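/- **Setting.** Fix integers $m\ge 1$ and $k$. A *formal Poisson scheme with one closed point* is $S=\operatorname{Spf}\mathcal O_S$, where $\mathcal O_S$ is a complete Noetherian local $\mathbf C$-algebra with maximal ideal $\mathfrak m_S$ and residue field $\mathbf C$, equipped with a Poisson bivector $\pi_S$, i.e. a Poisson bracket $\{f,g\}_S=\pi_S(f,g)$ on $\mathcal O_S$. Vector fields are $\mathbf C$-linear derivations of $\mathcal O_S$; $\xi^S_f=\{f,-\}_S$ is the Hamiltonian vector field of $f$; and $[\xi,\pi_S]$ is the Lie derivative, $[\xi,\pi_S](a,b)=\xi\{a,b\}_S-\{\xi a,b\}_S-\{a,\xi b\}_S$. Let $H(S)=\{\xi^S_f\}$ and $P(S)=\{p : [p,\pi_S]=0\}$. A vector field $\xi$ is called *tangent to the leaf at the closed point* if there is $f\in\mathcal O_S$ with $(\xi-\xi^S_f)(\mathfrak m_S)\subseteq\mathfrak m_S$ (if $\pi_S$ vanishes at the closed point, this says that $\xi$ vanishes there). For a vector field $\xi$ with $[\xi,\pi_S]=k\pi_S$, let $X(S,\pi_S,\xi)$ be the formal scheme $\mathbf C^\times\hat\times\Delta^{2m-1}\hat\times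 S$, with functions $\mathbf C[t,t^{-1}]\hat\otimes\mathbf C[[u,z_1,\dots,z_{2m-2}]]\hat\otimes\mathcal O_S$ (completed along the ideal generated by $u,z_1,\dots,z_{2m-2}$ and $\mathfrak m_S$), with $\mathbf C^\times$ acting by scaling $t$ only, and with the bivector $$t^{1-k}\,\partial_u\wedge\partial_t+\sum_{i=1}^{m-1}\partial_{z'_{2i-1}}\wedge\partial_{z_{2i}}+t^{-k}\,\partial_u\wedge\xi+t^{-k}\pi_S,$$ written in the coordinates $t,u,z'_{2i-1}=t^kz_{2i-1},z_{2i}$ (with $(D_1\wedge D_2)(a,b)=D_1(a)D_2(b)-D_2(a)D_1(b)$). Isomorphisms of such formal schemes are isomorphisms of the topological algebras of functions; a $\mathbf C^\times$-Poisson isomorphism is one that is $\mathbf C^\times$-equivariant and preserves the brackets. **Theorem.** Let $S,S'$ be formal Poisson schemes with one closed point, with Poisson bivectors $\pi_S,\pi_{S'}$. 1. Let $\xi,\xi'$ be vector fields on $S,S'$ with $[\xi,\pi_S]=k\pi_S$ and $[\xi',\pi_{S'}]=k\pi_{S'}$. If there is a Poisson isomorphism $S\to S'$ taking $\xi$ to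 $\xi'+\xi^{S'}_f$ for some $f\in\mathcal O_{S'}$, then $X(S,\pi_S,\xi)$ and $X(S',\pi_{S'},\xi')$ are $\mathbf C^\times$-Poisson isomorphic. If moreover $k=0$ or $\xi$ is tangent to the leaf at the closed point, then the converse also holds: $X(S,\pi_S,\xi)$ and $X(S',\pi_{S'},\xi')$ are $\mathbf C^\times$-Poisson isomorphic if and only if there is a Poisson isomorphism $S\to S'$ taking $\xi$ to $\xi'+\xi^{S'}_f$ for some $f\in\mathcal O_{S'}$. 2. If every Poisson vector field on $S$ is Hamiltonian, then for all vector fields $\xi,\xi'$ on $S$ with $[\xi,\pi_S]=k\pi_S=[\xi',\pi_S]$, $X(S,\pi_S,\xi)$ and $X(S,\pi_S,\xi')$ are $\mathbf C^\times$-Poisson isomorphic. 3. Call a vector field $\xi$ on $S$ *admissible* if $[\xi,\pi_S]=k\pi_S$ and ($k=0$ or $\xi$ is tangent to the leaf at the closed point). Let $P_k(S)$ be the space of $p\in P(S)$ such that $k=0$ or $p$ is tangent to the leaf at the closed point (so $P_0(S)=P(S)$ and $H(S)\subseteq P_k(S)$). For every admissible $\eta$, the map $\xi\mapsto\xi+H(S)$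 induces a bijection from the set of admissible $\xi$ modulo $\mathbf C^\times$-Poisson isomorphism of the $X(S,\pi_S,\xi)$ onto $(\eta+P_k(S)/H(S))/\operatorname{Aut}(S,\pi_S)$. -/

import Mathlib

open scoped TensorProduct LaurentPolynomial

noncomputable section

namespace FormalPoisson

/-! ### Bivector fields, Poisson structures, vector fields -/

section Bivectors

variable (L : Type*) [CommRing L] [Algebra ℂ L]

/-- Bivector fields on the (formal) affine scheme with ring of functions `L`: alternating
`ℂ`-bilinear operations on `L` which are derivations in each argument. -/
def Bivector : Submodule L (L →ₗ[ℂ] L →ₗ[ℂ] L) where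
  carrier := {P | (∀ a, P a a = 0) ∧ ∀ a b c, P a (b * c) = P a b * c + b * P a c}
  add_mem' := by
    rintro P Q ⟨hP, hP'⟩ ⟨hQ, hQ'⟩
    refine ⟨fun a => by simp [hP, hQ], fun a b c => ?_⟩
    simp only [LinearMap.add_apply, hP', hQ']
    ring
  zero_mem' := ⟨fun a => by simp, fun a b c => by simp⟩
  smul_mem' := by
    rintro r P ⟨hP, hP'⟩
    refine ⟨fun a => by simp [hP], fun a b c => ?_⟩
    simp only [LinearMap.smul_apply, hP', smul_eq_mul]
    ring

variable {L}

theorem bivector_leibniz_right (P : Bivector L) (a b c : L) :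
    P.1 a (b * c) = P.1 a b * c + b * P.1 a c := P.2.2 a b c

theorem bivector_skew (P : Bivector L) (a b : L) : P.1 a b = -P.1 b a := by
  have h := P.2.1 (a + b)
  simp only [map_add, LinearMap.add_apply, P.2.1] at h
  linear_combination h

/-- The wedge product of two vector fields: `(D₁ ∧ D₂)(a, b) = D₁ a · D₂ b - D₂ a · D₁ b`. -/
def wedge (D₁ D₂ : Derivation ℂ L L) : Bivector L :=
  ⟨LinearMap.mk₂ ℂ (fun a b => D₁ a * D₂ b - D₂ a * D₁ b)
      (fun a a' b => by simp only [map_add]; ring)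
      (fun c a b => by simp only [Derivation.map_smul, smul_mul_assoc, smul_sub])
      (fun a b b' => by simp only [map_add]; ring)
      (fun c a b => by simp only [Derivation.map_smul, mul_smul_comm, smul_sub]),
    fun a => by simp only [LinearMap.mk₂_apply]; ring,
    fun a b c => by
      simp only [LinearMap.mk₂_apply, Derivation.leibniz, smul_eq_mul]; ring⟩

/-- The Hamiltonian vector field `ξ_f = {f, -}` of a function `f`. -/
def hamiltonian (P : Bivector L) (f : L) : Derivation ℂ L L :=
  Derivation.mk' (P.1 f) fun a b => by
    rw [bivector_leibniz_right P, smul_eq_mul, smul_eq_mul]; ring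

/-- A bivector is Poisson when the associated bracket satisfies the Jacobi identity. -/
def IsPoisson (P : Bivector L) : Prop :=
  ∀ a b c, P.1 a (P.1 b c) + P.1 b (P.1 c a) + P.1 c (P.1 a b) = 0

/-- `[ξ, π] = k π`, where `[ξ, π]` is the Schouten–Nijenhuis bracket, i.e. the Lie derivative
of `π` along `ξ`. -/
def IsScaling (k : ℤ) (P : Bivector L) (ξ : Derivation ℂ L L) : Prop :=
  ∀ a b, ξ (P.1 a b) - P.1 (ξ a) b - P.1 a (ξ b) = (k : ℂ) • P.1 a b

end Bivectors

section Transport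

variable {A B : Type*} [CommRing A] [Algebra ℂ A] [CommRing B] [Algebra ℂ B]

/-- Transport of a vector field along an isomorphism of algebras: `φ ∘ D ∘ φ⁻¹`. -/
def transport (φ : A ≃ₐ[ℂ] B) (D : Derivation ℂ A A) : Derivation ℂ B B :=
  Derivation.mk' (φ.toLinearMap ∘ₗ (D : A →ₗ[ℂ] A) ∘ₗ φ.symm.toLinearMap) fun a b => by
    simp [Derivation.leibniz]

/-- `φ` is compatible with the brackets defined by two bivectors. -/
def IsPoissonEquiv (P : Bivector A) (Q : Bivector B) (φ : A ≃ₐ[ℂ] B) : Prop :=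
  ∀ a b, φ (P.1 a b) = Q.1 (φ a) (φ b)

/-- For `D` a vector field on the first factor of a product, the same vector field on the product
(acting trivially on the second factor). -/
def onLeft (D : Derivation ℂ A A) : Derivation ℂ (A ⊗[ℂ] B) (A ⊗[ℂ] B) :=
  Derivation.mk' ((D : A →ₗ[ℂ] A).rTensor B) fun x y => by
    induction x with
    | zero => simp
    | add x x' hx hx' => simp only [add_mul, map_add, hx, hx', add_smul, smul_add]; abel
    | tmul a b =>
      induction y with
      | zero => simp
      | add y y' hy hy' => simp only [mul_add, map_add, hy, hy', add_smul, smul_add]; abel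
      | tmul a' b' =>
        simp [Derivation.leibniz, TensorProduct.add_tmul, mul_comm b b']

/-- For `D` a vector field on the second factor of a product, the same vector field on the product
(acting trivially on the first factor). -/
def onRight (D : Derivation ℂ B B) : Derivation ℂ (A ⊗[ℂ] B) (A ⊗[ℂ] B) :=
  Derivation.mk' ((D : B →ₗ[ℂ] B).lTensor A) fun x y => by
    induction x with
    | zero => simp
    | add x x' hx hx' => simp only [add_mul, map_add, hx, hx', add_smul, smul_add]; abel
    | tmul a b =>
      induction y with
      | zero => simp
      | add y y' hy hy' => simp only [mul_add, map_add, hy, hy', add_smul, smul_add]; abel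
      | tmul a' b' =>
        simp [Derivation.leibniz, TensorProduct.tmul_add, mul_comm a a']

/-- The bilinear operation `(a ⊗ b, a' ⊗ b') ↦ a a' ⊗ P(b, b')`. -/
def baseChangeMap (P : Bivector B) : A ⊗[ℂ] B →ₗ[ℂ] A ⊗[ℂ] B →ₗ[ℂ] A ⊗[ℂ] B :=
  TensorProduct.map₂ (LinearMap.mul ℂ A) P.1

theorem baseChangeMap_tmul (P : Bivector B) (a a' : A) (b b' : B) :
    baseChangeMap P (a ⊗ₜ[ℂ] b) (a' ⊗ₜ[ℂ] b') = (a * a') ⊗ₜ[ℂ] P.1 b b' := by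
  simp [baseChangeMap]

theorem baseChangeMap_skew (P : Bivector B) (x y : A ⊗[ℂ] B) :
    baseChangeMap P x y = -baseChangeMap P y x := by
  induction x with
  | zero => simp
  | add x x' hx hx' => simp only [map_add, LinearMap.add_apply, hx, hx']; abel
  | tmul a b =>
    induction y with
    | zero => simp
    | add y y' hy hy' => simp only [map_add, LinearMap.add_apply, hy, hy']; abel
    | tmul a' b' =>
      rw [baseChangeMap_tmul, baseChangeMap_tmul, bivector_skew P, TensorProduct.tmul_neg, mul_comm]

/-- A bivector `P` on the second factor of a product, viewed as a bivector on the product. -/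
def bivectorOnRight (P : Bivector B) : Bivector (A ⊗[ℂ] B) :=
  ⟨baseChangeMap P, fun x => by
      have h := baseChangeMap_skew P x x
      have h2 : (2 : ℂ) • baseChangeMap P x x = 0 := by
        rw [two_smul]; nth_rewrite 1 [h]; simp
      exact (smul_eq_zero.mp h2).resolve_left two_ne_zero,
    fun x y z => by
      induction x with
      | zero => simp
      | add x x' hx hx' => simp only [map_add, LinearMap.add_apply, hx, hx']; ring
      | tmul a b =>
        induction y with
        | zero => simp
        | add y y' hy hy' => simp only [add_mul, map_add, hy, hy']; ring
        | tmul a' b' =>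
          induction z with
          | zero => simp
          | add z z' hz hz' => simp only [mul_add, map_add, hz, hz']; ring
          | tmul a'' b'' =>
            simp only [Algebra.TensorProduct.tmul_mul_tmul, baseChangeMap_tmul,
              bivector_leibniz_right P, TensorProduct.tmul_add]
            rw [mul_assoc a a' a'', ← mul_assoc a' a a'', mul_comm a' a, mul_assoc a a' a'']⟩

end Transport

/-! ### Adic completions: topology, brackets, automorphisms -/

section Completion

variable {L : Type*} [CommRing L] (I : Ideal L)

/-- The inverse limit topology on `lim L / Iⁿ`, each `L / Iⁿ` being discrete. -/
instance completionTopology : TopologicalSpace (AdicCompletion I L) :=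
  ⨅ n : ℕ, TopologicalSpace.induced (AdicCompletion.evalₐ I n) ⊥

variable {I}

/-- A representative in `L` of the `n`-th component in `L / Iⁿ`. -/
def rep (x : AdicCompletion I L) (n : ℕ) : L :=
  Function.surjInv Ideal.Quotient.mk_surjective (AdicCompletion.evalₐ I n x)

theorem mk_rep (x : AdicCompletion I L) (n : ℕ) :
    Ideal.Quotient.mk (I ^ n) (rep x n) = AdicCompletion.evalₐ I n x :=
  Function.surjInv_eq _ _

theorem factorPow_evalₐ {m n : ℕ} (hle : m ≤ n) (x : AdicCompletion I L) :
    Ideal.Quotient.factorPow I hle (AdicCompletion.evalₐ I n x) = AdicCompletion.evalₐ I m x := by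
  induction x using AdicCompletion.induction_on with
  | h f =>
    rw [AdicCompletion.evalₐ_mk, AdicCompletion.evalₐ_mk]
    exact AdicCompletion.Ideal.mk_eq_mk I hle f

theorem rep_sub_mem (x : AdicCompletion I L) (n : ℕ) : rep x n - rep x (n + 1) ∈ I ^ n := by
  rw [← Ideal.Quotient.eq, mk_rep]
  have h : Ideal.Quotient.mk (I ^ n) (rep x (n + 1)) =
      Ideal.Quotient.factorPow I (Nat.le_succ n)
        (Ideal.Quotient.mk (I ^ (n + 1)) (rep x (n + 1))) := rfl
  rw [h, mk_rep, factorPow_evalₐ]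

variable [Algebra ℂ L]

theorem derivation_mem (D : Derivation ℂ L L) (n : ℕ) {x : L} (hx : x ∈ I ^ (n + 1)) :
    D x ∈ I ^ n := by
  induction n generalizing x with
  | zero => simp
  | succ n ih =>
    rw [pow_succ] at hx
    refine Submodule.mul_induction_on hx (fun a ha b hb => ?_) (fun a b ha hb => ?_)
    · rw [Derivation.leibniz, smul_eq_mul, smul_eq_mul]
      refine Ideal.add_mem _ (Ideal.mul_mem_right _ _ ha) ?_
      rw [pow_succ, mul_comm b]
      exact Ideal.mul_mem_mul (ih ha) hb
    · rw [map_add]; exact Ideal.add_mem _ ha hb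

theorem bivector_mem_right (P : Bivector L) (n : ℕ) (x : L) {y : L} (hy : y ∈ I ^ (n + 1)) :
    P.1 x y ∈ I ^ n := derivation_mem (hamiltonian P x) n hy

theorem bivector_mem_left (P : Bivector L) (n : ℕ) (y : L) {x : L} (hx : x ∈ I ^ (n + 1)) :
    P.1 x y ∈ I ^ n := by
  rw [bivector_skew P]; exact neg_mem (bivector_mem_right P n y hx)

/-- The continuous extension to the completion of the bracket defined by a bivector on `L`:
its `n`-th component is the class of `P(xₙ₊₁, yₙ₊₁)` modulo `Iⁿ`. -/
def bracket (P : Bivector L) (x y : AdicCompletion I L) : AdicCompletion I L :=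
  AdicCompletion.mk I L <| AdicCompletion.AdicCauchySequence.mk I L
    (fun n => P.1 (rep x (n + 1)) (rep y (n + 1))) fun n => by
      rw [SModEq.sub_mem, smul_eq_mul, Ideal.mul_top]
      have h : P.1 (rep x (n + 1)) (rep y (n + 1)) - P.1 (rep x (n + 1 + 1)) (rep y (n + 1 + 1)) =
          P.1 (rep x (n + 1) - rep x (n + 1 + 1)) (rep y (n + 1)) +
          P.1 (rep x (n + 1 + 1)) (rep y (n + 1) - rep y (n + 1 + 1)) := by
        simp only [map_sub, LinearMap.sub_apply]; abel
      rw [h]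
      exact Ideal.add_mem _ (bivector_mem_left P n _ (rep_sub_mem x (n + 1)))
        (bivector_mem_right P n _ (rep_sub_mem y (n + 1)))

theorem pow_le_comap {σ : L →ₐ[ℂ] L} (h : I ≤ I.comap σ) (n : ℕ) : I ^ n ≤ (I ^ n).comap σ :=
  (Ideal.pow_right_mono h n).trans (Ideal.le_comap_pow σ n)

/-- The continuous extension to the completion of an endomorphism `σ` of `L` preserving `I`. -/
def completeHom (σ : L →ₐ[ℂ] L) (h : I ≤ I.comap σ) :
    AdicCompletion I L →ₐ[ℂ] AdicCompletion I L :=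
  AdicCompletion.liftAlgHom I
    (fun n => (Ideal.quotientMapₐ (I ^ n) σ (pow_le_comap h n)).comp
      ((AdicCompletion.evalₐ I n).restrictScalars ℂ)) fun {m n} hle => by
    ext x
    have hx : AdicCompletion.evalₐ I m x = Ideal.Quotient.mk (I ^ m) (rep x n) := by
      rw [← factorPow_evalₐ hle, ← mk_rep x n]; rfl
    change Ideal.Quotient.factorₐ ℂ (Ideal.pow_le_pow_right hle) (Ideal.quotientMapₐ (I ^ n) σ (pow_le_comap h n)
      (AdicCompletion.evalₐ I n x)) =
      Ideal.quotientMapₐ (I ^ m) σ (pow_le_comap h m) (AdicCompletion.evalₐ I m x)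
    rw [hx, ← mk_rep x n]
    rfl

end Completion

/-! ### The product of the punctured line, a formal disk and a formal slice -/

/-- `Spf A` is a formal germ: `A` is a complete Noetherian local `ℂ`-algebra with residue field
`ℂ`, so `Spf A` has a single closed point. -/
class IsFormalGerm (A : Type*) [CommRing A] [Algebra ℂ A] : Prop where
  isLocalRing : IsLocalRing A
  isNoetherianRing : IsNoetherianRing A
  isAdicComplete : IsAdicComplete (IsLocalRing.maximalIdeal A) A
  residue_surjective :
    Function.Surjective (algebraMap ℂ (IsLocalRing.ResidueField A))

attribute [instance] IsFormalGerm.isLocalRing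

/-- Indices for the `2 m - 1` coordinates `u, z₁, …, z₂ₘ₋₂` of the formal disk: `inl ()` stands
for `u`, `inr (inl i)` for `z_{2i-1}` and `inr (inr i)` for `z_{2i}`. -/
abbrev DiskCoord (m : ℕ) : Type := Unit ⊕ (Fin (m - 1) ⊕ Fin (m - 1))

/-- Functions on the punctured line times affine space: `ℂ[t, t⁻¹] ⊗ ℂ[u, z₁, …, z₂ₘ₋₂]`. -/
def Base (m : ℕ) : Type := ℂ[T;T⁻¹] ⊗[ℂ] MvPolynomial (DiskCoord m) ℂ

instance baseCommRing (m : ℕ) : CommRing (Base m) :=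
  inferInstanceAs (CommRing (ℂ[T;T⁻¹] ⊗[ℂ] MvPolynomial (DiskCoord m) ℂ))

instance baseAlgebra (m : ℕ) : Algebra ℂ (Base m) :=
  inferInstanceAs (Algebra ℂ (ℂ[T;T⁻¹] ⊗[ℂ] MvPolynomial (DiskCoord m) ℂ))

/-- The function `f(t) g(u, z)` on the punctured line times affine space. -/
def Base.mk {m : ℕ} (f : ℂ[T;T⁻¹]) (g : MvPolynomial (DiskCoord m) ℂ) : Base m := f ⊗ₜ[ℂ] g

/-- `ℂ[t, t⁻¹] ⊗ ℂ[u, z₁, …, z₂ₘ₋₂] ⊗ A`, before completion. -/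
abbrev PreFun (m : ℕ) (A : Type*) [CommRing A] [Algebra ℂ A] : Type _ := Base m ⊗[ℂ] A

/-- The linear map `tⁿ ↦ n tⁿ⁻¹` on `ℂ[t, t⁻¹]`. -/
def laurentDerivMap : ℂ[T;T⁻¹] →ₗ[ℂ] ℂ[T;T⁻¹] :=
  (Finsupp.lsum ℂ fun n : ℤ =>
      LinearMap.toSpanSingleton ℂ ℂ[T;T⁻¹] ((n : ℂ) • LaurentPolynomial.T (n - 1))) ∘ₗ
        (AddMonoidAlgebra.coeffLinearEquiv ℂ).toLinearMap

theorem laurentDerivMap_T (n : ℤ) : laurentDerivMap (LaurentPolynomial.T n) =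
    (n : ℂ) • LaurentPolynomial.T (n - 1) := by
  have h : AddMonoidAlgebra.coeffLinearEquiv ℂ (LaurentPolynomial.T (R := ℂ) n) =
      Finsupp.single n (1 : ℂ) := rfl
  rw [laurentDerivMap, LinearMap.comp_apply, LinearEquiv.coe_coe, h, Finsupp.lsum_single,
    LinearMap.toSpanSingleton_apply, one_smul]

theorem laurentDerivMap_mul (p q : ℂ[T;T⁻¹]) :
    laurentDerivMap (p * q) = p • laurentDerivMap q + q • laurentDerivMap p := by
  induction p using LaurentPolynomial.induction_on' with
  | add p p' hp hp' => simp only [add_mul, map_add, hp, hp', add_smul, smul_add]; abel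
  | C_mul_T n a =>
    induction q using LaurentPolynomial.induction_on' with
    | add q q' hq hq' => simp only [mul_add, map_add, hq, hq', add_smul, smul_add]; abel
    | C_mul_T n' a' =>
      simp only [← LaurentPolynomial.smul_eq_C_mul, smul_mul_smul_comm, map_smul,
        ← LaurentPolynomial.T_add, laurentDerivMap_T, smul_eq_mul, smul_smul]
      have h1 : n + (n' - 1) = n + n' - 1 := by ring
      have h2 : n' + (n - 1) = n + n' - 1 := by ring
      rw [h1, h2, ← add_smul]
      congr 1
      push_cast; ring

/-- The vector field `d/dt` on the punctured line. -/
def laurentDeriv : Derivation ℂ ℂ[T;T⁻¹] ℂ[T;T⁻¹] :=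
  Derivation.mk' laurentDerivMap laurentDerivMap_mul

/-- `∂_t` on the punctured line times affine space. -/
def baseDerivT (m : ℕ) : Derivation ℂ (Base m) (Base m) :=
  onLeft (A := ℂ[T;T⁻¹]) (B := MvPolynomial (DiskCoord m) ℂ) laurentDeriv

theorem baseDerivT_mk {m : ℕ} (f : ℂ[T;T⁻¹]) (g : MvPolynomial (DiskCoord m) ℂ) :
    baseDerivT m (Base.mk f g) = Base.mk (laurentDeriv f) g :=
  LinearMap.rTensor_tmul _ _ _ _

/-- Partial derivatives along the disk coordinates on the punctured line times affine space. -/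
def baseDerivDisk (m : ℕ) (i : DiskCoord m) : Derivation ℂ (Base m) (Base m) :=
  onRight (A := ℂ[T;T⁻¹]) (B := MvPolynomial (DiskCoord m) ℂ) (MvPolynomial.pderiv i)

theorem baseDerivDisk_mk {m : ℕ} (i : DiskCoord m) (f : ℂ[T;T⁻¹])
    (g : MvPolynomial (DiskCoord m) ℂ) :
    baseDerivDisk m i (Base.mk f g) = Base.mk f (MvPolynomial.pderiv i g) :=
  LinearMap.lTensor_tmul _ _ _ _

section Product

variable (m : ℕ) (A : Type*) [CommRing A] [Algebra ℂ A]

/-- The power `tⁿ` of the coordinate on the punctured line. -/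
def tPow (n : ℤ) : PreFun m A := Base.mk (LaurentPolynomial.T n) 1 ⊗ₜ 1

/-- The disk coordinate with index `i`. -/
def coord (i : DiskCoord m) : PreFun m A := Base.mk 1 (MvPolynomial.X i) ⊗ₜ 1

/-- A function on the slice, viewed on the product. -/
def fromSlice (a : A) : PreFun m A := 1 ⊗ₜ a

/-- `∂_t` in the coordinate system `t, u, z₁, …, z₂ₘ₋₂`. -/
def partialT : Derivation ℂ (PreFun m A) (PreFun m A) := onLeft (baseDerivT m)

/-- The partial derivative along the disk coordinate with index `i`, in the coordinate system
`t, u, z₁, …, z₂ₘ₋₂`. -/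
def partialDisk (i : DiskCoord m) : Derivation ℂ (PreFun m A) (PreFun m A) :=
  onLeft (baseDerivDisk m i)

/-- `∂_u`. -/
def partialU : Derivation ℂ (PreFun m A) (PreFun m A) := partialDisk m A (Sum.inl ())

/-- `∂_t` in the coordinate system `t, u, z'₁, z₂, z'₃, z₄, …`, where `z'_{2i-1} = tᵏ z_{2i-1}`:
by the chain rule it is `∂_t - k t⁻¹ ∑ᵢ z_{2i-1} ∂_{z_{2i-1}}` in the original coordinates. -/
def partialT' (k : ℤ) : Derivation ℂ (PreFun m A) (PreFun m A) :=
  partialT m A - ∑ i : Fin (m - 1),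
    ((k : PreFun m A) * tPow m A (-1) * coord m A (Sum.inr (Sum.inl i))) •
      partialDisk m A (Sum.inr (Sum.inl i))

/-- `∂_{z'_{2i-1}} = t⁻ᵏ ∂_{z_{2i-1}}`. -/
def partialZ' (k : ℤ) (i : Fin (m - 1)) : Derivation ℂ (PreFun m A) (PreFun m A) :=
  tPow m A (-k) • partialDisk m A (Sum.inr (Sum.inl i))

/-- The standard bivector of degree `-k` on the punctured line times the disk:
`t¹⁻ᵏ ∂_u ∧ ∂_t + ∑ᵢ ∂_{z'_{2i-1}} ∧ ∂_{z_{2i}}` in the coordinates `t, u, z'₁, z₂, z'₃, …`. -/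
def standardBivector (k : ℤ) : Bivector (PreFun m A) :=
  tPow m A (1 - k) • wedge (partialU m A) (partialT' m A k) +
    ∑ i : Fin (m - 1), wedge (partialZ' m A k i) (partialDisk m A (Sum.inr (Sum.inr i)))

/-- The bivector `π_{2m,-k} + t⁻ᵏ ∂_u ∧ ξ + t⁻ᵏ π_S` attached to a bivector `π_S` and a vector
field `ξ` on the slice. -/
def totalBivector {A : Type*} [CommRing A] [Algebra ℂ A] (k : ℤ) (P : Bivector A)
    (ξ : Derivation ℂ A A) : Bivector (PreFun m A) :=
  standardBivector m A k + tPow m A (-k) • wedge (partialU m A) (onRight ξ) +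
    tPow m A (-k) • bivectorOnRight P

/-- The ideal of the punctured line `t ≠ 0` times the origin of the disk and of the slice,
generated by the disk coordinates and by the maximal ideal of the slice. -/
def lineIdeal [IsLocalRing A] : Ideal (PreFun m A) :=
  Ideal.span (Set.range (coord m A) ∪ fromSlice m A '' IsLocalRing.maximalIdeal A)

/-- The topological algebra of functions `ℂ[t, t⁻¹] ⊗̂ ℂ⟦u, z₁, …, z₂ₘ₋₂⟧ ⊗̂ A` on the product of
formal schemes `ℂˣ ×̂ Δ²ᵐ⁻¹ ×̂ Spf A`. -/
abbrev FormalFun [IsLocalRing A] : Type _ := AdicCompletion (lineIdeal m A) (PreFun m A)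

/-- The automorphism `tⁿ ↦ cⁿ tⁿ` of `ℂ[t, t⁻¹]`. -/
def laurentScale (c : ℂˣ) : ℂ[T;T⁻¹] →ₐ[ℂ] ℂ[T;T⁻¹] :=
  AddMonoidAlgebra.lift ℂ ℂ[T;T⁻¹] ℤ
    { toFun := fun n => ((c ^ n.toAdd : ℂˣ) : ℂ) • LaurentPolynomial.T n.toAdd
      map_one' := by simp
      map_mul' := fun a b => by
        simp only [toAdd_mul, zpow_add, LaurentPolynomial.T_add, Units.val_mul,
          smul_mul_smul_comm] }

/-- The automorphism `f(t) g(u, z) ↦ f(c t) g(u, z)`. -/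
def baseScale (c : ℂˣ) : Base m →ₐ[ℂ] Base m :=
  Algebra.TensorProduct.map (laurentScale c) (AlgHom.id ℂ (MvPolynomial (DiskCoord m) ℂ))

theorem baseScale_mk (c : ℂˣ) (f : ℂ[T;T⁻¹]) (g : MvPolynomial (DiskCoord m) ℂ) :
    baseScale m c (Base.mk f g) = Base.mk (laurentScale c f) g :=
  Algebra.TensorProduct.map_tmul _ _ _ _

/-- The action of `c ∈ ℂˣ` on functions before completion, through the first factor only. -/
def preAction (c : ℂˣ) : PreFun m A →ₐ[ℂ] PreFun m A :=
  Algebra.TensorProduct.map (A := Base m) (C := Base m) (baseScale m c) (AlgHom.id ℂ A)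

theorem lineIdeal_le_comap [IsLocalRing A] (c : ℂˣ) :
    lineIdeal m A ≤ (lineIdeal m A).comap (preAction m A c) := by
  unfold lineIdeal
  rw [Ideal.span_le]
  rintro x (⟨i, rfl⟩ | ⟨a, ha, rfl⟩)
  · have h : preAction m A c (coord m A i) = coord m A i := by
      rw [coord, preAction, Algebra.TensorProduct.map_tmul, baseScale_mk, map_one]; rfl
    rw [SetLike.mem_coe, Ideal.mem_comap, h]
    exact Ideal.subset_span (Or.inl ⟨i, rfl⟩)
  · have h : preAction m A c (fromSlice m A a) = fromSlice m A a := by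
      rw [fromSlice, preAction, Algebra.TensorProduct.map_tmul, map_one]; rfl
    rw [SetLike.mem_coe, Ideal.mem_comap, h]
    exact Ideal.subset_span (Or.inr ⟨a, ha, rfl⟩)

/-- The action of `ℂˣ` on functions on the product, by scaling the first factor. -/
def action [IsLocalRing A] (c : ℂˣ) : FormalFun m A →ₐ[ℂ] FormalFun m A :=
  completeHom (preAction m A c) (lineIdeal_le_comap m A c)

end Product

/-! ### Isomorphisms -/

section Isomorphisms

variable {A A' : Type*} [CommRing A] [Algebra ℂ A] [CommRing A'] [Algebra ℂ A']

/-- The formal Poisson schemes `ℂˣ ×̂ Δ²ᵐ⁻¹ ×̂ S` and `ℂˣ ×̂ Δ²ᵐ⁻¹ ×̂ S'`, with `S = Spf A` and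
`S' = Spf A'`, are `ℂˣ`-equivariantly Poisson isomorphic: there is an isomorphism of topological
algebras of functions commuting with the `ℂˣ`-actions and with the Poisson brackets. -/
def TotalIso [IsLocalRing A] [IsLocalRing A'] (m : ℕ) (k : ℤ)
    (P : Bivector A) (ξ : Derivation ℂ A A)
    (P' : Bivector A') (ξ' : Derivation ℂ A' A') : Prop :=
  ∃ Φ : FormalFun m A' ≃A[ℂ] FormalFun m A,
    (∀ (c : ℂˣ) (x : FormalFun m A'), Φ (action m A' c x) = action m A c (Φ x)) ∧
    ∀ x y : FormalFun m A', Φ (bracket (totalBivector m k P' ξ') x y) =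
      bracket (totalBivector m k P ξ) (Φ x) (Φ y)

/-- There is a Poisson isomorphism `S → S'` (given by its pullback `φ : A' → A` on functions)
which takes `ξ` to `ξ' + ξ_f`, for some function `f` on `S'`. -/
def SliceIso (P : Bivector A) (ξ : Derivation ℂ A A)
    (P' : Bivector A') (ξ' : Derivation ℂ A' A') : Prop :=
  ∃ φ : A' ≃ₐ[ℂ] A, IsPoissonEquiv P' P φ ∧
    ∃ f : A', transport φ.symm ξ = ξ' + hamiltonian P' f

/-- At the closed point of `S`, the tangent vector defined by `ξ` is tangent to the symplectic
leaf, i.e. it is the value of a Hamiltonian vector field. -/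
def LeafTangent [IsLocalRing A] (P : Bivector A) (ξ : Derivation ℂ A A) : Prop :=
  ∃ f : A, ∀ a ∈ IsLocalRing.maximalIdeal A, ξ a - P.1 f a ∈ IsLocalRing.maximalIdeal A

theorem totalIso_refl [IsLocalRing A] (m : ℕ) (k : ℤ) (P : Bivector A) (ξ : Derivation ℂ A A) :
    TotalIso m k P ξ P ξ :=
  ⟨ContinuousAlgEquiv.refl ℂ _, fun _ _ => rfl, fun _ _ => rfl⟩

theorem TotalIso.symm [IsLocalRing A] [IsLocalRing A'] {m : ℕ} {k : ℤ} {P : Bivector A}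
    {ξ : Derivation ℂ A A} {P' : Bivector A'} {ξ' : Derivation ℂ A' A'}
    (h : TotalIso m k P ξ P' ξ') : TotalIso m k P' ξ' P ξ := by
  obtain ⟨Φ, h1, h2⟩ := h
  refine ⟨Φ.symm, fun c x => ?_, fun x y => ?_⟩
  · apply Φ.injective
    change Φ (Φ.symm _) = Φ _
    rw [h1, Φ.apply_symm_apply, Φ.apply_symm_apply]
  · apply Φ.injective
    change Φ (Φ.symm _) = Φ _
    rw [h2, Φ.apply_symm_apply, Φ.apply_symm_apply, Φ.apply_symm_apply]

theorem TotalIso.trans {A'' : Type*} [CommRing A''] [Algebra ℂ A''] [IsLocalRing A]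
    [IsLocalRing A'] [IsLocalRing A''] {m : ℕ} {k : ℤ} {P : Bivector A}
    {ξ : Derivation ℂ A A} {P' : Bivector A'} {ξ' : Derivation ℂ A' A'} {P'' : Bivector A''}
    {ξ'' : Derivation ℂ A'' A''} (h : TotalIso m k P ξ P' ξ') (h' : TotalIso m k P' ξ' P'' ξ'') :
    TotalIso m k P ξ P'' ξ'' := by
  obtain ⟨Φ, h1, h2⟩ := h
  obtain ⟨Ψ, h3, h4⟩ := h'
  refine ⟨Ψ.trans Φ, fun c x => ?_, fun x y => ?_⟩
  · simp only [ContinuousAlgEquiv.trans_apply, h3, h1]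
  · simp only [ContinuousAlgEquiv.trans_apply, h4, h2]

end Isomorphisms

/-! ### Classes of vector fields modulo Hamiltonian ones -/

section Classes

variable {A : Type*} [CommRing A] [Algebra ℂ A]

/-- The space `H(S)` of Hamiltonian vector fields. -/
def hamiltonianFields (P : Bivector A) : Submodule ℂ (Derivation ℂ A A) :=
  LinearMap.range
    ({ toFun := hamiltonian P
       map_add' := fun f g => by ext a; simp [hamiltonian]
       map_smul' := fun c f => by ext a; simp [hamiltonian] } : A →ₗ[ℂ] Derivation ℂ A A)

/-- The vector fields `ξ` on `S` with `[ξ, π_S] = k π_S` which moreover, when `k ≠ 0`, are tangent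
to the symplectic leaf at the closed point. -/
def IsAdmissible [IsLocalRing A] (k : ℤ) (P : Bivector A) (ξ : Derivation ℂ A A) : Prop :=
  IsScaling k P ξ ∧ (k = 0 ∨ LeafTangent P ξ)

/-- The space `P(S)` of Poisson vector fields `p`, i.e. `[p, π_S] = 0`. -/
def poissonFields (P : Bivector A) : Submodule ℂ (Derivation ℂ A A) where
  carrier := {p | IsScaling 0 P p}
  add_mem' := by
    intro p q hp hq a b
    have h1 := hp a b
    have h2 := hq a b
    simp only [Int.cast_zero, zero_smul] at h1 h2
    simp only [Derivation.add_apply, map_add, LinearMap.add_apply, Int.cast_zero, zero_smul]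
    linear_combination h1 + h2
  zero_mem' := fun a b => by simp
  smul_mem' := by
    intro c p hp a b
    have h1 := hp a b
    simp only [Int.cast_zero, zero_smul] at h1
    simp only [Derivation.smul_apply, map_smul, LinearMap.smul_apply, Int.cast_zero, zero_smul,
      ← smul_sub, h1, smul_zero]

/-- The Poisson vector fields on `S` which moreover, when `k ≠ 0`, are tangent to the symplectic
leaf at the closed point. -/
def admissiblePoissonFields [IsLocalRing A] (k : ℤ) (P : Bivector A) :
    Submodule ℂ (Derivation ℂ A A) where
  carrier := {p | p ∈ poissonFields P ∧ (k = 0 ∨ LeafTangent P p)}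
  add_mem' := by
    rintro p q ⟨hp, hp'⟩ ⟨hq, hq'⟩
    refine ⟨add_mem hp hq, ?_⟩
    rcases hp' with h | ⟨f, hf⟩
    · exact Or.inl h
    rcases hq' with h | ⟨g, hg⟩
    · exact Or.inl h
    refine Or.inr ⟨f + g, fun a ha => ?_⟩
    have : (p + q) a - P.1 (f + g) a = (p a - P.1 f a) + (q a - P.1 g a) := by
      simp only [Derivation.add_apply, map_add, LinearMap.add_apply]; ring
    rw [this]
    exact add_mem (hf a ha) (hg a ha)
  zero_mem' := ⟨zero_mem _, Or.inr ⟨0, fun a _ => by simp⟩⟩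
  smul_mem' := by
    rintro c p ⟨hp, hp'⟩
    refine ⟨Submodule.smul_mem _ c hp, ?_⟩
    rcases hp' with h | ⟨f, hf⟩
    · exact Or.inl h
    refine Or.inr ⟨c • f, fun a ha => ?_⟩
    have : (c • p) a - P.1 (c • f) a = algebraMap ℂ A c * (p a - P.1 f a) := by
      rw [← Algebra.smul_def, map_smul, LinearMap.smul_apply, Derivation.smul_apply, smul_sub]
    rw [this]
    exact Ideal.mul_mem_left _ _ (hf a ha)

/-- The group `Aut(S, π_S)` of Poisson automorphisms. -/
def poissonAut (P : Bivector A) : Subgroup (A ≃ₐ[ℂ] A) where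
  carrier := {φ | IsPoissonEquiv P P φ}
  mul_mem' := by
    intro φ ψ hφ hψ a b
    rw [AlgEquiv.mul_apply, hψ a b, hφ]; rfl
  one_mem' := fun a b => rfl
  inv_mem' := by
    intro φ hφ a b
    apply φ.injective
    rw [hφ]
    simp only [← AlgEquiv.mul_apply, mul_inv_cancel, AlgEquiv.one_apply]

/-- Transport of vector fields as a linear map. -/
def transportₗ (φ : A ≃ₐ[ℂ] A) : Derivation ℂ A A →ₗ[ℂ] Derivation ℂ A A where
  toFun := transport φ
  map_add' D D' := by ext a; exact map_add φ _ _
  map_smul' c D := by ext a; exact map_smul φ c _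

theorem hamiltonianFields_le (P : Bivector A) (g : poissonAut P) :
    hamiltonianFields P ≤ (hamiltonianFields P).comap (transportₗ g.1) := by
  rintro _ ⟨f, rfl⟩
  refine ⟨g.1 f, ?_⟩
  ext a
  have h := g.2 f (g.1.symm a)
  simp only [AlgEquiv.apply_symm_apply] at h
  exact h.symm

/-- `Aut(S, π_S)` acts by transport on vector fields modulo Hamiltonian vector fields. -/
instance poissonAutAction (P : Bivector A) :
    MulAction (poissonAut P) (Derivation ℂ A A ⧸ hamiltonianFields P) where
  smul g c := Submodule.mapQ _ _ (transportₗ g.1) (hamiltonianFields_le P g) c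
  one_smul c := by
    induction c using Submodule.Quotient.induction_on with
    | H D => exact congrArg Submodule.Quotient.mk (by ext a; rfl)
  mul_smul g h c := by
    induction c using Submodule.Quotient.induction_on with
    | H D => exact congrArg Submodule.Quotient.mk (by ext a; rfl)

variable [IsLocalRing A]

/-- The affine space `η + P(S) / H(S)`, where for `k ≠ 0` only Poisson vector fields tangent to
the symplectic leaf at the closed point are used. -/
def etaCoset (k : ℤ) (P : Bivector A) (η : Derivation ℂ A A) :
    Set (Derivation ℂ A A ⧸ hamiltonianFields P) :=
  {c | ∃ p ∈ admissiblePoissonFields k P, c = Submodule.Quotient.mk (η + p)}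

/-- Two elements of `η + P(S) / H(S)` are equivalent when they are in the same
`Aut(S, π_S)`-orbit. -/
def cosetSetoid (k : ℤ) (P : Bivector A) (η : Derivation ℂ A A) : Setoid (etaCoset k P η) :=
  (MulAction.orbitRel (poissonAut P) (Derivation ℂ A A ⧸ hamiltonianFields P)).comap
    Subtype.val

/-- Two admissible vector fields on `S` are equivalent when the bivectors which they define on
`ℂˣ ×̂ Δ²ᵐ⁻¹ ×̂ S` are `ℂˣ`-Poisson isomorphic. -/
def totalSetoid (m : ℕ) (k : ℤ) (P : Bivector A) :
    Setoid {ξ : Derivation ℂ A A // IsAdmissible k P ξ} where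
  r ξ ξ' := TotalIso m k P ξ.1 P ξ'.1
  iseqv := ⟨fun ξ => totalIso_refl m k P ξ.1, fun h => h.symm, fun h h' => h.trans h'⟩

theorem mk_mem_etaCoset {k : ℤ} {P : Bivector A} {η ξ : Derivation ℂ A A}
    (hη : IsAdmissible k P η) (hξ : IsAdmissible k P ξ) :
    (Submodule.Quotient.mk ξ : Derivation ℂ A A ⧸ hamiltonianFields P) ∈ etaCoset k P η := by
  refine ⟨ξ - η, ⟨fun a b => ?_, ?_⟩, by simp⟩
  · have h1 := hη.1 a b
    have h2 := hξ.1 a b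
    simp only [Derivation.sub_apply, map_sub, LinearMap.sub_apply, Int.cast_zero, zero_smul]
    linear_combination h2 - h1
  · rcases hη.2 with h | ⟨f, hf⟩
    · exact Or.inl h
    rcases hξ.2 with h | ⟨g, hg⟩
    · exact Or.inl h
    refine Or.inr ⟨g - f, fun a ha => ?_⟩
    have : (ξ - η) a - P.1 (g - f) a = (ξ a - P.1 g a) - (η a - P.1 f a) := by
      simp only [Derivation.sub_apply, map_sub, LinearMap.sub_apply]; ring
    rw [this]
    exact sub_mem (hg a ha) (hf a ha)

end Classes

end FormalPoisson

namespace FormalPoisson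

/-! ### Adically complete algebras -/

section Adic

variable {B : Type*} [CommRing B] {I : Ideal B}

/-! The bivector on X(S, π, ξ) is homogeneous of degree -k in t, and (S, ξ) can be recovered from
the formal neighbourhood of the point t = 1 together with its bracket Q and the field D = -t∂_t,
which satisfies [D, Q] = kQ. On that neighbourhood t - 1 (multiplied by a suitable unit), u, t^k
z_{2i-1} and z_{2i} form Darboux coordinates, so it is a symplectic disk of dimension 2m times S.
The field D + {t^k u, -} preserves the coisotropic subscheme where t - 1 and the z_{2i} vanish, and
induces ξ on its reduction S (`hasSlice_of_hom`, `hasSlice_point`).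

From slices to total spaces everything is explicit. A Poisson isomorphism of slices extends to the
products, and a Hamiltonian correction ξ_f is absorbed by shifting u by a multiple of f
(`substitution_bivector`, `SliceIso.totalIso`).

For the converse, let Φ be an equivariant Poisson isomorphism. It commutes with t∂_t, because modulo
powers of the ideal t∂_t is a polynomial in the action of a single element of infinite order
(`formalEuler_map`). It may move the point t = 1 to t = c; composing with a rescaling brings it
back, at the price of replacing π_S by c^k π_S (`TotalIso.exists_normalized`). Then Φ identifies the
two completions with their brackets and fields D, and both slices sit inside one formal germ. What
remains is a cancellation theorem (`HasSlice.sliceIso`): if a germ is a symplectic disk times A and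
also times A', then A and A' are isomorphic, with fields matching up to Hamiltonian ones.

Cancellation proceeds one Darboux pair x, y at a time. The centralizer Z of the pair is a complement
to the ideal (x, y), and it is also the coisotropic reduction of the hypersurface x = 0. So Z
depends only on that hypersurface, and symmetrically only on y = 0. Any two pairs are joined by a
chain in which consecutive pairs share a hypersurface, hence their centralizers are isomorphic
(`IsCut.sliceIso`).

Finally the factor c^k has to be removed. It is 1 for k = 0. If ξ is tangent to the leaf, a
Hamiltonian correction makes it vanish at the closed point; it then acts on the finite-dimensional
quotients A / 𝔪ⁿ, and exponentiating its semisimple part gives automorphisms that commute with it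
and rescale π_S by any nonzero constant (`exists_flow`, `sliceIso_smul`). Parts 2 and 3 are formal
consequences. -/

theorem eq_zero_of_forall_mem_pow [IsAdicComplete I B] {b : B} (h : ∀ n, b ∈ I ^ n) : b = 0 :=
  IsHausdorff.haus (inferInstance : IsHausdorff I B) b fun n => by
    rw [SModEq.zero, smul_eq_mul, Ideal.mul_top]; exact h n

theorem sub_mem_pow_of_le {f : ℕ → B} (hf : ∀ n, f (n + 1) - f n ∈ I ^ n) {m n : ℕ} (h : m ≤ n) :
    f n - f m ∈ I ^ m := by
  induction n, h using Nat.le_induction with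
  | base => simp
  | succ n hmn ih =>
    rw [← sub_add_sub_cancel _ (f n)]
    exact add_mem (Ideal.pow_le_pow_right hmn (hf n)) ih

theorem exists_adic_limit [IsAdicComplete I B] {f : ℕ → B} (hf : ∀ n, f (n + 1) - f n ∈ I ^ n) :
    ∃ b, ∀ n, b - f n ∈ I ^ n := by
  obtain ⟨b, hb⟩ := IsPrecomplete.prec (inferInstance : IsPrecomplete I B) (f := f) fun {m n} h => by
    rw [SModEq.sub_mem, smul_eq_mul, Ideal.mul_top, ← neg_sub]
    exact neg_mem (sub_mem_pow_of_le hf h)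
  refine ⟨b, fun n => ?_⟩
  have := hb n
  rw [SModEq.sub_mem, smul_eq_mul, Ideal.mul_top, ← neg_sub] at this
  exact neg_mem_iff.mp this

theorem isAdicComplete_of_limits (h0 : ∀ b : B, (∀ n, b ∈ I ^ n) → b = 0)
    (h1 : ∀ f : ℕ → B, (∀ n, f (n + 1) - f n ∈ I ^ n) → ∃ b, ∀ n, b - f n ∈ I ^ n) :
    IsAdicComplete I B where
  haus' b hb := h0 b fun n => by
    have := hb n
    rwa [SModEq.zero, smul_eq_mul, Ideal.mul_top] at this
  prec' f hf := by
    obtain ⟨b, hb⟩ := h1 f fun n => by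
      have := hf (Nat.le_succ n)
      rw [SModEq.sub_mem, smul_eq_mul, Ideal.mul_top, ← neg_sub] at this
      exact neg_mem_iff.mp this
    refine ⟨b, fun n => ?_⟩
    rw [SModEq.sub_mem, smul_eq_mul, Ideal.mul_top, ← neg_sub]
    exact neg_mem (hb n)

variable [Algebra ℂ B]

/-- Repeated integration by parts: the antiderivative is the series of (-1)^n y^(n+1) / (n+1)! · vⁿ
f. Applying v to a partial sum telescopes, leaving an error divisible by y^N. The factor y in front
of g normalizes the antiderivative to vanish on y = 0. -/
theorem derivation_surjective_of_eq_one [IsAdicComplete I B] (v : Derivation ℂ B B) {y : B}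
    (hy : y ∈ I) (hv : v y = 1) (f : B) : ∃ g, v (y * g) = f := by
  let d : ℕ → ℂ := fun n => (-1) ^ n / n.factorial
  let s : ℕ → B := fun N => ∑ n ∈ Finset.range N, (-d (n + 1)) • (y ^ n * v^[n] f)
  have hd : ∀ n : ℕ, ((n : ℂ) + 1) * -d (n + 1) = d n := fun n => by
    simp only [d, Nat.factorial_succ, pow_succ]
    have h1 : (n : ℂ) + 1 ≠ 0 := by exact_mod_cast Nat.succ_ne_zero n
    have h2 : (n.factorial : ℂ) ≠ 0 := by exact_mod_cast n.factorial_ne_zero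
    push_cast
    field_simp
  have hpow : ∀ n, y ^ n ∈ I ^ n := fun n => Ideal.pow_mem_pow hy n
  have hsum : ∀ N, v (y * s N) = f - d N • (y ^ N * v^[N] f) := by
    intro N
    induction N with
    | zero => simp [s, d]
    | succ N ih =>
      have h1 : y * s (N + 1) = y * s N + (-d (N + 1)) • (y ^ (N + 1) * v^[N] f) := by
        simp only [s, Finset.sum_range_succ, mul_add, mul_smul_comm]
        ring_nf
      have h2 : v (y ^ (N + 1) * v^[N] f) =
          ((N : ℂ) + 1) • (y ^ N * v^[N] f) + y ^ (N + 1) * v^[N + 1] f := by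
        rw [Derivation.leibniz, Derivation.leibniz_pow, hv, Function.iterate_succ_apply',
          Algebra.smul_def ((N : ℂ) + 1)]
        simp only [smul_eq_mul, nsmul_eq_mul, map_add, map_natCast, map_one, Nat.add_sub_cancel]
        push_cast
        ring
      rw [h1, map_add, ih, Derivation.map_smul, h2, smul_add, smul_smul, mul_comm (-d (N + 1)), hd,
        neg_smul]
      abel
  obtain ⟨g, hg⟩ := exists_adic_limit (I := I) (f := s) fun n => by
    simp only [s, Finset.sum_range_succ, add_sub_cancel_left]
    exact Submodule.smul_of_tower_mem _ _ (Ideal.mul_mem_right _ _ (hpow n))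
  refine ⟨g, sub_eq_zero.mp (eq_zero_of_forall_mem_pow (I := I) fun n => ?_)⟩
  have h1 : v (y * g) - f = v (y * (g - s n)) - d n • (y ^ n * v^[n] f) := by
    rw [mul_sub, map_sub, hsum]; abel
  rw [h1]
  refine sub_mem (derivation_mem v n ?_)
    (Submodule.smul_of_tower_mem _ _ (Ideal.mul_mem_right _ _ (hpow n)))
  rw [pow_succ']
  exact Ideal.mul_mem_mul hy (hg n)

/-- The equation says g = -y v(g). Differentiating and iterating gives n! g = (-1)^n yⁿ vⁿ(g), so g
lies in every power of I. -/
theorem derivation_injective_of_eq_one [IsAdicComplete I B] (v : Derivation ℂ B B) {y : B}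
    (hy : y ∈ I) (hv : v y = 1) {g : B} (h : v (y * g) = 0) : y * g = 0 := by
  have h1 : ∀ n : ℕ, ((n : B) + 1) * v^[n] g + y * v^[n + 1] g = 0 := by
    intro n
    induction n with
    | zero =>
      rw [Derivation.leibniz, hv] at h
      simp only [smul_eq_mul, mul_one] at h
      simp only [Function.iterate_zero, Function.iterate_succ, id, Function.comp_apply]
      push_cast
      linear_combination h
    | succ n ih =>
      have := congrArg v ih
      simp only [map_add, Derivation.leibniz, smul_eq_mul, hv, map_zero, Derivation.map_natCast,
        Derivation.map_one_eq_zero, ← Function.iterate_succ_apply' v] at this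
      push_cast
      linear_combination this
  have h2 : ∀ n : ℕ, (n.factorial : B) * g = (-1) ^ n * y ^ n * v^[n] g := by
    intro n
    induction n with
    | zero => simp
    | succ n ih =>
      rw [Nat.factorial_succ]
      push_cast
      linear_combination ((n : B) + 1) * ih + (-1) ^ n * y ^ n * h1 n
  have h3 : g = 0 := eq_zero_of_forall_mem_pow (I := I) fun n => by
    have h4 : (n.factorial : ℂ) • g ∈ I ^ n := by
      rw [Algebra.smul_def, map_natCast, h2]
      exact Ideal.mul_mem_right _ _ (Ideal.mul_mem_left _ _ (Ideal.pow_mem_pow hy n))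
    have h5 := Submodule.smul_of_tower_mem (I ^ n) ((n.factorial : ℂ)⁻¹) h4
    rwa [smul_smul, inv_mul_cancel₀ (by exact_mod_cast n.factorial_ne_zero), one_smul] at h5
  rw [h3, mul_zero]

/-- Dividing v by the unit v(w) reduces to the case v(w) = 1. -/
theorem derivation_surjective [IsAdicComplete I B] (v : Derivation ℂ B B) {w : B}
    (hw : w ∈ I) (hv : IsUnit (v w)) (f : B) : ∃ g, v (w * g) = f := by
  obtain ⟨c, hc⟩ := hv
  obtain ⟨g, hg⟩ := derivation_surjective_of_eq_one ((↑c⁻¹ : B) • v) hw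
    (by simp [← hc]) ((↑c⁻¹ : B) * f)
  exact ⟨g, c⁻¹.isUnit.mul_left_cancel hg⟩

theorem derivation_injective [IsAdicComplete I B] (v : Derivation ℂ B B) {w : B}
    (hw : w ∈ I) (hv : IsUnit (v w)) {g : B} (h : v (w * g) = 0) : w * g = 0 := by
  obtain ⟨c, hc⟩ := hv
  exact derivation_injective_of_eq_one ((↑c⁻¹ : B) • v) hw (by simp [← hc]) (by rw [Derivation.smul_apply, h, smul_zero])

/-- `Spf B` with ideal of definition `I` has a single closed point, with residue field `ℂ`. -/
structure IsGerm (I : Ideal B) : Prop where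
  complete : IsAdicComplete I B
  residue : ∀ b : B, ∃ c : ℂ, b - algebraMap ℂ B c ∈ I
  ne_top : I ≠ ⊤

/-- Outside I, b is a nonzero constant times an element of 1 + I, and completeness puts I in the
Jacobson radical. -/
theorem IsGerm.isUnit_iff (h : IsGerm I) {b : B} : IsUnit b ↔ b ∉ I := by
  refine ⟨fun hb hI => h.ne_top (Ideal.eq_top_of_isUnit_mem _ hI hb), fun hb => ?_⟩
  obtain ⟨c, hc⟩ := h.residue b
  have hc0 : c ≠ 0 := by
    rintro rfl
    exact hb (by simpa using hc)
  have := h.complete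
  have h1 := Ideal.mem_jacobson_bot.mp (IsAdicComplete.le_jacobson_bot I hc) (algebraMap ℂ B c⁻¹)
  have h2 : b = algebraMap ℂ B c *
      ((b - algebraMap ℂ B c) * algebraMap ℂ B c⁻¹ + 1) := by
    have : algebraMap ℂ B c * algebraMap ℂ B c⁻¹ = 1 := by
      rw [← map_mul, mul_inv_cancel₀ hc0, map_one]
    linear_combination (algebraMap ℂ B c - b) * this
  rw [h2]
  exact ((isUnit_iff_ne_zero.mpr hc0).map _).mul h1

theorem IsGerm.isUnit_of_mul_sub_one_mem (h : IsGerm I) {b c : B} (hb : b * c - 1 ∈ I) :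
    IsUnit c := by
  refine h.isUnit_iff.mpr fun hc => h.ne_top ((Ideal.eq_top_iff_one _).mpr ?_)
  simpa using sub_mem (Ideal.mul_mem_left I b hc) hb

/-- The ideal of a germ is its set of non-units, so any algebra isomorphism respects it, with no
continuity assumption. -/
theorem IsGerm.of_algEquiv {B' : Type*} [CommRing B'] [Algebra ℂ B'] {I' : Ideal B'}
    (h : IsGerm I) (h' : IsGerm I') (φ : B' ≃ₐ[ℂ] B) (b : B') : φ b ∈ I ↔ b ∈ I' := by
  rw [← not_iff_not, ← h.isUnit_iff, ← h'.isUnit_iff]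
  exact MulEquiv.isUnit_map φ

theorem IsGerm.mem_pow_of_algEquiv {B' : Type*} [CommRing B'] [Algebra ℂ B'] {I' : Ideal B'}
    (h : IsGerm I) (h' : IsGerm I') (φ : B' ≃ₐ[ℂ] B) {n : ℕ} {b : B'} (hb : b ∈ I' ^ n) :
    φ b ∈ I ^ n := by
  have h1 : I'.map φ ≤ I := Ideal.map_le_iff_le_comap.mpr fun b hb => (h.of_algEquiv h' φ b).mpr hb
  have h2 := Ideal.mem_map_of_mem φ hb
  rw [Ideal.map_pow] at h2
  exact Ideal.pow_right_mono h1 n h2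

end Adic

/-! ### Brackets -/

section Brackets

variable {B : Type*} [CommRing B] [Algebra ℂ B]

theorem hamiltonian_apply (Q : Bivector B) (f a : B) : hamiltonian Q f a = Q.1 f a := rfl

theorem transport_apply {A : Type*} [CommRing A] [Algebra ℂ A] (φ : A ≃ₐ[ℂ] B)
    (D : Derivation ℂ A A) (b : B) : transport φ D b = φ (D (φ.symm b)) := rfl

theorem bivector_leibniz_left (Q : Bivector B) (a b c : B) :
    Q.1 (a * b) c = a * Q.1 b c + b * Q.1 a c := by
  rw [bivector_skew, bivector_leibniz_right, bivector_skew Q c a, bivector_skew Q c b]; ring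

/-- The vector field `{-, x}`. -/
def bracketRight (Q : Bivector B) (x : B) : Derivation ℂ B B := -hamiltonian Q x

@[simp] theorem bracketRight_apply (Q : Bivector B) (x a : B) : bracketRight Q x a = Q.1 a x := by
  rw [bivector_skew]; rfl

theorem bivector_algebraMap (Q : Bivector B) (a : B) (c : ℂ) :
    Q.1 a (algebraMap ℂ B c) = 0 := (hamiltonian Q a).map_algebraMap c

theorem bivector_one (Q : Bivector B) (a : B) : Q.1 a 1 = 0 := (hamiltonian Q a).map_one_eq_zero

theorem IsPoisson.isScaling {Q : Bivector B} (hQ : IsPoisson Q) (h : B) :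
    IsScaling 0 Q (hamiltonian Q h) := fun a b => by
  have h1 := hQ h a b
  have h2 := bivector_skew Q a (Q.1 b h)
  have h3 := bivector_skew Q b h
  have h4 := bivector_skew Q b (Q.1 h a)
  have h5 := bivector_skew Q (Q.1 h a) b
  simp only [hamiltonian_apply, Int.cast_zero, zero_smul]
  rw [h3, map_neg] at h1
  linear_combination h1 - h5

theorem IsScaling.add {Q : Bivector B} {k : ℤ} {D D' : Derivation ℂ B B} (h : IsScaling k Q D)
    (h' : IsScaling 0 Q D') : IsScaling k Q (D + D') := fun a b => by
  have h1 := h a b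
  have h2 := h' a b
  simp only [Int.cast_zero, zero_smul] at h2
  simp only [Derivation.add_apply, map_add, LinearMap.add_apply]
  linear_combination h1 + h2

theorem IsScaling.add_hamiltonian {Q : Bivector B} (hQ : IsPoisson Q) {k : ℤ}
    {D : Derivation ℂ B B} (h : IsScaling k Q D) (f : B) :
    IsScaling k Q (D + hamiltonian Q f) := h.add (hQ.isScaling f)

theorem IsPoisson.jacobi {Q : Bivector B} (hQ : IsPoisson Q) (f g h : B) :
    Q.1 f (Q.1 g h) = Q.1 (Q.1 f g) h + Q.1 g (Q.1 f h) := by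
  have := hQ.isScaling f g h
  simp only [hamiltonian_apply, Int.cast_zero, zero_smul] at this
  linear_combination this

/-- The commutator of two Hamiltonian fields is the Hamiltonian field of the bracket, which vanishes
for a constant. -/
theorem bracketRight_comm {Q : Bivector B} (hQ : IsPoisson Q) {x y : B} {c : ℂ}
    (h : Q.1 y x = algebraMap ℂ B c) (f : B) :
    Q.1 (Q.1 f y) x = Q.1 (Q.1 f x) y := by
  have h1 := hQ.jacobi f y x
  rw [h, bivector_algebraMap] at h1
  have h2 := bivector_skew Q y (Q.1 f x)
  linear_combination -h1 - h2

/-- The restriction of a bracket to a subalgebra closed under it. -/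
def restrictBivector (Q : Bivector B) (Z : Subalgebra ℂ B) (hZ : ∀ f ∈ Z, ∀ g ∈ Z, Q.1 f g ∈ Z) :
    Bivector Z :=
  ⟨LinearMap.mk₂ ℂ (fun f g => ⟨Q.1 f g, hZ f f.2 g g.2⟩)
    (fun a b c => Subtype.ext (by simp)) (fun c a b => Subtype.ext (by simp))
    (fun a b c => Subtype.ext (by simp)) (fun c a b => Subtype.ext (by simp)),
    fun a => Subtype.ext (Q.2.1 a), fun a b c => Subtype.ext (Q.2.2 a b c)⟩

@[simp] theorem restrictBivector_coe (Q : Bivector B) (Z : Subalgebra ℂ B)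
    (hZ : ∀ f ∈ Z, ∀ g ∈ Z, Q.1 f g ∈ Z) (f g : Z) :
    ((restrictBivector Q Z hZ).1 f g : B) = Q.1 f g := rfl

theorem restrictBivector_isPoisson {Q : Bivector B} (hQ : IsPoisson Q) (Z : Subalgebra ℂ B)
    (hZ : ∀ f ∈ Z, ∀ g ∈ Z, Q.1 f g ∈ Z) : IsPoisson (restrictBivector Q Z hZ) :=
  fun a b c => Subtype.ext (hQ a b c)

/-- The restriction of a vector field to a subalgebra preserved by it. -/
def restrictDerivation (D : Derivation ℂ B B) (Z : Subalgebra ℂ B) (hD : ∀ f ∈ Z, D f ∈ Z) :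
    Derivation ℂ Z Z :=
  Derivation.mk' ((D : B →ₗ[ℂ] B).restrict (p := Subalgebra.toSubmodule Z)
    (q := Subalgebra.toSubmodule Z) hD) fun a b => Subtype.ext (D.leibniz a b)

@[simp] theorem restrictDerivation_coe (D : Derivation ℂ B B) (Z : Subalgebra ℂ B)
    (hD : ∀ f ∈ Z, D f ∈ Z) (f : Z) : (restrictDerivation D Z hD f : B) = D f := rfl

theorem restrictDerivation_isScaling {Q : Bivector B} {k : ℤ} {D : Derivation ℂ B B}
    (h : IsScaling k Q D) (Z : Subalgebra ℂ B) (hZ : ∀ f ∈ Z, ∀ g ∈ Z, Q.1 f g ∈ Z)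
    (hD : ∀ f ∈ Z, D f ∈ Z) :
    IsScaling k (restrictBivector Q Z hZ) (restrictDerivation D Z hD) :=
  fun a b => Subtype.ext (h a b)

end Brackets

/-! ### Slice isomorphisms form an equivalence relation -/

section SliceIso

variable {A A' A'' : Type*} [CommRing A] [Algebra ℂ A] [CommRing A'] [Algebra ℂ A']
  [CommRing A''] [Algebra ℂ A'']

theorem sliceIso_iff {P : Bivector A} {ξ : Derivation ℂ A A} {P' : Bivector A'}
    {ξ' : Derivation ℂ A' A'} : SliceIso P ξ P' ξ' ↔ ∃ φ : A' ≃ₐ[ℂ] A, IsPoissonEquiv P' P φ ∧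
      ∃ f : A', ∀ a, ξ (φ a) = φ (ξ' a + P'.1 f a) := by
  refine exists_congr fun φ => and_congr_right fun _ => exists_congr fun f => ?_
  rw [Derivation.ext_iff]
  refine forall_congr' fun a => ?_
  rw [transport_apply, Derivation.add_apply, hamiltonian_apply, AlgEquiv.symm_symm,
    AlgEquiv.symm_apply_eq]

theorem isPoissonEquiv_symm {P : Bivector A} {P' : Bivector A'} {φ : A' ≃ₐ[ℂ] A}
    (h : IsPoissonEquiv P' P φ) : IsPoissonEquiv P P' φ.symm := fun a b => by
  rw [AlgEquiv.symm_apply_eq, h, φ.apply_symm_apply, φ.apply_symm_apply]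

theorem SliceIso.of_add_hamiltonian (P : Bivector A) {ξ ξ' : Derivation ℂ A A} (f : A)
    (h : ∀ a, ξ a = ξ' a + P.1 f a) : SliceIso P ξ P ξ' :=
  sliceIso_iff.mpr ⟨AlgEquiv.refl, fun _ _ => rfl, f, h⟩

theorem SliceIso.symm {P : Bivector A} {ξ : Derivation ℂ A A} {P' : Bivector A'}
    {ξ' : Derivation ℂ A' A'} (h : SliceIso P ξ P' ξ') : SliceIso P' ξ' P ξ := by
  obtain ⟨φ, hφ, f, hf⟩ := sliceIso_iff.mp h
  refine sliceIso_iff.mpr ⟨φ.symm, isPoissonEquiv_symm hφ, -φ f, fun a => ?_⟩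
  have h1 := hf (φ.symm a)
  have h2 := isPoissonEquiv_symm hφ (φ f) a
  rw [φ.symm_apply_apply] at h2
  rw [φ.apply_symm_apply] at h1
  rw [h1]
  simp only [map_add, map_neg, LinearMap.neg_apply, φ.symm_apply_apply, h2]
  abel

theorem SliceIso.trans {P : Bivector A} {ξ : Derivation ℂ A A} {P' : Bivector A'}
    {ξ' : Derivation ℂ A' A'} {P'' : Bivector A''} {ξ'' : Derivation ℂ A'' A''}
    (h : SliceIso P ξ P' ξ') (h' : SliceIso P' ξ' P'' ξ'') : SliceIso P ξ P'' ξ'' := by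
  obtain ⟨φ, hφ, f, hf⟩ := sliceIso_iff.mp h
  obtain ⟨ψ, hψ, g, hg⟩ := sliceIso_iff.mp h'
  refine sliceIso_iff.mpr ⟨ψ.trans φ, fun a b => ?_, g + ψ.symm f, fun a => ?_⟩
  · simp only [AlgEquiv.trans_apply]
    rw [hψ, hφ]
  · simp only [AlgEquiv.trans_apply, map_add, LinearMap.add_apply]
    rw [hf, hg, hψ (ψ.symm f), ψ.apply_symm_apply, map_add, map_add, map_add, add_assoc]

end SliceIso

/-! ### Centralizers of Darboux pairs -/

section Cuts

variable {B : Type*} [CommRing B] [Algebra ℂ B]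

/-- `Z` is the centralizer of the Darboux pair `x, y` of functions vanishing on the closed
subscheme defined by `I`. -/
structure IsCut (Q : Bivector B) (I : Ideal B) (x y : B) (Z : Subalgebra ℂ B) : Prop where
  left_mem : x ∈ I
  right_mem : y ∈ I
  pair : Q.1 y x = 1
  mem_iff : ∀ f, f ∈ Z ↔ Q.1 f x = 0 ∧ Q.1 f y = 0

/-- The centralizer of two functions. -/
def centralizer (Q : Bivector B) (x y : B) : Subalgebra ℂ B where
  carrier := {f | Q.1 f x = 0 ∧ Q.1 f y = 0}
  mul_mem' := by
    rintro a b ⟨h1, h2⟩ ⟨h3, h4⟩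
    simp [bivector_leibniz_left, h1, h2, h3, h4]
  add_mem' := by
    rintro a b ⟨h1, h2⟩ ⟨h3, h4⟩
    simp [h1, h2, h3, h4]
  algebraMap_mem' c := by
    simp [bivector_skew Q (algebraMap ℂ B c), bivector_algebraMap]

theorem isCut_centralizer {Q : Bivector B} {I : Ideal B} {x y : B} (hx : x ∈ I) (hy : y ∈ I)
    (h : Q.1 y x = 1) : IsCut Q I x y (centralizer Q x y) :=
  ⟨hx, hy, h, fun _ => Iff.rfl⟩

namespace IsCut

variable {Q : Bivector B} {I : Ideal B} {x y : B} {Z : Subalgebra ℂ B}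

theorem swap (h : IsCut Q I x y Z) : IsCut Q I y (-x) Z :=
  ⟨h.right_mem, neg_mem h.left_mem, by
    rw [bivector_skew]; simp [h.pair], fun f => by
    rw [h.mem_iff, map_neg, neg_eq_zero, and_comm]⟩

theorem bracket_mem (h : IsCut Q I x y Z) (hQ : IsPoisson Q) : ∀ f ∈ Z, ∀ g ∈ Z, Q.1 f g ∈ Z := by
  intro f hf g hg
  rw [h.mem_iff] at hf hg ⊢
  have h1 := hQ.jacobi f g x
  have h2 := hQ.jacobi f g y
  rw [hf.1, hg.1, map_zero, map_zero, add_zero] at h1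
  rw [hf.2, hg.2, map_zero, map_zero, add_zero] at h2
  exact ⟨h1.symm, h2.symm⟩

theorem comm (h : IsCut Q I x y Z) (hQ : IsPoisson Q) (f : B) :
    Q.1 (Q.1 f y) x = Q.1 (Q.1 f x) y :=
  bracketRight_comm (c := 1) hQ (by rw [h.pair, map_one]) f

theorem exists_integral_left (h : IsCut Q I x y Z) (hI : IsGerm I) (f : B) :
    ∃ g, Q.1 (y * g) x = f := by
  have := hI.complete
  obtain ⟨g, hg⟩ := derivation_surjective_of_eq_one (bracketRight Q x) h.right_mem
    (by simp [h.pair]) f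
  exact ⟨g, by rwa [bracketRight_apply] at hg⟩

theorem eq_zero_left (h : IsCut Q I x y Z) (hI : IsGerm I) {g : B} (hg : Q.1 (y * g) x = 0) :
    y * g = 0 := by
  have := hI.complete
  exact derivation_injective_of_eq_one (bracketRight Q x) h.right_mem (by simp [h.pair])
    (by rwa [bracketRight_apply])

theorem exists_integral_right (h : IsCut Q I x y Z) (hI : IsGerm I) (f : B) :
    ∃ g, Q.1 (x * g) y = f := by
  obtain ⟨g, hg⟩ := h.swap.exists_integral_left hI f
  exact ⟨-g, by rwa [mul_neg, ← neg_mul]⟩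

theorem eq_zero_right (h : IsCut Q I x y Z) (hI : IsGerm I) {g : B} (hg : Q.1 (x * g) y = 0) :
    x * g = 0 := by
  have := h.swap.eq_zero_left hI (g := g) (by simpa using hg)
  simpa using this

/-- Splitting off the part in an ideal generated by functions commuting with `x`. -/
theorem exists_sub_mem_of_bracket_mem (h : IsCut Q I x y Z) (hI : IsGerm I) (hQ : IsPoisson Q)
    {S : Set B} (hxS : x ∈ S) (hS : ∀ s ∈ S, Q.1 s x = 0) {f : B} (hf : Q.1 f x ∈ Ideal.span S) :
    ∃ z ∈ Z, f - z ∈ Ideal.span S ∧ f - z ∈ Ideal.span {x, y} := by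
  -- Elements of S are constants for the field {-, x}, so antiderivatives along it can be taken
  -- inside the ideal: only the coefficient of each s is integrated. The extra factor c lets the
  -- induction pass through multiplication by scalars.
  have h1 : ∀ a ∈ Ideal.span S, ∀ c, ∃ g, y * g ∈ Ideal.span S ∧ Q.1 (y * g) x = c * a := by
    intro a ha
    induction ha using Submodule.span_induction with
    | mem s hs =>
      intro c
      obtain ⟨g, hg⟩ := h.exists_integral_left hI c
      refine ⟨g * s, Ideal.mul_mem_left _ _ (Ideal.mul_mem_left _ _ (Ideal.subset_span hs)), ?_⟩
      rw [← mul_assoc, bivector_leibniz_left, hS s hs, hg]; ring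
    | zero => exact fun c => ⟨0, by simp⟩
    | add a b _ _ ha hb =>
      intro c
      obtain ⟨g, hg, hg'⟩ := ha c
      obtain ⟨g', hg1, hg1'⟩ := hb c
      exact ⟨g + g', by rw [mul_add]; exact add_mem hg hg1,
        by rw [mul_add, map_add, LinearMap.add_apply, hg', hg1', mul_add]⟩
    | smul d a _ ih => exact fun c => by rw [smul_eq_mul, ← mul_assoc]; exact ih _
  obtain ⟨g, hg, hg'⟩ := h1 _ hf 1
  rw [one_mul] at hg'
  -- Now the bracket with y is removed by subtracting x g'. This does not spoil the bracket with x: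
  -- the two fields commute, so {x g', x} = x {g', x} is killed by {-, y}, and being divisible by x
  -- it vanishes.
  obtain ⟨g', hg1⟩ := h.exists_integral_right hI (Q.1 (f - y * g) y)
  have h2 : Q.1 (f - y * g) x = 0 := by simp [hg']
  have h3 : x * Q.1 g' x = Q.1 (x * g') x := by
    rw [bivector_leibniz_left, Q.2.1]; ring
  have h4 : x * Q.1 g' x = 0 := by
    apply h.eq_zero_right hI
    rw [h3, ← h.comm hQ, hg1, h.comm hQ, h2]; simp
  refine ⟨f - y * g - x * g', (h.mem_iff _).mpr ⟨?_, ?_⟩, ?_, ?_⟩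
  · rw [map_sub, LinearMap.sub_apply, h2, ← h3, h4, sub_zero]
  · rw [map_sub, LinearMap.sub_apply, hg1, sub_self]
  · have : f - (f - y * g - x * g') = y * g + x * g' := by ring
    rw [this]
    exact add_mem hg (Ideal.mul_mem_right _ _ (Ideal.subset_span hxS))
  · exact Ideal.mem_span_pair.mpr ⟨g', g, by ring⟩

/-- After subtracting an antiderivative y g of {f, x}, the function commutes with x and the previous
splitting applies with S = {x}. -/
theorem exists_sub_mem (h : IsCut Q I x y Z) (hI : IsGerm I) (hQ : IsPoisson Q) (f : B) :
    ∃ z ∈ Z, f - z ∈ Ideal.span {x, y} := by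
  obtain ⟨g, hg⟩ := h.exists_integral_left hI (Q.1 f x)
  obtain ⟨z, hz, -, hz'⟩ := h.exists_sub_mem_of_bracket_mem hI hQ (S := {x}) rfl
    (by rintro s rfl; exact Q.2.1 s) (f := f - y * g) (by simp [hg])
  refine ⟨z, hz, ?_⟩
  have : f - z = (f - y * g - z) + g * y := by ring
  rw [this]
  exact add_mem hz' (Ideal.mul_mem_left _ _ (Ideal.subset_span (by simp)))

theorem eq_zero_of_mem (h : IsCut Q I x y Z) (hI : IsGerm I) {z : B} (hz : z ∈ Z)
    (hz' : z ∈ Ideal.span {x, y}) : z = 0 := by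
  obtain ⟨α, β, rfl⟩ := Ideal.mem_span_pair.mp hz'
  obtain ⟨g, hg⟩ := h.exists_integral_left hI (Q.1 α x)
  rw [h.mem_iff] at hz
  -- The term x y g is moved between the summands so that the first one commutes with x. Then {-, x}
  -- isolates the second summand, and afterwards {-, y} the first.
  have h1 : α * x + β * y = x * (α - y * g) + y * (β + x * g) := by ring
  have h2 : Q.1 (x * (α - y * g)) x = 0 := by
    rw [bivector_leibniz_left, Q.2.1, map_sub, LinearMap.sub_apply, hg]; ring
  rw [h1] at hz ⊢
  have h3 : y * (β + x * g) = 0 := by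
    apply h.eq_zero_left hI
    have := hz.1
    rwa [map_add, LinearMap.add_apply, h2, zero_add] at this
  rw [h3, add_zero] at hz ⊢
  exact h.eq_zero_right hI hz.2

/-- This is the formal splitting of one Darboux pair: B is the direct sum of Z and the ideal (x, y).
-/
theorem quotient_bijective (h : IsCut Q I x y Z) (hI : IsGerm I) (hQ : IsPoisson Q) :
    Function.Bijective ((Ideal.Quotient.mkₐ ℂ (Ideal.span {x, y})).comp Z.val) := by
  refine ⟨(injective_iff_map_eq_zero _).mpr fun z hz => Subtype.ext ?_, fun q => ?_⟩
  · exact h.eq_zero_of_mem hI z.2 (Ideal.Quotient.eq_zero_iff_mem.mp hz)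
  · obtain ⟨f, rfl⟩ := Ideal.Quotient.mk_surjective q
    obtain ⟨z, hz, hz'⟩ := h.exists_sub_mem hI hQ f
    exact ⟨⟨z, hz⟩, (Ideal.Quotient.eq.mpr hz').symm⟩

/-- The projection of `B` onto the centralizer of a Darboux pair `x, y`, with kernel generated by
`x` and `y`. -/
def proj (h : IsCut Q I x y Z) (hI : IsGerm I) (hQ : IsPoisson Q) : B →ₐ[ℂ] Z :=
  (AlgEquiv.ofBijective _ (h.quotient_bijective hI hQ)).symm.toAlgHom.comp
    (Ideal.Quotient.mkₐ ℂ (Ideal.span {x, y}))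

theorem sub_proj_mem (h : IsCut Q I x y Z) (hI : IsGerm I) (hQ : IsPoisson Q) (f : B) :
    f - h.proj hI hQ f ∈ Ideal.span {x, y} := by
  rw [← Ideal.Quotient.eq]
  exact ((AlgEquiv.ofBijective _ (h.quotient_bijective hI hQ)).apply_symm_apply
    (Ideal.Quotient.mk _ f)).symm

theorem proj_eq_iff (h : IsCut Q I x y Z) (hI : IsGerm I) (hQ : IsPoisson Q) {f : B} {z : Z} :
    h.proj hI hQ f = z ↔ f - z ∈ Ideal.span {x, y} := by
  refine ⟨?_, fun hf => Subtype.ext (sub_eq_zero.mp ?_)⟩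
  · rintro rfl; exact h.sub_proj_mem hI hQ f
  · refine h.eq_zero_of_mem hI (sub_mem (h.proj hI hQ f).2 z.2) ?_
    have := sub_mem hf (h.sub_proj_mem hI hQ f)
    rwa [sub_sub_sub_cancel_left] at this

theorem proj_coe (h : IsCut Q I x y Z) (hI : IsGerm I) (hQ : IsPoisson Q) (z : Z) :
    h.proj hI hQ z = z := (h.proj_eq_iff hI hQ).mpr (by simp)

theorem proj_eq_zero (h : IsCut Q I x y Z) (hI : IsGerm I) (hQ : IsPoisson Q) {f : B}
    (hf : f ∈ Ideal.span {x, y}) : h.proj hI hQ f = 0 :=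
  (h.proj_eq_iff hI hQ).mpr (by simpa using hf)

theorem proj_left (h : IsCut Q I x y Z) (hI : IsGerm I) (hQ : IsPoisson Q) :
    h.proj hI hQ x = 0 := h.proj_eq_zero hI hQ (Ideal.subset_span (by simp))

theorem proj_right (h : IsCut Q I x y Z) (hI : IsGerm I) (hQ : IsPoisson Q) :
    h.proj hI hQ y = 0 := h.proj_eq_zero hI hQ (Ideal.subset_span (by simp))

/-- With S = {x}, this says that the normalizer of (x) is Z + (x), so Z is the coisotropic reduction
of x = 0. Larger S is needed when several x-coordinates are handled at once. -/
theorem sub_proj_mem_of_bracket_mem (h : IsCut Q I x y Z) (hI : IsGerm I) (hQ : IsPoisson Q)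
    {S : Set B} (hxS : x ∈ S) (hS : ∀ s ∈ S, Q.1 s x = 0) {f : B} (hf : Q.1 f x ∈ Ideal.span S) :
    f - h.proj hI hQ f ∈ Ideal.span S := by
  obtain ⟨z, hz, h1, h2⟩ := h.exists_sub_mem_of_bracket_mem hI hQ hxS hS hf
  rwa [(h.proj_eq_iff hI hQ (z := ⟨z, hz⟩)).mpr h2]

theorem proj_mem (h : IsCut Q I x y Z) (hI : IsGerm I) (hQ : IsPoisson Q) {f : B} (hf : f ∈ I) :
    (h.proj hI hQ f : B) ∈ I := by
  have h1 : Ideal.span {x, y} ≤ I := Ideal.span_le.mpr (by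
    rintro s (rfl | rfl)
    exacts [h.left_mem, h.right_mem])
  simpa using sub_mem hf (h1 (h.sub_proj_mem hI hQ f))

theorem proj_mem_pow (h : IsCut Q I x y Z) (hI : IsGerm I) (hQ : IsPoisson Q) {n : ℕ} {f : B}
    (hf : f ∈ I ^ n) : h.proj hI hQ f ∈ (I.comap Z.val) ^ n := by
  have h1 : I.map (h.proj hI hQ) ≤ I.comap Z.val :=
    Ideal.map_le_iff_le_comap.mpr fun f hf => h.proj_mem hI hQ hf
  have h2 := Ideal.mem_map_of_mem (h.proj hI hQ) hf
  rw [Ideal.map_pow] at h2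
  exact Ideal.pow_right_mono h1 n h2

/-- Z is a retract of B by a projection mapping powers of I into powers of its trace, so limits
taken in B project to limits in Z. -/
theorem isGerm (h : IsCut Q I x y Z) (hI : IsGerm I) (hQ : IsPoisson Q) :
    IsGerm (I.comap Z.val) where
  complete := by
    have := hI.complete
    have hle : ∀ n (z : Z), z ∈ (I.comap Z.val) ^ n → (z : B) ∈ I ^ n := fun n z hz =>
      Ideal.le_comap_pow Z.val n hz
    refine isAdicComplete_of_limits (fun z hz => Subtype.ext ?_) fun f hf => ?_
    · exact eq_zero_of_forall_mem_pow (I := I) fun n => hle n _ (hz n)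
    · obtain ⟨b, hb⟩ := exists_adic_limit (I := I) (f := fun n => (f n : B)) fun n => hle n _ (hf n)
      refine ⟨h.proj hI hQ b, fun n => ?_⟩
      have := h.proj_mem_pow hI hQ (hb n)
      rwa [map_sub, h.proj_coe] at this
  residue z := by
    obtain ⟨c, hc⟩ := hI.residue z
    exact ⟨c, hc⟩
  ne_top := by
    rw [Ne, Ideal.eq_top_iff_one, Ideal.mem_comap, map_one, ← Ideal.eq_top_iff_one]
    exact hI.ne_top

/-- Modifying a vector field by a Hamiltonian one so as to preserve a centralizer. -/
theorem exists_adjust (h : IsCut Q I x y Z) (hI : IsGerm I) (hQ : IsPoisson Q) {k : ℤ}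
    {D : Derivation ℂ B B} (hD : IsScaling k Q D) :
    ∃ e, (D + hamiltonian Q e) x = 0 ∧ (D + hamiltonian Q e) y = -(k : ℂ) • y := by
  obtain ⟨g, hg⟩ := h.exists_integral_left hI (-D x)
  set e₁ := y * g
  obtain ⟨g', hg'⟩ := h.exists_integral_right hI (-(D y + Q.1 e₁ y + (k : ℂ) • y))
  -- Evaluating [D, Q] = kQ on the pair shows that the corrected field sends y to a function whose
  -- bracket with x is -k. So the remaining error, with -k y as target, commutes with x and can be
  -- integrated along {-, y} without disturbing the first correction.
  have h1 := hD.add_hamiltonian hQ e₁ y x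
  simp only [Derivation.add_apply, hamiltonian_apply, h.pair, hg, add_neg_cancel, map_zero,
    sub_zero, Derivation.map_one_eq_zero, zero_sub] at h1
  have h2 : Q.1 (D y + Q.1 e₁ y + (k : ℂ) • y) x = 0 := by
    rw [map_add, LinearMap.add_apply, map_smul, LinearMap.smul_apply, h.pair, ← h1]
    ring
  have h3 : x * Q.1 g' x = Q.1 (x * g') x := by
    rw [bivector_leibniz_left, Q.2.1]; ring
  have h4 : x * Q.1 g' x = 0 := by
    apply h.eq_zero_right hI
    rw [h3, ← h.comm hQ, hg', map_neg, LinearMap.neg_apply, h2, neg_zero]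
  refine ⟨e₁ + x * g', ?_, ?_⟩
  · simp only [Derivation.add_apply, hamiltonian_apply, map_add, LinearMap.add_apply, hg, ← h3, h4]
    ring
  · simp only [Derivation.add_apply, hamiltonian_apply, map_add, LinearMap.add_apply, hg', neg_smul]
    ring

/-- A field that scales the bracket and rescales x and y preserves the condition of commuting with
them. -/
theorem map_mem (h : IsCut Q I x y Z) {k : ℤ}
    {D : Derivation ℂ B B} (hD : IsScaling k Q D) {a b : ℂ} (hx : D x = a • x)
    (hy : D y = b • y) : ∀ f ∈ Z, D f ∈ Z := by
  intro f hf
  rw [h.mem_iff] at hf ⊢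
  have h1 := hD f x
  have h2 := hD f y
  simp only [hx, hy, hf.1, hf.2, map_smul, smul_zero, map_zero, sub_zero, zero_sub,
    neg_eq_zero] at h1 h2
  exact ⟨h1, h2⟩

/-- Slices defined by Darboux pairs with the same first hypersurface are isomorphic. -/
theorem sliceIso_of_span_eq (hI : IsGerm I) (hQ : IsPoisson Q) {x' y' : B} {Z' : Subalgebra ℂ B}
    (h : IsCut Q I x y Z) (h' : IsCut Q I x' y' Z') (hxx : Ideal.span {x} = Ideal.span {x'})
    {D D' : Derivation ℂ B B} {e : B} (he : ∀ f, D' f = D f + Q.1 e f)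
    {a a' : ℂ} (ha : D x = a • x) (ha' : D' x' = a' • x')
    (hDZ : ∀ f ∈ Z, D f ∈ Z) (hDZ' : ∀ f ∈ Z', D' f ∈ Z') :
    SliceIso (restrictBivector Q Z (h.bracket_mem hQ)) (restrictDerivation D Z hDZ)
      (restrictBivector Q Z' (h'.bracket_mem hQ)) (restrictDerivation D' Z' hDZ') := by
  have hS : ∀ s ∈ ({x} : Set B), Q.1 s x = 0 := by rintro s rfl; exact Q.2.1 s
  have hS' : ∀ s ∈ ({x'} : Set B), Q.1 s x' = 0 := by rintro s rfl; exact Q.2.1 s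
  have hx : x ∈ Ideal.span {x} := Ideal.subset_span rfl
  have hx' : x' ∈ Ideal.span {x} := hxx ▸ Ideal.subset_span rfl
  have hN : ∀ f, Q.1 f x ∈ Ideal.span {x} → ∀ r ∈ Ideal.span {x}, Q.1 f r ∈ Ideal.span {x} := by
    intro f hf r hr
    obtain ⟨c, rfl⟩ := Ideal.mem_span_singleton'.mp hr
    rw [bivector_leibniz_right]
    exact add_mem (Ideal.mul_mem_left _ _ hx) (Ideal.mul_mem_left _ _ hf)
  have hN' : ∀ f, Q.1 f x' ∈ Ideal.span {x} → ∀ r ∈ Ideal.span {x}, Q.1 f r ∈ Ideal.span {x} := by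
    intro f hf r hr
    rw [hxx] at hr
    obtain ⟨c, rfl⟩ := Ideal.mem_span_singleton'.mp hr
    rw [bivector_leibniz_right]
    exact add_mem (Ideal.mul_mem_left _ _ hx') (Ideal.mul_mem_left _ _ hf)
  -- A function normalizing (x) differs from its projection by an element of (x), not merely of (x,
  -- y). This makes both centralizers models of the same reduction.
  have hr : ∀ f, Q.1 f x ∈ Ideal.span {x} → f - h.proj hI hQ f ∈ Ideal.span {x} := fun f hf =>
    h.sub_proj_mem_of_bracket_mem hI hQ (S := {x}) rfl hS hf
  have hr' : ∀ f, Q.1 f x' ∈ Ideal.span {x} → f - h'.proj hI hQ f ∈ Ideal.span {x} := fun f hf => by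
    rw [hxx] at hf ⊢
    exact h'.sub_proj_mem_of_bracket_mem hI hQ (S := {x'}) rfl hS' hf
  have hZ : ∀ f ∈ Z, ∀ r ∈ Ideal.span {x}, Q.1 f r ∈ Ideal.span {x} := fun f hf =>
    hN f (by rw [((h.mem_iff f).mp hf).1]; exact zero_mem _)
  have hZ' : ∀ f ∈ Z', ∀ r ∈ Ideal.span {x}, Q.1 f r ∈ Ideal.span {x} := fun f hf =>
    hN' f (by rw [((h'.mem_iff f).mp hf).1]; exact zero_mem _)
  have hle : Ideal.span {x} ≤ Ideal.span {x, y} := Ideal.span_mono (by simp)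
  have hle' : Ideal.span {x} ≤ Ideal.span {x', y'} := by
    rw [hxx]; exact Ideal.span_mono (by simp)
  have hD : ∀ r ∈ Ideal.span {x}, D r ∈ Ideal.span {x} := by
    intro r hr
    obtain ⟨c, rfl⟩ := Ideal.mem_span_singleton'.mp hr
    rw [Derivation.leibniz, ha]
    exact add_mem (Ideal.mul_mem_left _ _ (Submodule.smul_of_tower_mem _ _ hx))
      (Ideal.mul_mem_right _ _ hx)
  have key : ∀ z : Z', (z : B) - h.proj hI hQ z ∈ Ideal.span {x} := fun z =>
    hr _ (hZ' z z.2 x hx)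
  have key' : ∀ z : Z, (z : B) - h'.proj hI hQ z ∈ Ideal.span {x} := fun z =>
    hr' _ (hZ z z.2 x' hx')
  let φ : Z' ≃ₐ[ℂ] Z := AlgEquiv.ofAlgHom ((h.proj hI hQ).comp Z'.val) ((h'.proj hI hQ).comp Z.val)
    (AlgHom.ext fun z => (h.proj_eq_iff hI hQ).mpr (hle (by simpa using neg_mem (key' z))))
    (AlgHom.ext fun z => (h'.proj_eq_iff hI hQ).mpr (hle' (by simpa using neg_mem (key z))))
  have hφ : ∀ z, φ z = h.proj hI hQ z := fun z => rfl
  -- On the common reduction D = D' - {e, -}, so the Hamiltonian is minus the class of e,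
  -- represented by its projection to Z'.
  refine sliceIso_iff.mpr ⟨φ, fun f g => ?_, -h'.proj hI hQ e, fun f => ?_⟩
  · rw [hφ, hφ, hφ, h.proj_eq_iff]
    refine hle ?_
    simp only [restrictBivector_coe]
    have h1 : Q.1 (f : B) (g : B) - Q.1 (h.proj hI hQ f : B) (h.proj hI hQ g : B) =
        Q.1 (f : B) (g - h.proj hI hQ g) -
          Q.1 (h.proj hI hQ g : B) (f - h.proj hI hQ f) := by
      rw [bivector_skew Q (h.proj hI hQ g : B)]
      simp only [map_sub, LinearMap.sub_apply]; ring
    rw [h1]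
    exact sub_mem (hZ' f f.2 _ (key g)) (hZ _ (h.proj hI hQ g).2 _ (key f))
  · rw [hφ, hφ, eq_comm, h.proj_eq_iff]
    refine hle ?_
    simp only [restrictDerivation_coe, Subalgebra.coe_add, map_neg, LinearMap.neg_apply,
      restrictBivector_coe, NegMemClass.coe_neg, he]
    -- Both D and D' preserve the hypersurface, hence so does their difference {e, -}; thus e
    -- defines a function on the reduction.
    have he1 : Q.1 e x' ∈ Ideal.span {x} := by
      have h1 : Q.1 e x' = a' • x' - D x' := by rw [← ha', he]; ring
      rw [h1]
      exact sub_mem (Submodule.smul_of_tower_mem _ _ hx') (hD _ hx')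
    have h2 : D f + Q.1 e f + -Q.1 (h'.proj hI hQ e : B) (f : B) - D (h.proj hI hQ f : B) =
        D (f - h.proj hI hQ f) - Q.1 (f : B) (e - h'.proj hI hQ e) := by
      rw [bivector_skew Q (f : B)]
      simp only [map_sub, LinearMap.sub_apply]; ring
    rw [h2]
    exact sub_mem (hD _ (key f)) (hZ' f f.2 _ (hr' e he1))

/-- Integrating 1 along {-, x} with vanishing on w = 0 gives w g conjugate to x. Modulo I the
equation reads {w, x} g = 1, so g is a unit and the hypersurface w = 0 is unchanged. -/
theorem exists_unit_partner (h : IsCut Q I x y Z) (hI : IsGerm I) {w : B} (hw : w ∈ I)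
    (hu : IsUnit (Q.1 w x)) : ∃ w', Ideal.span {w'} = Ideal.span {w} ∧
      IsCut Q I x w' (centralizer Q x w') := by
  have := hI.complete
  obtain ⟨g, hg⟩ := derivation_surjective (bracketRight Q x) hw (by simpa using hu) 1
  rw [bracketRight_apply] at hg
  have hg' : IsUnit g := hI.isUnit_of_mul_sub_one_mem (b := Q.1 w x) (by
    rw [bivector_leibniz_left] at hg
    have : Q.1 w x * g - 1 = -Q.1 g x * w := by linear_combination hg
    rw [this]
    exact Ideal.mul_mem_left _ _ hw)
  exact ⟨w * g, Ideal.span_singleton_mul_right_unit hg' w,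
    isCut_centralizer h.left_mem (Ideal.mul_mem_right _ _ hw) hg⟩

/-- Any two slices defined by Darboux pairs are isomorphic. -/
theorem sliceIso (hI : IsGerm I) (hQ : IsPoisson Q) {x' y' : B} {Z' : Subalgebra ℂ B}
    (h : IsCut Q I x y Z) (h' : IsCut Q I x' y' Z')
    {D D₁ D₂ : Derivation ℂ B B} {k : ℤ} (hD : IsScaling k Q D) {e₁ e₂ : B}
    (hD₁ : D₁ = D + hamiltonian Q e₁) (hD₂ : D₂ = D + hamiltonian Q e₂)
    (ha : D₁ x = 0) (ha' : D₂ x' = 0)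
    (hDZ : ∀ f ∈ Z, D₁ f ∈ Z) (hDZ' : ∀ f ∈ Z', D₂ f ∈ Z') :
    SliceIso (restrictBivector Q Z (h.bracket_mem hQ)) (restrictDerivation D₁ Z hDZ)
      (restrictBivector Q Z' (h'.bracket_mem hQ)) (restrictDerivation D₂ Z' hDZ') := by
  -- A hypersurface transverse to the Hamiltonian flows of both x and x'. If neither y nor y' works,
  -- both mixed brackets lie in I, and then y + y' works.
  obtain ⟨w, hw, hwx, hwx'⟩ : ∃ w ∈ I, IsUnit (Q.1 w x) ∧ IsUnit (Q.1 w x') := by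
    by_cases h1 : IsUnit (Q.1 y x')
    · exact ⟨y, h.right_mem, by simp [h.pair], h1⟩
    by_cases h2 : IsUnit (Q.1 y' x)
    · exact ⟨y', h'.right_mem, h2, by simp [h'.pair]⟩
    have h3 : IsUnit (1 : B) := isUnit_one
    rw [hI.isUnit_iff] at h1 h2 h3
    rw [not_not] at h1 h2
    refine ⟨y + y', add_mem h.right_mem h'.right_mem, ?_, ?_⟩
    · rw [hI.isUnit_iff, map_add, LinearMap.add_apply, h.pair]
      exact fun h4 => h3 (by simpa using sub_mem h4 h2)
    · rw [hI.isUnit_iff, map_add, LinearMap.add_apply, h'.pair]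
      exact fun h4 => h3 (by simpa using sub_mem h4 h1)
  obtain ⟨w₁, hw₁, hc₁⟩ := h.exists_unit_partner hI hw hwx
  obtain ⟨w₂, hw₂, hc₂⟩ := h'.exists_unit_partner hI hw hwx'
  obtain ⟨e₃, h3x, h3y⟩ := hc₁.exists_adjust hI hQ hD
  obtain ⟨e₄, h4x, h4y⟩ := hc₂.exists_adjust hI hQ hD
  have h3x' : (D + hamiltonian Q e₃) x = (0 : ℂ) • x := by rw [h3x, zero_smul]
  have h4x' : (D + hamiltonian Q e₄) x' = (0 : ℂ) • x' := by rw [h4x, zero_smul]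
  have h3 := hc₁.map_mem (hD.add_hamiltonian hQ e₃) h3x' h3y
  have h4 := hc₂.map_mem (hD.add_hamiltonian hQ e₄) h4x' h4y
  have hsub : ∀ a b f : B, (D + hamiltonian Q a) f =
      (D + hamiltonian Q b) f + Q.1 (a - b) f := fun a b f => by
    simp only [Derivation.add_apply, hamiltonian_apply, map_sub, LinearMap.sub_apply]; ring
  -- The chain is (x, y), (x, w₁), (x', w₂), (x', y'). The outer links share x or x'; the middle
  -- one, after swapping the members of the pairs, shares the hypersurface w = 0.
  have step₁ := sliceIso_of_span_eq hI hQ h hc₁ rfl (D := D₁) (D' := D + hamiltonian Q e₃)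
    (by rw [hD₁]; exact hsub e₃ e₁) (a := 0) (by rw [ha, zero_smul]) h3x' hDZ h3
  have step₂ := sliceIso_of_span_eq hI hQ hc₁.swap hc₂.swap (hw₁.trans hw₂.symm)
    (hsub e₄ e₃) h3y h4y h3 h4
  have step₃ := sliceIso_of_span_eq hI hQ hc₂ h' rfl (D := D + hamiltonian Q e₄) (D' := D₂)
    (by rw [hD₂]; exact hsub e₂ e₄) h4x' (a' := 0) (by rw [ha', zero_smul]) h4 hDZ'
  exact step₁.trans (step₂.trans step₃)

end IsCut

end Cuts

/-! ### Cancellation of Darboux coordinates -/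

section Slices

variable {B : Type*} [CommRing B] [Algebra ℂ B] {A : Type*} [CommRing A] [Algebra ℂ A]

theorem derivation_mem_span (v : Derivation ℂ B B) {S : Set B} {K : Ideal B}
    (hS : ∀ s ∈ S, v s ∈ K) (hK : Ideal.span S ≤ K) {r : B} (hr : r ∈ Ideal.span S) : v r ∈ K := by
  induction hr using Submodule.span_induction with
  | mem s hs => exact hS s hs
  | zero => simp
  | add a b _ _ ha hb => rw [map_add]; exact add_mem ha hb
  | smul c a ha ih =>
    rw [smul_eq_mul, Derivation.leibniz]
    exact add_mem (Ideal.mul_mem_left _ _ ih) (Ideal.mul_mem_right _ _ (hK ha))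

/-- Darboux coordinates `x, y` on `Spf B`, together with an identification of the functions on the
subscheme `x = y = 0` with `A`, such that the bracket `P` and the vector field `ξ` on `A` are
induced by the bracket `Q` and the vector field `D + {e, -}` on `B` through coisotropic reduction
along `x = 0`. -/
structure SliceData {n : ℕ} (Q : Bivector B) (D : Derivation ℂ B B) (I : Ideal B) (P : Bivector A)
    (ξ : Derivation ℂ A A) (x y : Fin n → B) (ι : A →ₐ[ℂ] B) (ε : B →ₐ[ℂ] A) (e : B) : Prop where
  x_mem : ∀ i, x i ∈ I
  y_mem : ∀ i, y i ∈ I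
  xx : ∀ i j, Q.1 (x i) (x j) = 0
  yy : ∀ i j, Q.1 (y i) (y j) = 0
  yx : ∀ i j, Q.1 (y i) (x j) = if i = j then 1 else 0
  retract : ∀ a, ε (ι a) = a
  retract_x : ∀ i, ε (x i) = 0
  retract_y : ∀ i, ε (y i) = 0
  normal : ∀ a i, Q.1 (ι a) (x i) ∈ Ideal.span (Set.range x)
  bracket : ∀ a b, Q.1 (ι a) (ι b) - ι (P.1 a b) ∈ Ideal.span (Set.range x)
  field_x : ∀ i, D (x i) + Q.1 e (x i) ∈ Ideal.span (Set.range x)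
  field : ∀ a, D (ι a) + Q.1 e (ι a) - ι (ξ a) ∈ Ideal.span (Set.range x)
  dense : ∀ b N, b - ι (ε b) ∈ Ideal.span (Set.range x) ⊔ Ideal.span (Set.range y) ⊔ I ^ N

/-- `Spf B` is a product of a formal symplectic disk of dimension `2 n` with `Spf A`, in a way
compatible with brackets and with vector fields up to Hamiltonian ones. -/
def HasSlice (n : ℕ) (Q : Bivector B) (D : Derivation ℂ B B) (I : Ideal B) (P : Bivector A)
    (ξ : Derivation ℂ A A) : Prop :=
  ∃ (x y : Fin n → B) (ι : A →ₐ[ℂ] B) (ε : B →ₐ[ℂ] A) (e : B), SliceData Q D I P ξ x y ι ε e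

variable {Q : Bivector B} {D : Derivation ℂ B B} {I : Ideal B} {P : Bivector A}
  {ξ : Derivation ℂ A A}

theorem HasSlice.of_sliceIso {B' : Type*} [CommRing B'] [Algebra ℂ B'] {Q' : Bivector B'}
    {D' : Derivation ℂ B' B'} {I' : Ideal B'} (hI : IsGerm I) (hI' : IsGerm I') {n : ℕ}
    (h : HasSlice n Q' D' I' P ξ) (hiso : SliceIso Q D Q' D') : HasSlice n Q D I P ξ := by
  obtain ⟨x, y, ι, ε, e, h⟩ := h
  obtain ⟨φ, hφ, f, hf⟩ := sliceIso_iff.mp hiso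
  have hspan : ∀ (s : Fin n → B') {b : B'}, b ∈ Ideal.span (Set.range s) →
      φ b ∈ Ideal.span (Set.range (φ ∘ s)) := fun s b hb => by
    have := Ideal.mem_map_of_mem φ hb
    rwa [Ideal.map_span, ← Set.range_comp] at this
  -- The Hamiltonian defect f of the isomorphism is absorbed into the auxiliary function e.
  have hfield : ∀ b, D (φ b) + Q.1 (φ (e - f)) (φ b) = φ (D' b + Q'.1 e b) := fun b => by
    rw [hf, ← hφ, ← map_add]
    simp only [map_sub, map_add, LinearMap.sub_apply]
    ring
  refine ⟨φ ∘ x, φ ∘ y, φ.toAlgHom.comp ι, ε.comp φ.symm.toAlgHom, φ (e - f), ?_⟩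
  refine ⟨fun i => (hI.of_algEquiv hI' φ _).mpr (h.x_mem i),
    fun i => (hI.of_algEquiv hI' φ _).mpr (h.y_mem i), fun i j => ?_, fun i j => ?_, fun i j => ?_,
    fun a => ?_, fun i => ?_, fun i => ?_, fun a i => ?_, fun a b => ?_, fun i => ?_, fun a => ?_,
    fun b N => ?_⟩
  · simp [← hφ (x i), h.xx]
  · simp [← hφ (y i), h.yy]
  · simp only [Function.comp_apply, ← hφ (y i), h.yx]
    split_ifs <;> simp
  · change ε (φ.symm (φ (ι a))) = a
    rw [φ.symm_apply_apply, h.retract]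
  · change ε (φ.symm (φ (x i))) = 0
    rw [φ.symm_apply_apply, h.retract_x]
  · change ε (φ.symm (φ (y i))) = 0
    rw [φ.symm_apply_apply, h.retract_y]
  · change Q.1 (φ (ι a)) (φ (x i)) ∈ _
    rw [← hφ]; exact hspan x (h.normal a i)
  · change Q.1 (φ (ι a)) (φ (ι b)) - φ (ι (P.1 a b)) ∈ _
    rw [← hφ, ← map_sub]; exact hspan x (h.bracket a b)
  · change D (φ (x i)) + Q.1 (φ (e - f)) (φ (x i)) ∈ _
    rw [hfield]; exact hspan x (h.field_x i)
  · change D (φ (ι a)) + Q.1 (φ (e - f)) (φ (ι a)) - φ (ι (ξ a)) ∈ _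
    rw [hfield, ← map_sub]; exact hspan x (h.field a)
  · change b - φ (ι (ε (φ.symm b))) ∈ _
    have h1 := h.dense (φ.symm b) N
    have h2 : Ideal.span (Set.range x) ⊔ Ideal.span (Set.range y) ⊔ I' ^ N ≤
        (Ideal.span (Set.range (φ ∘ x)) ⊔ Ideal.span (Set.range (φ ∘ y)) ⊔ I ^ N).comap φ := by
      refine sup_le (sup_le ?_ ?_) ?_
      · exact fun b hb => Ideal.mem_sup_left (Ideal.mem_sup_left (hspan x hb))
      · exact fun b hb => Ideal.mem_sup_left (Ideal.mem_sup_right (hspan y hb))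
      · exact fun b hb => Ideal.mem_sup_right (hI.mem_pow_of_algEquiv hI' φ hb)
    have h3 := h2 h1
    rwa [Ideal.mem_comap, map_sub, φ.apply_symm_apply] at h3

/-- Brackets with Z preserve the ideal (x, y), since Z commutes with its generators. The projection
itself need not be Poisson. -/
theorem IsCut.proj_bracket {x y : B} {Z : Subalgebra ℂ B} (h : IsCut Q I x y Z) (hI : IsGerm I)
    (hQ : IsPoisson Q) (f : B) (z : Z) : h.proj hI hQ (Q.1 f z) =
      (restrictBivector Q Z (h.bracket_mem hQ)).1 (h.proj hI hQ f) z := by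
  rw [h.proj_eq_iff, restrictBivector_coe, ← LinearMap.sub_apply, ← map_sub]
  have hz := (h.mem_iff z).mp z.2
  obtain ⟨α, β, hαβ⟩ := Ideal.mem_span_pair.mp (h.sub_proj_mem hI hQ f)
  rw [← hαβ, map_add, LinearMap.add_apply, bivector_leibniz_left, bivector_leibniz_left,
    bivector_skew Q x, bivector_skew Q y, hz.1, hz.2]
  exact Ideal.mem_span_pair.mpr ⟨Q.1 α z, Q.1 β z, by ring⟩

theorem SliceData.isCut {n : ℕ} {x y : Fin (n + 1) → B} {ι : A →ₐ[ℂ] B} {ε : B →ₐ[ℂ] A} {e : B}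
    (h : SliceData Q D I P ξ x y ι ε e) :
    IsCut Q I (x 0) (y 0) (FormalPoisson.centralizer Q (x 0) (y 0)) :=
  isCut_centralizer (h.x_mem 0) (h.y_mem 0) (by simp [h.yx])

/-- Splitting off the first Darboux pair: the other coordinates already lie in the centralizer, and
ι is replaced by its projection. The conditions survive because they are imposed only modulo the
ideal of the x-coordinates, where ι and its projection agree. -/
theorem SliceData.reduce {n : ℕ} {x y : Fin (n + 1) → B} {ι : A →ₐ[ℂ] B} {ε : B →ₐ[ℂ] A} {e : B}
    (hI : IsGerm I) (hQ : IsPoisson Q)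
    (h : SliceData Q D I P ξ x y ι ε e) {Z : Subalgebra ℂ B} (hZ : IsCut Q I (x 0) (y 0) Z)
    {D' : Derivation ℂ B B} {e' : B} (hD' : D' = D + hamiltonian Q e')
    (hDZ : ∀ f ∈ Z, D' f ∈ Z) :
    HasSlice n (restrictBivector Q Z (hZ.bracket_mem hQ)) (restrictDerivation D' Z hDZ)
      (I.comap Z.val) P ξ := by
  set ρ := hZ.proj hI hQ with hρ
  set K := Ideal.span (Set.range x) with hK
  have hxK : ∀ i, x i ∈ K := fun i => Ideal.subset_span ⟨i, rfl⟩
  have hxZ : ∀ i : Fin n, x i.succ ∈ Z := fun i => (hZ.mem_iff _).mpr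
    ⟨h.xx _ _, by rw [bivector_skew, h.yx, if_neg (Fin.succ_ne_zero i).symm, neg_zero]⟩
  have hyZ : ∀ i : Fin n, y i.succ ∈ Z := fun i => (hZ.mem_iff _).mpr
    ⟨by rw [h.yx, if_neg (Fin.succ_ne_zero i)], h.yy _ _⟩
  set x' : Fin n → Z := fun i => ⟨x i.succ, hxZ i⟩ with hx'
  set y' : Fin n → Z := fun i => ⟨y i.succ, hyZ i⟩ with hy'
  set K' := Ideal.span (Set.range x') with hK'
  have hρK : K ≤ K'.comap ρ := by
    refine Ideal.span_le.mpr ?_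
    rintro _ ⟨i, rfl⟩
    change ρ (x i) ∈ K'
    refine Fin.cases ?_ (fun i => ?_) i
    · rw [hρ, hZ.proj_left]; exact zero_mem _
    · have : ρ (x i.succ) = x' i := hZ.proj_coe hI hQ (x' i)
      rw [this]; exact Ideal.subset_span ⟨i, rfl⟩
  have hρY : Ideal.span (Set.range y) ≤ (Ideal.span (Set.range y')).comap ρ := by
    refine Ideal.span_le.mpr ?_
    rintro _ ⟨i, rfl⟩
    change ρ (y i) ∈ Ideal.span (Set.range y')
    refine Fin.cases ?_ (fun i => ?_) i
    · rw [hρ, hZ.proj_right]; exact zero_mem _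
    · have : ρ (y i.succ) = y' i := hZ.proj_coe hI hQ (y' i)
      rw [this]; exact Ideal.subset_span ⟨i, rfl⟩
  have hcoe : ∀ z : Z, (z : B) ∈ K → z ∈ K' := fun z hz => by
    have := hρK hz
    rwa [Ideal.mem_comap, hρ, hZ.proj_coe] at this
  have hN : ∀ f, (∀ i, Q.1 f (x i) ∈ K) → ∀ r ∈ K, Q.1 f r ∈ K := fun f hf r hr =>
    derivation_mem_span (hamiltonian Q f) (by rintro _ ⟨i, rfl⟩; exact hf i) le_rfl hr
  have hKx : ∀ r ∈ K, ∀ i, Q.1 r (x i) ∈ K := fun r hr i => by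
    rw [bivector_skew]
    exact neg_mem (hN _ (fun j => by rw [h.xx]; exact zero_mem _) r hr)
  -- The x-coordinates commute with the first of them, so the splitting applies with S equal to all
  -- of them.
  have hι : ∀ a, ι a - ρ (ι a) ∈ K := fun a =>
    hZ.sub_proj_mem_of_bracket_mem hI hQ (S := Set.range x) ⟨0, rfl⟩
      (by rintro _ ⟨i, rfl⟩; exact h.xx _ _) (h.normal a 0)
  have hρN : ∀ a i, Q.1 (ρ (ι a) : B) (x i) ∈ K := fun a i => by
    have : Q.1 (ρ (ι a) : B) (x i) = Q.1 (ι a) (x i) - Q.1 (ι a - ρ (ι a)) (x i) := by simp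
    rw [this]
    exact sub_mem (h.normal a i) (hKx _ (hι a) i)
  have hDe : ∀ r ∈ K, (D + hamiltonian Q e) r ∈ K := fun r hr =>
    derivation_mem_span _ (by rintro _ ⟨i, rfl⟩; exact h.field_x i) le_rfl hr
  -- Since D' = D + {e', -}, the field D + {e, -} is D' + {e - e', -}, and its Hamiltonian part is
  -- projected to the centralizer.
  have hD'e : ∀ z : Z, restrictDerivation D' Z hDZ z +
      (restrictBivector Q Z (hZ.bracket_mem hQ)).1 (ρ (e - e')) z =
        ρ ((D + hamiltonian Q e) z) := fun z => by
    rw [← hZ.proj_bracket, ← hZ.proj_coe hI hQ (restrictDerivation D' Z hDZ z), ← map_add,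
      restrictDerivation_coe, hD']
    congr 1
    simp only [Derivation.add_apply, hamiltonian_apply, map_sub, LinearMap.sub_apply]
    ring
  refine ⟨x', y', ρ.comp ι, ε.comp Z.val, ρ (e - e'), ⟨fun i => h.x_mem _, fun i => h.y_mem _,
    fun i j => Subtype.ext (h.xx _ _), fun i j => Subtype.ext (h.yy _ _), fun i j => ?_,
    fun a => ?_, fun i => h.retract_x _, fun i => h.retract_y _, fun a i => ?_, fun a b => ?_,
    fun i => ?_, fun a => ?_, fun b N => ?_⟩⟩
  · apply Subtype.ext
    rw [restrictBivector_coe]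
    simp only [hx', hy', h.yx, Fin.succ_inj]
    split_ifs <;> rfl
  · change ε (ρ (ι a)) = a
    have h1 : ε (ι a - ρ (ι a)) = 0 := by
      obtain ⟨α, β, hαβ⟩ := Ideal.mem_span_pair.mp (hZ.sub_proj_mem hI hQ (ι a))
      rw [← hαβ, map_add, map_mul, map_mul, h.retract_x, h.retract_y]; simp
    rw [map_sub, h.retract, sub_eq_zero] at h1
    exact h1.symm
  · exact hcoe _ (hρN a _)
  · refine hcoe _ ?_
    have h1 : Q.1 (ρ (ι a) : B) (ρ (ι b) : B) - ρ (ι (P.1 a b)) =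
        (Q.1 (ι a) (ι b) - ι (P.1 a b)) + (ι (P.1 a b) - ρ (ι (P.1 a b))) -
          Q.1 (ρ (ι a) : B) (ι b - ρ (ι b)) + Q.1 (ι b) (ι a - ρ (ι a)) := by
      simp only [map_sub]
      rw [bivector_skew Q (ι b), bivector_skew Q (ι b)]
      ring
    change Q.1 (ρ (ι a) : B) (ρ (ι b) : B) - ρ (ι (P.1 a b)) ∈ K
    rw [h1]
    exact add_mem (sub_mem (add_mem (h.bracket a b) (hι _)) (hN _ (hρN a) _ (hι b)))
      (hN _ (h.normal b) _ (hι a))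
  · rw [hD'e]
    exact hρK (h.field_x _)
  · change _ + (restrictBivector Q Z _).1 _ (ρ (ι a)) - ρ (ι (ξ a)) ∈ K'
    change restrictDerivation D' Z hDZ (ρ (ι a)) + _ - _ ∈ K'
    rw [hD'e, ← map_sub]
    apply hρK
    have h1 : (D + hamiltonian Q e) (ρ (ι a) : B) - ι (ξ a) =
        (D (ι a) + Q.1 e (ι a) - ι (ξ a)) - (D + hamiltonian Q e) (ι a - ρ (ι a)) := by
      simp only [map_sub, Derivation.add_apply, hamiltonian_apply]; ring
    rw [h1]
    exact sub_mem (h.field a) (hDe _ (hι a))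
  · change b - ρ (ι (ε b)) ∈ _
    have h1 : K ⊔ Ideal.span (Set.range y) ⊔ I ^ N ≤
        (K' ⊔ Ideal.span (Set.range y') ⊔ (I.comap Z.val) ^ N).comap ρ := by
      refine sup_le (sup_le ?_ ?_) ?_
      · exact fun b hb => Ideal.mem_sup_left (Ideal.mem_sup_left (hρK hb))
      · exact fun b hb => Ideal.mem_sup_left (Ideal.mem_sup_right (hρY hb))
      · exact fun b hb => Ideal.mem_sup_right (hZ.proj_mem_pow hI hQ hb)
    have h2 := h1 (h.dense b N)
    rwa [Ideal.mem_comap, map_sub, hρ, hZ.proj_coe] at h2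

/-- Without coordinates the ideals generated by them are zero, so ι ∘ ε is the identity modulo all
powers of I, and ι is an isomorphism. -/
theorem HasSlice.sliceIso_of_zero (hI : IsGerm I) (h : HasSlice 0 Q D I P ξ) :
    SliceIso Q D P ξ := by
  obtain ⟨x, y, ι, ε, e, h⟩ := h
  have := hI.complete
  have hx : Ideal.span (Set.range x) = ⊥ := by rw [Set.range_eq_empty, Ideal.span_empty]
  have hy : Ideal.span (Set.range y) = ⊥ := by rw [Set.range_eq_empty, Ideal.span_empty]
  have h1 : ∀ b, ι (ε b) = b := fun b => by
    refine (sub_eq_zero.mp (eq_zero_of_forall_mem_pow (I := I) fun n => ?_)).symm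
    simpa [hx, hy] using h.dense b n
  let φ : A ≃ₐ[ℂ] B := AlgEquiv.ofAlgHom ι ε (AlgHom.ext h1) (AlgHom.ext h.retract)
  have h2 : ∀ a b, Q.1 (ι a) (ι b) = ι (P.1 a b) := fun a b => by
    simpa [hx, sub_eq_zero] using h.bracket a b
  refine sliceIso_iff.mpr ⟨φ, fun a b => (h2 a b).symm, -ε e, fun a => ?_⟩
  have h3 : D (ι a) + Q.1 e (ι a) = ι (ξ a) := by
    simpa [hx, sub_eq_zero] using h.field a
  change D (ι a) = ι (ξ a + P.1 (-ε e) a)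
  rw [map_add, map_neg, LinearMap.neg_apply, map_neg, ← h2, h1, ← h3]
  ring

/-- Cancellation of symplectic disks. -/
theorem HasSlice.sliceIso {A' : Type*} [CommRing A'] [Algebra ℂ A'] {P' : Bivector A'}
    {ξ' : Derivation ℂ A' A'} {k : ℤ} {n : ℕ} (hI : IsGerm I) (hQ : IsPoisson Q)
    (hD : IsScaling k Q D) (h : HasSlice n Q D I P ξ) (h' : HasSlice n Q D I P' ξ') :
    SliceIso P ξ P' ξ' := by
  induction n generalizing B with
  | zero => exact (h.sliceIso_of_zero hI).symm.trans (h'.sliceIso_of_zero hI)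
  | succ n ih =>
    obtain ⟨x, y, ι, ε, e, h⟩ := h
    obtain ⟨x', y', ι', ε', e', h'⟩ := h'
    have hc := h.isCut
    have hc' := h'.isCut
    obtain ⟨e₁, h1, h2⟩ := hc.exists_adjust hI hQ hD
    obtain ⟨e₂, h3, h4⟩ := hc'.exists_adjust hI hQ hD
    have hD₁ := hD.add_hamiltonian hQ e₁
    have hZ := hc.map_mem hD₁ (a := 0) (by rw [h1, zero_smul]) h2
    have hZ' := hc'.map_mem (hD.add_hamiltonian hQ e₂) (a := 0) (by rw [h3, zero_smul]) h4
    -- Both slices live on the centralizer of the first pair of h: the slice coming from h' is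
    -- carried there by `IsCut.sliceIso`.
    exact ih (hc.isGerm hI hQ) (restrictBivector_isPoisson hQ _ _)
      (restrictDerivation_isScaling hD₁ _ (hc.bracket_mem hQ) hZ)
      (h.reduce hI hQ hc rfl hZ)
      ((h'.reduce hI hQ hc' rfl hZ').of_sliceIso (hc.isGerm hI hQ) (hc'.isGerm hI hQ)
        (IsCut.sliceIso hI hQ hc hc' hD rfl rfl h1 h3 hZ hZ'))

end Slices

/-! ### Functoriality of adic completion -/

section Approximation

variable {L : Type*} [CommRing L] {I : Ideal L}

/-- `l` represents `x` modulo `Iⁿ`. -/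
def Approx (n : ℕ) (x : AdicCompletion I L) (l : L) : Prop :=
  AdicCompletion.evalₐ I n x = Ideal.Quotient.mk (I ^ n) l

namespace Approx

theorem exists_approx (n : ℕ) (x : AdicCompletion I L) : ∃ l, Approx n x l :=
  ⟨rep x n, (mk_rep x n).symm⟩

theorem mono {m n : ℕ} (hle : m ≤ n) {x : AdicCompletion I L} {l : L} (h : Approx n x l) :
    Approx m x l := by
  rw [Approx, ← factorPow_evalₐ hle, h]; rfl

theorem succ {n : ℕ} {x : AdicCompletion I L} {l : L} (h : Approx (n + 1) x l) : Approx n x l :=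
  h.mono n.le_succ

theorem ext {x y : AdicCompletion I L} (h : ∀ n, ∃ l, Approx n x l ∧ Approx n y l) : x = y :=
  AdicCompletion.ext_evalₐ fun n => by
    obtain ⟨l, h1, h2⟩ := h n
    rw [h1, h2]

theorem sub_mem {n : ℕ} {x : AdicCompletion I L} {l l' : L} (h : Approx n x l)
    (h' : Approx n x l') : l - l' ∈ I ^ n := by
  rw [← Ideal.Quotient.eq, ← h, ← h']

theorem of_sub_mem {n : ℕ} {x : AdicCompletion I L} {l l' : L} (h : Approx n x l)
    (h' : l - l' ∈ I ^ n) : Approx n x l' := by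
  rw [Approx, h, Ideal.Quotient.eq]; exact h'

theorem add {n : ℕ} {x y : AdicCompletion I L} {a b : L} (hx : Approx n x a)
    (hy : Approx n y b) : Approx n (x + y) (a + b) := by
  rw [Approx, map_add, map_add, hx, hy]

theorem sub {n : ℕ} {x y : AdicCompletion I L} {a b : L} (hx : Approx n x a)
    (hy : Approx n y b) : Approx n (x - y) (a - b) := by
  rw [Approx, map_sub, map_sub, hx, hy]

theorem mul {n : ℕ} {x y : AdicCompletion I L} {a b : L} (hx : Approx n x a)
    (hy : Approx n y b) : Approx n (x * y) (a * b) := by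
  rw [Approx, map_mul, map_mul, hx, hy]

theorem of_algebraMap (n : ℕ) (l : L) : Approx n (algebraMap L (AdicCompletion I L) l) l :=
  (AdicCompletion.evalₐ I n).commutes l

theorem zero (n : ℕ) : Approx n (0 : AdicCompletion I L) 0 := by
  rw [Approx, map_zero, map_zero]

theorem smul [Algebra ℂ L] {n : ℕ} {x : AdicCompletion I L} {a : L} (hx : Approx n x a) (c : ℂ) :
    Approx n (c • x) (c • a) := by
  have h : ((AdicCompletion.evalₐ I n).restrictScalars ℂ) (c • x) =
      c • ((AdicCompletion.evalₐ I n).restrictScalars ℂ) x := map_smul _ c x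
  exact h.trans (by rw [AlgHom.restrictScalars_apply, hx]; rfl)

end Approx

theorem exists_of_approx (f : ℕ → L) (hf : ∀ n, f n - f (n + 1) ∈ I ^ n) :
    ∃ x : AdicCompletion I L, ∀ n, Approx n x (f n) :=
  ⟨AdicCompletion.mk I L (AdicCompletion.AdicCauchySequence.mk I L f fun n => by
    rw [SModEq.sub_mem, smul_eq_mul, Ideal.mul_top]; exact hf n),
    fun n => by rw [Approx, AdicCompletion.evalₐ_mk]; rfl⟩

/-- Finite generation makes the inverse limit filtration agree with the powers of the extended
ideal. Without it the completion need not be complete for that ideal. -/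
theorem approx_zero_iff_mem (hI : I.FG) {n : ℕ} {x : AdicCompletion I L} :
    Approx n x 0 ↔ x ∈ (I.map (algebraMap L (AdicCompletion I L))) ^ n := by
  have h1 := AdicCompletion.pow_smul_top_eq_ker_eval (M := L) (n := n) hI
  have h2 : x ∈ (I ^ n • ⊤ : Submodule L (AdicCompletion I L)) ↔
      x ∈ (I.map (algebraMap L (AdicCompletion I L))) ^ n := by
    rw [Ideal.smul_top_eq_map, Ideal.map_pow]; rfl
  rw [← h2, h1, LinearMap.mem_ker, Approx, map_zero]
  have h3 : I ^ n ≤ I ^ n • ⊤ := by rw [smul_eq_mul, Ideal.mul_top]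
  have h4 : I ^ n • ⊤ ≤ I ^ n := by rw [smul_eq_mul, Ideal.mul_top]
  constructor
  · intro h
    rw [← AdicCompletion.factor_evalₐ_eq_eval I x h3, h, map_zero]
  · intro h
    rw [← AdicCompletion.factor_eval_eq_evalₐ I x h4, h, map_zero]

theorem Approx.iff_sub_mem (hI : I.FG) {n : ℕ} {x : AdicCompletion I L} {l : L} :
    Approx n x l ↔ x - algebraMap L (AdicCompletion I L) l ∈
      (I.map (algebraMap L (AdicCompletion I L))) ^ n := by
  rw [← approx_zero_iff_mem hI]
  refine ⟨fun h => by simpa using h.sub (Approx.of_algebraMap n l), fun h => ?_⟩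
  simpa using h.add (Approx.of_algebraMap n l)

theorem isAdicComplete_map_algebraMap (hI : I.FG) :
    IsAdicComplete (I.map (algebraMap L (AdicCompletion I L))) (AdicCompletion I L) :=
  (IsAdicComplete.map_algebraMap_iff _ _).mpr (AdicCompletion.isAdicComplete hI)

end Approximation

section Functoriality

variable {L L' L'' : Type*} [CommRing L] [Algebra ℂ L] [CommRing L'] [Algebra ℂ L']
  [CommRing L''] [Algebra ℂ L''] {I : Ideal L} {I' : Ideal L'} {I'' : Ideal L''}

/-- The inclusion of `L` into its completion. -/
def toCompletion (I : Ideal L) : L →ₐ[ℂ] AdicCompletion I L := IsScalarTower.toAlgHom ℂ L _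

theorem approx_toCompletion (n : ℕ) (l : L) : Approx n (toCompletion I l) l := Approx.of_algebraMap n l

theorem le_comap_pow_of_le (σ : L →ₐ[ℂ] L') (h : I ≤ I'.comap σ) (n : ℕ) :
    I ^ n ≤ (I' ^ n).comap σ := (Ideal.pow_right_mono h n).trans (Ideal.le_comap_pow σ n)

theorem factor_comp_quotientMap (σ : L →ₐ[ℂ] L') (h : I ≤ I'.comap σ) {m n : ℕ} (hle : m ≤ n) :
    (Ideal.Quotient.factorₐ ℂ (Ideal.pow_le_pow_right hle)).comp
      ((Ideal.quotientMapₐ (I' ^ n) σ (le_comap_pow_of_le σ h n)).comp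
        ((AdicCompletion.evalₐ I n).restrictScalars ℂ)) =
      (Ideal.quotientMapₐ (I' ^ m) σ (le_comap_pow_of_le σ h m)).comp
        ((AdicCompletion.evalₐ I m).restrictScalars ℂ) := by
    ext x
    obtain ⟨l, hl⟩ := Approx.exists_approx n x
    change Ideal.Quotient.factorₐ ℂ (Ideal.pow_le_pow_right hle)
      (Ideal.quotientMapₐ (I' ^ n) σ (le_comap_pow_of_le σ h n) (AdicCompletion.evalₐ I n x)) =
      Ideal.quotientMapₐ (I' ^ m) σ (le_comap_pow_of_le σ h m) (AdicCompletion.evalₐ I m x)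
    rw [hl, hl.mono hle]
    rfl

/-- The map between completions induced by a homomorphism compatible with the ideals. -/
def completionMap (σ : L →ₐ[ℂ] L') (h : I ≤ I'.comap σ) :
    AdicCompletion I L →ₐ[ℂ] AdicCompletion I' L' :=
  AdicCompletion.liftAlgHom I'
    (fun n => (Ideal.quotientMapₐ (I' ^ n) σ (le_comap_pow_of_le σ h n)).comp
      ((AdicCompletion.evalₐ I n).restrictScalars ℂ)) (factor_comp_quotientMap σ h)

theorem Approx.completionMap {σ : L →ₐ[ℂ] L'} (h : I ≤ I'.comap σ) {n : ℕ}
    {x : AdicCompletion I L} {l : L} (hx : Approx n x l) :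
    Approx n (completionMap σ h x) (σ l) := by
  refine (AdicCompletion.evalₐ_liftAlgHom I' _ (factor_comp_quotientMap σ h) n x).trans ?_
  rw [AlgHom.comp_apply, AlgHom.restrictScalars_apply, hx]
  rfl

theorem completionMap_toCompletion (σ : L →ₐ[ℂ] L') (h : I ≤ I'.comap σ) (l : L) :
    completionMap σ h (toCompletion I l) = toCompletion I' (σ l) :=
  Approx.ext fun n => ⟨σ l, (approx_toCompletion n l).completionMap h, approx_toCompletion n _⟩

/-- An isomorphism compatible with the ideals induces an isomorphism of completions. -/
def completionEquiv (σ : L ≃ₐ[ℂ] L') (h : I ≤ I'.comap (σ : L →ₐ[ℂ] L'))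
    (h' : I' ≤ I.comap (σ.symm : L' →ₐ[ℂ] L)) : AdicCompletion I L ≃ₐ[ℂ] AdicCompletion I' L' :=
  AlgEquiv.ofAlgHom (completionMap _ h) (completionMap _ h')
    (AlgHom.ext fun x => Approx.ext fun n => by
      obtain ⟨l, hl⟩ := Approx.exists_approx n x
      exact ⟨l, by simpa using (hl.completionMap h').completionMap h, hl⟩)
    (AlgHom.ext fun x => Approx.ext fun n => by
      obtain ⟨l, hl⟩ := Approx.exists_approx n x
      exact ⟨l, by simpa using (hl.completionMap h).completionMap h', hl⟩)

/-- A biderivation lowers the order of vanishing by at most one in each argument, whence the shift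
from n + 1 to n. -/
theorem Approx.bracket (P : Bivector L) {n : ℕ} {x y : AdicCompletion I L} {a b : L}
    (hx : Approx (n + 1) x a) (hy : Approx (n + 1) y b) : Approx n (bracket P x y) (P.1 a b) := by
  have h : Approx n (FormalPoisson.bracket P x y) (P.1 (rep x (n + 1)) (rep y (n + 1))) := by
    rw [Approx, FormalPoisson.bracket, AdicCompletion.evalₐ_mk]; rfl
  refine h.of_sub_mem ?_
  have h1 : Approx (n + 1) x (rep x (n + 1)) := (mk_rep x _).symm
  have h2 : Approx (n + 1) y (rep y (n + 1)) := (mk_rep y _).symm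
  have h3 : P.1 (rep x (n + 1)) (rep y (n + 1)) - P.1 a b =
      P.1 (rep x (n + 1) - a) (rep y (n + 1)) + P.1 a (rep y (n + 1) - b) := by
    simp only [map_sub, LinearMap.sub_apply]; abel
  rw [h3]
  exact add_mem (bivector_mem_left P n _ (h1.sub_mem hx)) (bivector_mem_right P n _ (h2.sub_mem hy))

/-- The bracket on the completion defined by a bivector, as a bivector. -/
def completionBivector (I : Ideal L) (P : Bivector L) : Bivector (AdicCompletion I L) :=
  ⟨LinearMap.mk₂ ℂ (bracket P)
    (fun x x' y => Approx.ext fun n => by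
      obtain ⟨a, ha⟩ := Approx.exists_approx (n + 1) x
      obtain ⟨a', ha'⟩ := Approx.exists_approx (n + 1) x'
      obtain ⟨b, hb⟩ := Approx.exists_approx (n + 1) y
      exact ⟨_, (ha.add ha').bracket P hb, by
        simpa using (ha.bracket P hb).add (ha'.bracket P hb)⟩)
    (fun c x y => Approx.ext fun n => by
      obtain ⟨a, ha⟩ := Approx.exists_approx (n + 1) x
      obtain ⟨b, hb⟩ := Approx.exists_approx (n + 1) y
      exact ⟨_, (ha.smul c).bracket P hb, by simpa using (ha.bracket P hb).smul c⟩)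
    (fun x y y' => Approx.ext fun n => by
      obtain ⟨a, ha⟩ := Approx.exists_approx (n + 1) x
      obtain ⟨b', hb'⟩ := Approx.exists_approx (n + 1) y'
      obtain ⟨b, hb⟩ := Approx.exists_approx (n + 1) y
      exact ⟨_, ha.bracket P (hb.add hb'), by
        simpa using (ha.bracket P hb).add (ha.bracket P hb')⟩)
    (fun c x y => Approx.ext fun n => by
      obtain ⟨a, ha⟩ := Approx.exists_approx (n + 1) x
      obtain ⟨b, hb⟩ := Approx.exists_approx (n + 1) y
      exact ⟨_, ha.bracket P (hb.smul c), by simpa using (ha.bracket P hb).smul c⟩),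
    fun x => Approx.ext fun n => by
      obtain ⟨a, ha⟩ := Approx.exists_approx (n + 1) x
      exact ⟨_, ha.bracket P ha, by rw [P.2.1]; exact Approx.zero n⟩,
    fun x y z => Approx.ext fun n => by
      obtain ⟨a, ha⟩ := Approx.exists_approx (n + 1) x
      obtain ⟨b, hb⟩ := Approx.exists_approx (n + 1) y
      obtain ⟨c, hc⟩ := Approx.exists_approx (n + 1) z
      exact ⟨_, ha.bracket P (hb.mul hc), by
        rw [P.2.2]
        exact ((ha.bracket P hb).mul hc.succ).add (hb.succ.mul (ha.bracket P hc))⟩⟩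

theorem Approx.completionBivector (P : Bivector L) {n : ℕ} {x y : AdicCompletion I L} {a b : L}
    (hx : Approx (n + 1) x a) (hy : Approx (n + 1) y b) :
    Approx n ((completionBivector I P).1 x y) (P.1 a b) := hx.bracket P hy

theorem completionBivector_toCompletion (P : Bivector L) (a b : L) :
    (completionBivector I P).1 (toCompletion I a) (toCompletion I b) = toCompletion I (P.1 a b) :=
  Approx.ext fun n => ⟨_, (approx_toCompletion _ a).completionBivector P (approx_toCompletion _ b),
    approx_toCompletion n _⟩

theorem completionBivector_isPoisson {P : Bivector L} (hP : IsPoisson P) :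
    IsPoisson (completionBivector I P) := fun x y z => Approx.ext fun n => by
  obtain ⟨a, ha⟩ := Approx.exists_approx (n + 1 + 1) x
  obtain ⟨b, hb⟩ := Approx.exists_approx (n + 1 + 1) y
  obtain ⟨c, hc⟩ := Approx.exists_approx (n + 1 + 1) z
  refine ⟨_, ((ha.succ.completionBivector P (hb.completionBivector P hc)).add
    (hb.succ.completionBivector P (hc.completionBivector P ha))).add
    (hc.succ.completionBivector P (ha.completionBivector P hb)), ?_⟩
  rw [hP]
  exact Approx.zero n

theorem exists_completionDerivation (D : Derivation ℂ L L) (x : AdicCompletion I L) :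
    ∃ y : AdicCompletion I L, ∀ n l, Approx (n + 1) x l → Approx n y (D l) := by
  obtain ⟨y, hy⟩ := exists_of_approx (I := I) (fun n => D (rep x (n + 1))) fun n => by
    rw [← map_sub]
    exact derivation_mem D n (rep_sub_mem x (n + 1))
  refine ⟨y, fun n l hl => (hy n).of_sub_mem ?_⟩
  rw [← map_sub]
  have h1 : Approx (n + 1) x (rep x (n + 1)) := (mk_rep x _).symm
  exact derivation_mem D n (h1.sub_mem hl)

/-- The continuous extension of a vector field to the completion. -/
def completionDerivation (I : Ideal L) (D : Derivation ℂ L L) :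
    Derivation ℂ (AdicCompletion I L) (AdicCompletion I L) :=
  Derivation.mk'
    { toFun := fun x => (exists_completionDerivation D x).choose
      map_add' := fun x y => Approx.ext fun n => by
        obtain ⟨a, ha⟩ := Approx.exists_approx (n + 1) x
        obtain ⟨b, hb⟩ := Approx.exists_approx (n + 1) y
        exact ⟨_, (exists_completionDerivation D _).choose_spec n _ (ha.add hb), by
          rw [map_add]
          exact ((exists_completionDerivation D x).choose_spec n _ ha).add
            ((exists_completionDerivation D y).choose_spec n _ hb)⟩
      map_smul' := fun c x => Approx.ext fun n => by
        obtain ⟨a, ha⟩ := Approx.exists_approx (n + 1) x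
        exact ⟨_, (exists_completionDerivation D _).choose_spec n _ (ha.smul c), by
          rw [Derivation.map_smul]
          exact ((exists_completionDerivation D x).choose_spec n _ ha).smul c⟩ }
    fun x y => Approx.ext fun n => by
      obtain ⟨a, ha⟩ := Approx.exists_approx (n + 1) x
      obtain ⟨b, hb⟩ := Approx.exists_approx (n + 1) y
      exact ⟨_, (exists_completionDerivation D _).choose_spec n _ (ha.mul hb), by
        rw [D.leibniz]
        exact (ha.succ.mul ((exists_completionDerivation D y).choose_spec n _ hb)).add
          (hb.succ.mul ((exists_completionDerivation D x).choose_spec n _ ha))⟩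

theorem Approx.completionDerivation (D : Derivation ℂ L L) {n : ℕ} {x : AdicCompletion I L} {l : L}
    (h : Approx (n + 1) x l) : Approx n (completionDerivation I D x) (D l) :=
  (exists_completionDerivation D x).choose_spec n l h

theorem completionDerivation_toCompletion (D : Derivation ℂ L L) (l : L) :
    completionDerivation I D (toCompletion I l) = toCompletion I (D l) :=
  Approx.ext fun n => ⟨_, (approx_toCompletion _ l).completionDerivation D,
    approx_toCompletion n _⟩

theorem completionDerivation_isScaling {P : Bivector L} {D : Derivation ℂ L L} {k : ℤ}
    (h : IsScaling k P D) : IsScaling k (completionBivector I P) (completionDerivation I D) :=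
  fun x y => Approx.ext fun n => by
    obtain ⟨a, ha⟩ := Approx.exists_approx (n + 1 + 1) x
    obtain ⟨b, hb⟩ := Approx.exists_approx (n + 1 + 1) y
    refine ⟨_, (((ha.completionBivector P hb).completionDerivation D).sub
      ((ha.completionDerivation D).completionBivector P hb.succ)).sub
      (ha.succ.completionBivector P (hb.completionDerivation D)), ?_⟩
    rw [h]
    exact (ha.succ.completionBivector P hb.succ).smul _

theorem completionMap_completionBivector {σ : L →ₐ[ℂ] L'} (h : I ≤ I'.comap σ) {P : Bivector L}
    {P' : Bivector L'} (hP : ∀ a b, σ (P.1 a b) = P'.1 (σ a) (σ b)) (x y : AdicCompletion I L) :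
    completionMap σ h ((completionBivector I P).1 x y) =
      (completionBivector I' P').1 (completionMap σ h x) (completionMap σ h y) :=
  Approx.ext fun n => by
    obtain ⟨a, ha⟩ := Approx.exists_approx (n + 1) x
    obtain ⟨b, hb⟩ := Approx.exists_approx (n + 1) y
    refine ⟨_, (ha.completionBivector P hb).completionMap h, ?_⟩
    rw [hP]
    exact (ha.completionMap h).completionBivector P' (hb.completionMap h)

theorem completionMap_completionDerivation {σ : L →ₐ[ℂ] L'} (h : I ≤ I'.comap σ)
    {D : Derivation ℂ L L} {D' : Derivation ℂ L' L'} (hD : ∀ a, σ (D a) = D' (σ a))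
    (x : AdicCompletion I L) : completionMap σ h (completionDerivation I D x) =
      completionDerivation I' D' (completionMap σ h x) :=
  Approx.ext fun n => by
    obtain ⟨a, ha⟩ := Approx.exists_approx (n + 1) x
    refine ⟨_, (ha.completionDerivation D).completionMap h, ?_⟩
    rw [hD]
    exact (ha.completionMap h).completionDerivation D'

/-- The extension to the completion of a homomorphism to a complete algebra. -/
def completionLift (σ : L →ₐ[ℂ] L') (h : I ≤ I'.comap σ) (hc : IsAdicComplete I' L') :
    AdicCompletion I L →ₐ[ℂ] L' :=
  ((AdicCompletion.ofAlgEquiv I').restrictScalars ℂ).symm.toAlgHom.comp (completionMap σ h)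

theorem completionLift_sub_mem {σ : L →ₐ[ℂ] L'} (h : I ≤ I'.comap σ) (hc : IsAdicComplete I' L')
    {n : ℕ} {x : AdicCompletion I L} {l : L} (hx : Approx n x l) :
    completionLift σ h hc x - σ l ∈ I' ^ n := by
  rw [← Ideal.Quotient.eq]
  have h1 := AdicCompletion.mk_ofAlgEquiv_symm I' n (completionMap σ h x)
  exact h1.trans (hx.completionMap h)

theorem completionLift_toCompletion {σ : L →ₐ[ℂ] L'} (h : I ≤ I'.comap σ)
    (hc : IsAdicComplete I' L') (l : L) : completionLift σ h hc (toCompletion I l) = σ l :=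
  sub_eq_zero.mp (eq_zero_of_forall_mem_pow (I := I') fun n =>
    completionLift_sub_mem h hc (approx_toCompletion n l))

/-- Completing at the kernel of a character leaves one closed point, whose residue field is read off
from an approximation of order 1. -/
theorem isGerm_completion {χ : L →ₐ[ℂ] ℂ} (hI : I.FG) (hχ : ∀ l, l ∈ I ↔ χ l = 0) :
    IsGerm (I.map (algebraMap L (AdicCompletion I L))) where
  complete := isAdicComplete_map_algebraMap hI
  residue x := by
    obtain ⟨l, hl⟩ := Approx.exists_approx 1 x
    have h1 : l - algebraMap ℂ L (χ l) ∈ I := (hχ _).mpr (by simp)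
    have h2 := (Approx.iff_sub_mem hI).mp (hl.of_sub_mem (by rwa [pow_one]))
    refine ⟨χ l, ?_⟩
    rwa [pow_one, ← IsScalarTower.algebraMap_apply] at h2
  ne_top := by
    rw [Ne, Ideal.eq_top_iff_one, ← pow_one (Ideal.map _ _), ← approx_zero_iff_mem hI]
    intro h
    have h1 := (Approx.of_algebraMap (I := I) 1 1).sub_mem (l' := 0) (by rwa [map_one])
    rw [sub_zero, pow_one, hχ, map_one] at h1
    exact one_ne_zero h1

end Functoriality

/-! ### Checking identities on generators -/

section Generators

variable {L : Type*} [CommRing L] [Algebra ℂ L] {S : Set L}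

theorem derivation_comm_of_generators (hS : Algebra.adjoin ℂ S = ⊤) {D D' : Derivation ℂ L L}
    (h : ∀ s ∈ S, D (D' s) = D' (D s)) (x : L) : D (D' x) = D' (D x) := by
  have h1 : ⁅D, D'⁆ = 0 := Derivation.ext_of_adjoin_eq_top S hS fun s hs => by
    rw [Derivation.commutator_apply, h s hs, sub_self]; rfl
  have h2 := DFunLike.congr_fun h1 x
  rwa [Derivation.commutator_apply, Derivation.zero_apply, sub_eq_zero] at h2

/-- The defect [D, Q] - kQ is again a biderivation, so its vanishing propagates from generators one
argument at a time. -/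
theorem isScaling_of_generators (hS : Algebra.adjoin ℂ S = ⊤) {Q : Bivector L}
    {D : Derivation ℂ L L} {k : ℤ}
    (h : ∀ s ∈ S, ∀ s' ∈ S, D (Q.1 s s') - Q.1 (D s) s' - Q.1 s (D s') = (k : ℂ) • Q.1 s s') :
    IsScaling k Q D := by
  have h1 : ∀ b, (∀ s ∈ S, D (Q.1 s b) - Q.1 (D s) b - Q.1 s (D b) = (k : ℂ) • Q.1 s b) →
      ∀ a, D (Q.1 a b) - Q.1 (D a) b - Q.1 a (D b) = (k : ℂ) • Q.1 a b := by
    intro b hb a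
    have h1 : ⁅D, bracketRight Q b⁆ - bracketRight Q (D b) = (k : ℂ) • bracketRight Q b :=
      Derivation.ext_of_adjoin_eq_top S hS fun s hs => by
        simpa only [Derivation.sub_apply, Derivation.smul_apply, Derivation.commutator_apply,
          bracketRight_apply] using hb s hs
    simpa only [Derivation.sub_apply, Derivation.smul_apply, Derivation.commutator_apply,
      bracketRight_apply] using DFunLike.congr_fun h1 a
  intro a b
  have h2 : ∀ s ∈ S, ∀ a, D (Q.1 a s) - Q.1 (D a) s - Q.1 a (D s) = (k : ℂ) • Q.1 a s :=
    fun s hs a => h1 s (fun s' hs' => h s' hs' s hs) a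
  refine h1 b (fun s hs => ?_) a
  have h3 := h2 s hs b
  rw [bivector_skew Q s b, bivector_skew Q (D s) b, bivector_skew Q s (D b), map_neg, smul_neg,
    ← h3]
  ring

/-- The Jacobi identity says that Hamiltonian fields preserve the bracket. For generators this
follows from the scaling criterion with k = 0; the remaining argument is then an identity of
derivations. -/
theorem isPoisson_of_generators (hS : Algebra.adjoin ℂ S = ⊤) {Q : Bivector L}
    (h : ∀ s ∈ S, ∀ s' ∈ S, ∀ s'' ∈ S,
      Q.1 s (Q.1 s' s'') = Q.1 (Q.1 s s') s'' + Q.1 s' (Q.1 s s'')) : IsPoisson Q := by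
  have h1 : ∀ s ∈ S, IsScaling 0 Q (hamiltonian Q s) := fun s hs =>
    isScaling_of_generators hS fun s' hs' s'' hs'' => by
      simp only [hamiltonian_apply, h s hs s' hs' s'' hs'', Int.cast_zero, zero_smul]; ring
  have h2 : ∀ a b c, Q.1 a (Q.1 b c) = Q.1 (Q.1 a b) c + Q.1 b (Q.1 a c) := by
    intro a b c
    have h3 : bracketRight Q (Q.1 b c) = ⁅bracketRight Q c, bracketRight Q b⁆ :=
      Derivation.ext_of_adjoin_eq_top S hS fun s hs => by
        have h4 := h1 s hs b c
        simp only [hamiltonian_apply, Int.cast_zero, zero_smul] at h4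
        rw [Derivation.commutator_apply, bracketRight_apply, bracketRight_apply,
          bracketRight_apply, bracketRight_apply, bracketRight_apply, bivector_skew Q (Q.1 s c)]
        linear_combination h4
    have h4 := DFunLike.congr_fun h3 a
    rw [Derivation.commutator_apply, bracketRight_apply, bracketRight_apply,
      bracketRight_apply, bracketRight_apply, bracketRight_apply, bivector_skew Q (Q.1 a c)] at h4
    linear_combination h4
  intro a b c
  rw [h2 a b c, bivector_skew Q c (Q.1 a b), bivector_skew Q c a, map_neg]
  ring

theorem map_bivector_of_generators {L' : Type*} [CommRing L'] [Algebra ℂ L']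
    (hS : Algebra.adjoin ℂ S = ⊤) {Q : Bivector L} {Q' : Bivector L'} {σ : L →ₐ[ℂ] L'} {c : ℂ}
    (h : ∀ s ∈ S, ∀ s' ∈ S, σ (Q.1 s s') = c • Q'.1 (σ s) (σ s')) (a b : L) :
    σ (Q.1 a b) = c • Q'.1 (σ a) (σ b) := by
  have hc : ∀ (Q : Bivector L) (z : ℂ) (y : L), Q.1 (algebraMap ℂ L z) y = 0 := fun Q z y => by
    rw [bivector_skew, bivector_algebraMap, neg_zero]
  have hc' : ∀ (Q : Bivector L') (z : ℂ) (y : L'), Q.1 (algebraMap ℂ L' z) y = 0 := fun Q z y => by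
    rw [bivector_skew, bivector_algebraMap, neg_zero]
  have h1 : ∀ y, (∀ s ∈ S, σ (Q.1 s y) = c • Q'.1 (σ s) (σ y)) →
      ∀ x, σ (Q.1 x y) = c • Q'.1 (σ x) (σ y) := by
    intro y hy x
    have hx : x ∈ Algebra.adjoin ℂ S := hS ▸ Algebra.mem_top
    induction hx using Algebra.adjoin_induction with
    | mem s hs => exact hy s hs
    | algebraMap z => rw [hc, AlgHom.commutes, hc', map_zero, smul_zero]
    | add x x' _ _ hx hx' => simp only [map_add, LinearMap.add_apply, hx, hx', smul_add]
    | mul x x' _ _ hx hx' =>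
      rw [bivector_leibniz_left, map_add, map_mul, map_mul, hx, hx', map_mul, bivector_leibniz_left,
        smul_add, mul_smul_comm, mul_smul_comm]
  refine h1 b (fun s hs => ?_) a
  rw [bivector_skew, bivector_skew Q', map_neg, smul_neg,
    h1 s (fun s' hs' => h s' hs' s hs) b]

/-- Conditions under which `τ (∂ ∧ η + W)` is a Poisson bivector. -/
theorem isPoisson_smul_wedge_add {W : Bivector L} {δ η : Derivation ℂ L L} {τ : L} {k : ℤ}
    (hW : IsPoisson W) (hη : IsScaling k W η) (hδ : IsScaling 0 W δ)
    (hc : ∀ x, δ (η x) = η (δ x)) (h1 : δ τ = 0) (h2 : η τ = -(k : ℂ) • τ)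
    (h3 : ∀ x, W.1 x τ = 0) : IsPoisson (τ • (wedge δ η + W)) := by
  have hw : ∀ a b, (τ • (wedge δ η + W)).1 a b = τ * (δ a * η b - η a * δ b + W.1 a b) :=
    fun a b => rfl
  have hδ' : ∀ a b, δ (W.1 a b) = W.1 (δ a) b + W.1 a (δ b) := fun a b => by
    have := hδ a b
    rw [Int.cast_zero, zero_smul] at this
    linear_combination this
  have hη' : ∀ a b, η (W.1 a b) = W.1 (η a) b + W.1 a (η b) + (k : L) * W.1 a b := fun a b => by
    have := hη a b
    rw [Algebra.smul_def, map_intCast] at this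
    linear_combination this
  have h2' : η τ = -(k : L) * τ := by rw [h2, neg_smul, Algebra.smul_def, map_intCast, neg_mul]
  intro a b c
  simp only [hw, Derivation.leibniz, bivector_leibniz_right, map_add, map_sub, smul_eq_mul, h1, h2',
    h3, hδ', hη', hc]
  have e1 := hW a b c
  rw [bivector_skew W c (η a), bivector_skew W c (δ a), bivector_skew W b (δ a),
    bivector_skew W b (η a), bivector_skew W c (δ b), bivector_skew W c (η b),
    bivector_skew W a (δ c), bivector_skew W a (η c)]
  linear_combination τ ^ 2 * e1

theorem map_bivector_add {Q Q' : Bivector L} (a b : L) : (Q + Q').1 a b = Q.1 a b + Q'.1 a b := rfl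

end Generators

/-! ### Coordinates on the product -/

section Coordinates

variable {m : ℕ} {A : Type*} [CommRing A] [Algebra ℂ A]

theorem Base.mk_mul {m : ℕ} (f f' : ℂ[T;T⁻¹]) (g g' : MvPolynomial (DiskCoord m) ℂ) :
    Base.mk f g * Base.mk f' g' = Base.mk (f * f') (g * g') :=
  Algebra.TensorProduct.tmul_mul_tmul _ _ _ _

theorem Base.induction_on {p : Base m → Prop} (b : Base m) (zero : p 0)
    (mk : ∀ f g, p (Base.mk f g)) (add : ∀ b b', p b → p b' → p (b + b')) : p b :=
  TensorProduct.induction_on b zero mk add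

theorem Base.one_def : (1 : Base m) = Base.mk 1 1 := rfl

theorem tPow_add (i j : ℤ) : tPow m A (i + j) = tPow m A i * tPow m A j := by
  rw [tPow, tPow, tPow, Algebra.TensorProduct.tmul_mul_tmul, Base.mk_mul, LaurentPolynomial.T_add,
    one_mul, one_mul]

@[simp] theorem tPow_zero : tPow m A 0 = 1 := by
  rw [tPow, LaurentPolynomial.T_zero]; rfl

theorem tPow_mul_neg (i : ℤ) : tPow m A i * tPow m A (-i) = 1 := by
  rw [← tPow_add, add_neg_cancel, tPow_zero]

/-- Functions on the slice as functions on the product. -/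
def sliceHom (m : ℕ) (A : Type*) [CommRing A] [Algebra ℂ A] : A →ₐ[ℂ] PreFun m A :=
  Algebra.TensorProduct.includeRight

@[simp] theorem sliceHom_apply (a : A) : sliceHom m A a = fromSlice m A a := rfl

@[simp] theorem fromSlice_zero : fromSlice m A 0 = 0 := map_zero (sliceHom m A)

/-- Generators of the ring of functions on the product. -/
def generators (m : ℕ) (A : Type*) [CommRing A] [Algebra ℂ A] : Set (PreFun m A) :=
  Set.range (tPow m A) ∪ Set.range (coord m A) ∪ Set.range (fromSlice m A)

theorem tPow_mem_generators (i : ℤ) : tPow m A i ∈ generators m A := Or.inl (Or.inl ⟨i, rfl⟩)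

theorem coord_mem_generators (i : DiskCoord m) : coord m A i ∈ generators m A :=
  Or.inl (Or.inr ⟨i, rfl⟩)

theorem fromSlice_mem_generators (a : A) : fromSlice m A a ∈ generators m A := Or.inr ⟨a, rfl⟩

theorem adjoin_generators : Algebra.adjoin ℂ (generators m A) = ⊤ := by
  set G := Algebra.adjoin ℂ (generators m A)
  have ht : ∀ f : ℂ[T;T⁻¹], (Base.mk f 1 : Base m) ⊗ₜ[ℂ] (1 : A) ∈ G := by
    intro f
    induction f using LaurentPolynomial.induction_on' with
    | add f f' hf hf' =>
      have : (Base.mk (f + f') 1 : Base m) = Base.mk f 1 + Base.mk f' 1 :=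
        TensorProduct.add_tmul _ _ _
      rw [this, TensorProduct.add_tmul]; exact add_mem hf hf'
    | C_mul_T n a =>
      have : (Base.mk (LaurentPolynomial.C a * LaurentPolynomial.T n) 1 : Base m) =
          a • Base.mk (LaurentPolynomial.T n) 1 := by
        rw [← LaurentPolynomial.smul_eq_C_mul]; rfl
      rw [this, ← TensorProduct.smul_tmul']
      exact Subalgebra.smul_mem _ (Algebra.subset_adjoin (tPow_mem_generators n)) a
  have hg : ∀ g : MvPolynomial (DiskCoord m) ℂ, (Base.mk 1 g : Base m) ⊗ₜ[ℂ] (1 : A) ∈ G := by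
    intro g
    induction g using MvPolynomial.induction_on with
    | C a =>
      have : (Base.mk 1 (MvPolynomial.C a) : Base m) ⊗ₜ[ℂ] (1 : A) = algebraMap ℂ _ a := by
        have h1 : (Base.mk 1 (MvPolynomial.C a) : Base m) = a • 1 := by
          rw [Base.one_def, MvPolynomial.C_eq_smul_one]
          exact TensorProduct.tmul_smul _ _ _
        rw [h1, ← TensorProduct.smul_tmul', Algebra.algebraMap_eq_smul_one]; rfl
      rw [this]; exact Subalgebra.algebraMap_mem _ _
    | add g g' hg hg' =>
      have : (Base.mk 1 (g + g') : Base m) = Base.mk 1 g + Base.mk 1 g' :=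
        TensorProduct.tmul_add _ _ _
      rw [this, TensorProduct.add_tmul]; exact add_mem hg hg'
    | mul_X g i hg =>
      have : (Base.mk 1 (g * MvPolynomial.X i) : Base m) ⊗ₜ[ℂ] (1 : A) =
          (Base.mk 1 g : Base m) ⊗ₜ[ℂ] (1 : A) * coord m A i := by
        rw [coord, Algebra.TensorProduct.tmul_mul_tmul, Base.mk_mul, one_mul, one_mul]
      rw [this]; exact mul_mem hg (Algebra.subset_adjoin (coord_mem_generators i))
  rw [eq_top_iff]
  rintro x -
  induction x using TensorProduct.induction_on with
  | zero => exact zero_mem _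
  | add x y hx hy => exact add_mem hx hy
  | tmul b a =>
    have : b ⊗ₜ[ℂ] a = b ⊗ₜ[ℂ] 1 * fromSlice m A a := by
      rw [fromSlice, Algebra.TensorProduct.tmul_mul_tmul, one_mul, mul_one]
    rw [this]
    refine mul_mem ?_ (Algebra.subset_adjoin (fromSlice_mem_generators a))
    refine Base.induction_on (p := fun b => b ⊗ₜ[ℂ] (1 : A) ∈ G) b ?_ (fun f g => ?_)
      (fun b b' hb hb' => ?_)
    · rw [TensorProduct.zero_tmul]; exact zero_mem _
    · have : (Base.mk f g : Base m) ⊗ₜ[ℂ] (1 : A) =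
          (Base.mk f 1 : Base m) ⊗ₜ[ℂ] (1 : A) * (Base.mk 1 g : Base m) ⊗ₜ[ℂ] (1 : A) := by
        rw [Algebra.TensorProduct.tmul_mul_tmul, Base.mk_mul, one_mul, one_mul, mul_one]
      rw [this]; exact mul_mem (ht f) (hg g)
    · rw [TensorProduct.add_tmul]; exact add_mem hb hb'

theorem generators_induction {p : PreFun m A → Prop} (ht : ∀ i, p (tPow m A i))
    (hc : ∀ i, p (coord m A i)) (ha : ∀ a, p (fromSlice m A a)) : ∀ s ∈ generators m A, p s := by
  rintro _ ((⟨i, rfl⟩ | ⟨i, rfl⟩) | ⟨a, rfl⟩)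
  exacts [ht i, hc i, ha a]

theorem onLeft_tmul {A B : Type*} [CommRing A] [Algebra ℂ A] [CommRing B] [Algebra ℂ B]
    (D : Derivation ℂ A A) (a : A) (b : B) : onLeft D (a ⊗ₜ[ℂ] b) = D a ⊗ₜ[ℂ] b := rfl

theorem onRight_tmul {A B : Type*} [CommRing A] [Algebra ℂ A] [CommRing B] [Algebra ℂ B]
    (D : Derivation ℂ B B) (a : A) (b : B) : onRight D (a ⊗ₜ[ℂ] b) = a ⊗ₜ[ℂ] D b := rfl

@[simp] theorem partialT_tPow (i : ℤ) :
    partialT m A (tPow m A i) = (i : ℂ) • tPow m A (i - 1) := by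
  have h : laurentDeriv (LaurentPolynomial.T i) = (i : ℂ) • LaurentPolynomial.T (i - 1) :=
    laurentDerivMap_T i
  rw [partialT, tPow, onLeft_tmul, baseDerivT_mk, h]; rfl

@[simp] theorem partialT_coord (i : DiskCoord m) : partialT m A (coord m A i) = 0 := by
  rw [partialT, coord, onLeft_tmul, baseDerivT_mk, Derivation.map_one_eq_zero]
  have : (Base.mk 0 (MvPolynomial.X i) : Base m) = 0 := TensorProduct.zero_tmul _ _
  rw [this, TensorProduct.zero_tmul]

@[simp] theorem partialT_fromSlice (a : A) : partialT m A (fromSlice m A a) = 0 := by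
  rw [partialT, fromSlice, onLeft_tmul, Derivation.map_one_eq_zero, TensorProduct.zero_tmul]

@[simp] theorem partialDisk_tPow (j : DiskCoord m) (i : ℤ) :
    partialDisk m A j (tPow m A i) = 0 := by
  rw [partialDisk, tPow, onLeft_tmul, baseDerivDisk_mk, Derivation.map_one_eq_zero]
  have : (Base.mk (LaurentPolynomial.T i) 0 : Base m) = 0 := TensorProduct.tmul_zero _ _
  rw [this, TensorProduct.zero_tmul]

@[simp] theorem partialDisk_coord (j i : DiskCoord m) :
    partialDisk m A j (coord m A i) = if i = j then 1 else 0 := by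
  rw [partialDisk, coord, onLeft_tmul, baseDerivDisk_mk, MvPolynomial.pderiv_X, Pi.single_apply]
  split_ifs
  · rfl
  · have : (Base.mk 1 0 : Base m) = 0 := TensorProduct.tmul_zero _ _
    rw [this, TensorProduct.zero_tmul]

@[simp] theorem partialDisk_fromSlice (j : DiskCoord m) (a : A) :
    partialDisk m A j (fromSlice m A a) = 0 := by
  rw [partialDisk, fromSlice, onLeft_tmul, Derivation.map_one_eq_zero, TensorProduct.zero_tmul]

/-- A vector field on the slice, as a vector field on the product. -/
def sliceField (m : ℕ) {A : Type*} [CommRing A] [Algebra ℂ A] (ξ : Derivation ℂ A A) :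
    Derivation ℂ (PreFun m A) (PreFun m A) := onRight ξ

/-- A bivector on the slice, as a bivector on the product. -/
def sliceBivector (m : ℕ) {A : Type*} [CommRing A] [Algebra ℂ A] (P : Bivector A) :
    Bivector (PreFun m A) := bivectorOnRight P

@[simp] theorem sliceField_tPow (ξ : Derivation ℂ A A) (i : ℤ) :
    sliceField m ξ (tPow m A i) = 0 := by
  rw [sliceField, tPow, onRight_tmul, Derivation.map_one_eq_zero, TensorProduct.tmul_zero]

@[simp] theorem sliceField_coord (ξ : Derivation ℂ A A) (i : DiskCoord m) :
    sliceField m ξ (coord m A i) = 0 := by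
  rw [sliceField, coord, onRight_tmul, Derivation.map_one_eq_zero, TensorProduct.tmul_zero]

@[simp] theorem sliceField_fromSlice (ξ : Derivation ℂ A A) (a : A) :
    sliceField m ξ (fromSlice m A a) = fromSlice m A (ξ a) := rfl

theorem sliceBivector_tmul_one (P : Bivector A) (b : Base m) (x : PreFun m A) :
    (sliceBivector m P).1 x (b ⊗ₜ 1) = 0 := by
  have h : hamiltonian (sliceBivector m P) (b ⊗ₜ[ℂ] (1 : A)) = 0 := by
    refine Derivation.ext fun x => ?_
    induction x using TensorProduct.induction_on with
    | zero => simp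
    | add x y hx hy => rw [map_add, hx, hy]; simp
    | tmul c a =>
      have h1 : P.1 1 a = 0 := by rw [bivector_skew, bivector_one, neg_zero]
      have h2 : (sliceBivector m P).1 (b ⊗ₜ[ℂ] (1 : A)) (c ⊗ₜ[ℂ] a) = (b * c) ⊗ₜ[ℂ] P.1 1 a :=
        baseChangeMap_tmul P b c 1 a
      rw [hamiltonian_apply, h2, h1, TensorProduct.tmul_zero]; rfl
  rw [bivector_skew, ← hamiltonian_apply, h]
  simp

@[simp] theorem sliceBivector_tPow (P : Bivector A) (i : ℤ) (x : PreFun m A) :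
    (sliceBivector m P).1 x (tPow m A i) = 0 := sliceBivector_tmul_one P _ x

@[simp] theorem sliceBivector_coord (P : Bivector A) (i : DiskCoord m) (x : PreFun m A) :
    (sliceBivector m P).1 x (coord m A i) = 0 := sliceBivector_tmul_one P _ x

@[simp] theorem sliceBivector_fromSlice (P : Bivector A) (a b : A) :
    (sliceBivector m P).1 (fromSlice m A a) (fromSlice m A b) = fromSlice m A (P.1 a b) := by
  exact (baseChangeMap_tmul P (1 : Base m) 1 a b).trans (by rw [mul_one]; rfl)

/-- The Euler vector field `t ∂_t`. -/
def euler (m : ℕ) (A : Type*) [CommRing A] [Algebra ℂ A] : Derivation ℂ (PreFun m A) (PreFun m A) :=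
  tPow m A 1 • partialT m A

@[simp] theorem euler_tPow (i : ℤ) : euler m A (tPow m A i) = (i : ℂ) • tPow m A i := by
  rw [euler, Derivation.smul_apply, partialT_tPow, smul_eq_mul, mul_smul_comm, ← tPow_add,
    add_sub_cancel]

@[simp] theorem euler_coord (i : DiskCoord m) : euler m A (coord m A i) = 0 := by
  rw [euler, Derivation.smul_apply, partialT_coord, smul_zero]

@[simp] theorem euler_fromSlice (a : A) : euler m A (fromSlice m A a) = 0 := by
  rw [euler, Derivation.smul_apply, partialT_fromSlice, smul_zero]

/-- The coordinate `u`. -/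
abbrev coordU (m : ℕ) (A : Type*) [CommRing A] [Algebra ℂ A] : PreFun m A := coord m A (Sum.inl ())

/-- The coordinate `z_{2i-1}`. -/
abbrev coordP (m : ℕ) (A : Type*) [CommRing A] [Algebra ℂ A] (i : Fin (m - 1)) : PreFun m A :=
  coord m A (Sum.inr (Sum.inl i))

/-- The coordinate `z_{2i}`. -/
abbrev coordQ (m : ℕ) (A : Type*) [CommRing A] [Algebra ℂ A] (i : Fin (m - 1)) : PreFun m A :=
  coord m A (Sum.inr (Sum.inr i))

/-- The vector field `t ∂_t - k ∑ᵢ z_{2i-1} ∂_{z_{2i-1}} + ξ`. -/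
def twistField (m : ℕ) (k : ℤ) (ξ : Derivation ℂ A A) : Derivation ℂ (PreFun m A) (PreFun m A) :=
  euler m A - ∑ i : Fin (m - 1), ((k : ℂ) • coordP m A i) • partialDisk m A (Sum.inr (Sum.inl i)) +
    sliceField m ξ

/-- The bivector `∑ᵢ ∂_{z_{2i-1}} ∧ ∂_{z_{2i}} + π_S`. -/
def diskBivector (m : ℕ) (P : Bivector A) : Bivector (PreFun m A) :=
  ∑ i : Fin (m - 1), wedge (partialDisk m A (Sum.inr (Sum.inl i)))
    (partialDisk m A (Sum.inr (Sum.inr i))) + sliceBivector m P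

theorem wedge_apply {L : Type*} [CommRing L] [Algebra ℂ L] (D D' : Derivation ℂ L L) (a b : L) :
    (wedge D D').1 a b = D a * D' b - D' a * D b := rfl

theorem sum_bivector_apply {ι L : Type*} [CommRing L] [Algebra ℂ L] (s : Finset ι)
    (Q : ι → Bivector L) (a b : L) : (∑ i ∈ s, Q i).1 a b = ∑ i ∈ s, (Q i).1 a b := by
  rw [Submodule.coe_sum, LinearMap.sum_apply, LinearMap.sum_apply]

theorem sum_derivation_apply {ι L : Type*} [CommRing L] [Algebra ℂ L] (s : Finset ι)
    (D : ι → Derivation ℂ L L) (a : L) : (∑ i ∈ s, D i) a = ∑ i ∈ s, D i a := by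
  classical
  induction s using Finset.induction_on with
  | empty => simp
  | insert i s hi ih => rw [Finset.sum_insert hi, Finset.sum_insert hi, Derivation.add_apply, ih]

/-- Returning to the coordinates z, the chain rule turns t∂_t into the Euler field minus k Σ
z_{2i-1} ∂_{z_{2i-1}}, and t^(-k) factors out of every term. In this form the Jacobi identity
follows from `isPoisson_smul_wedge_add`. -/
theorem totalBivector_eq (k : ℤ) (P : Bivector A) (ξ : Derivation ℂ A A) :
    totalBivector m k P ξ =
      tPow m A (-k) • (wedge (partialU m A) (twistField m k ξ) + diskBivector m P) := by
  refine Subtype.ext (LinearMap.ext fun a => LinearMap.ext fun b => ?_)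
  have hk : (k : PreFun m A) = algebraMap ℂ _ (k : ℂ) := (map_intCast _ _).symm
  have h1 : tPow m A (1 - k) = tPow m A (-k) * tPow m A 1 := by rw [← tPow_add]; ring_nf
  have h2 : ∀ x, tPow m A 1 * partialT' m A k x =
      euler m A x - ∑ i : Fin (m - 1), ((k : ℂ) • coordP m A i) *
        partialDisk m A (Sum.inr (Sum.inl i)) x := fun x => by
    simp only [partialT', euler, Derivation.sub_apply, Derivation.smul_apply, sum_derivation_apply,
      smul_eq_mul, mul_sub, Finset.mul_sum]
    congr 1
    refine Finset.sum_congr rfl fun i _ => ?_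
    rw [Algebra.smul_def, ← hk]
    linear_combination (k : PreFun m A) * coordP m A i *
      partialDisk m A (Sum.inr (Sum.inl i)) x * tPow_mul_neg (m := m) (A := A) 1
  simp only [totalBivector, standardBivector, twistField, diskBivector, map_bivector_add,
    SetLike.val_smul, LinearMap.smul_apply, sum_bivector_apply, wedge_apply, partialZ',
    Derivation.add_apply, Derivation.sub_apply, Derivation.smul_apply, sum_derivation_apply,
    smul_eq_mul, h1, ← sliceField.eq_def, ← sliceBivector.eq_def]
  have h3 : ∑ i : Fin (m - 1), (tPow m A (-k) * partialDisk m A (Sum.inr (Sum.inl i)) a *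
      partialDisk m A (Sum.inr (Sum.inr i)) b - partialDisk m A (Sum.inr (Sum.inr i)) a *
      (tPow m A (-k) * partialDisk m A (Sum.inr (Sum.inl i)) b)) = tPow m A (-k) *
      ∑ i : Fin (m - 1), (partialDisk m A (Sum.inr (Sum.inl i)) a *
        partialDisk m A (Sum.inr (Sum.inr i)) b - partialDisk m A (Sum.inr (Sum.inr i)) a *
        partialDisk m A (Sum.inr (Sum.inl i)) b) := by
    rw [Finset.mul_sum]
    exact Finset.sum_congr rfl fun i _ => by ring
  rw [h3]
  linear_combination tPow m A (-k) * partialU m A a * h2 b -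
    tPow m A (-k) * partialU m A b * h2 a

section Values

variable (k : ℤ) (P : Bivector A) (ξ : Derivation ℂ A A)

@[simp] theorem twistField_tPow (i : ℤ) :
    twistField m k ξ (tPow m A i) = (i : ℂ) • tPow m A i := by
  simp [twistField, sum_derivation_apply]

@[simp] theorem twistField_coordU : twistField m k ξ (coordU m A) = 0 := by
  simp [twistField, sum_derivation_apply]

@[simp] theorem twistField_coordP (i : Fin (m - 1)) :
    twistField m k ξ (coordP m A i) = -(k : ℂ) • coordP m A i := by
  simp [twistField, sum_derivation_apply]

@[simp] theorem twistField_coordQ (i : Fin (m - 1)) : twistField m k ξ (coordQ m A i) = 0 := by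
  simp [twistField, sum_derivation_apply]

@[simp] theorem twistField_fromSlice (a : A) :
    twistField m k ξ (fromSlice m A a) = fromSlice m A (ξ a) := by
  simp [twistField, sum_derivation_apply]

@[simp] theorem diskBivector_tPow (i : ℤ) (x : PreFun m A) :
    (diskBivector m P).1 x (tPow m A i) = 0 := by
  simp [diskBivector, wedge_apply]

@[simp] theorem diskBivector_tPow' (i : ℤ) (x : PreFun m A) :
    (diskBivector m P).1 (tPow m A i) x = 0 := by
  rw [bivector_skew, diskBivector_tPow, neg_zero]

@[simp] theorem diskBivector_coordU (x : PreFun m A) :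
    (diskBivector m P).1 x (coordU m A) = 0 := by
  simp [diskBivector, wedge_apply]

@[simp] theorem diskBivector_coordU' (x : PreFun m A) :
    (diskBivector m P).1 (coordU m A) x = 0 := by
  rw [bivector_skew, diskBivector_coordU, neg_zero]

@[simp] theorem diskBivector_fromSlice_coord (a : A) (i : DiskCoord m) :
    (diskBivector m P).1 (fromSlice m A a) (coord m A i) = 0 := by
  simp [diskBivector, wedge_apply]

@[simp] theorem diskBivector_coord_fromSlice (a : A) (i : DiskCoord m) :
    (diskBivector m P).1 (coord m A i) (fromSlice m A a) = 0 := by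
  rw [bivector_skew, diskBivector_fromSlice_coord, neg_zero]

@[simp] theorem diskBivector_fromSlice (a b : A) :
    (diskBivector m P).1 (fromSlice m A a) (fromSlice m A b) = fromSlice m A (P.1 a b) := by
  simp [diskBivector, wedge_apply]

@[simp] theorem diskBivector_coordP_coordQ (i j : Fin (m - 1)) :
    (diskBivector m P).1 (coordP m A i) (coordQ m A j) = if i = j then 1 else 0 := by
  simp [diskBivector, wedge_apply, eq_comm]

@[simp] theorem diskBivector_coordQ_coordP (i j : Fin (m - 1)) :
    (diskBivector m P).1 (coordQ m A i) (coordP m A j) = if j = i then -1 else 0 := by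
  rw [bivector_skew, diskBivector_coordP_coordQ]; split_ifs <;> simp

@[simp] theorem diskBivector_coordP_coordP (i j : Fin (m - 1)) :
    (diskBivector m P).1 (coordP m A i) (coordP m A j) = 0 := by
  simp [diskBivector, wedge_apply]

@[simp] theorem diskBivector_coordQ_coordQ (i j : Fin (m - 1)) :
    (diskBivector m P).1 (coordQ m A i) (coordQ m A j) = 0 := by
  simp [diskBivector, wedge_apply]

theorem coord_cases {p : DiskCoord m → Prop} (hu : p (Sum.inl ()))
    (hp : ∀ i, p (Sum.inr (Sum.inl i))) (hq : ∀ i, p (Sum.inr (Sum.inr i))) : ∀ i, p i := by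
  rintro (⟨⟩ | i | i)
  exacts [hu, hp i, hq i]

/-- Constancy of these brackets makes the Jacobi and scaling checks on disk coordinates collapse. -/
theorem exists_diskBivector_coord (i j : DiskCoord m) :
    ∃ c : ℂ, (diskBivector m P).1 (coord m A i) (coord m A j) = algebraMap ℂ _ c := by
  revert i j
  refine coord_cases (fun j => ⟨0, by simp⟩) (fun i => ?_) fun i => ?_
  · refine coord_cases ⟨0, by simp⟩ (fun j => ⟨0, by simp⟩) fun j => ⟨if i = j then 1 else 0, ?_⟩
    rw [diskBivector_coordP_coordQ, apply_ite (algebraMap ℂ _), map_one, map_zero]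
  · refine coord_cases ⟨0, by simp⟩ (fun j => ⟨if j = i then -1 else 0, ?_⟩) fun j => ⟨0, by simp⟩
    rw [diskBivector_coordQ_coordP, apply_ite (algebraMap ℂ _), map_neg, map_one, map_zero]

variable {k P ξ}

theorem diskBivector_isPoisson (hP : IsPoisson P) : IsPoisson (diskBivector m P) := by
  have hc : ∀ (c : ℂ) (y : PreFun m A), (diskBivector m P).1 (algebraMap ℂ _ c) y = 0 :=
    fun c y => by rw [bivector_skew, bivector_algebraMap, neg_zero]
  refine isPoisson_of_generators adjoin_generators (generators_induction (fun i => ?_) (fun i => ?_)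
    fun a => ?_)
  · simp
  · refine generators_induction (fun j => ?_) (fun j => ?_) fun b => ?_
    · simp
    · refine generators_induction (fun l => ?_) (fun l => ?_) fun d => ?_
      · simp
      · obtain ⟨c1, h1⟩ := exists_diskBivector_coord (A := A) P i j
        obtain ⟨c2, h2⟩ := exists_diskBivector_coord (A := A) P i l
        obtain ⟨c3, h3⟩ := exists_diskBivector_coord (A := A) P j l
        rw [h1, h2, h3, bivector_algebraMap, bivector_algebraMap, hc, add_zero]
      · obtain ⟨c1, h1⟩ := exists_diskBivector_coord (A := A) P i j
        rw [h1, hc]; simp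
    · refine generators_induction (fun l => ?_) (fun l => ?_) fun d => ?_
      · simp
      · obtain ⟨c1, h1⟩ := exists_diskBivector_coord (A := A) P i l
        rw [h1, bivector_algebraMap]; simp
      · simp
  · refine generators_induction (fun j => ?_) (fun j => ?_) fun b => ?_
    · simp
    · refine generators_induction (fun l => ?_) (fun l => ?_) fun d => ?_
      · simp
      · obtain ⟨c1, h1⟩ := exists_diskBivector_coord (A := A) P j l
        rw [h1, bivector_algebraMap]; simp
      · simp
    · refine generators_induction (fun l => ?_) (fun l => ?_) fun d => ?_
      · simp
      · simp
      · simp only [diskBivector_fromSlice, hP.jacobi a b d]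
        exact map_add (sliceHom m A) _ _

theorem diskBivector_isScaling_partialU : IsScaling 0 (diskBivector m P) (partialU m A) := by
  refine isScaling_of_generators adjoin_generators (generators_induction (fun i => ?_) (fun i => ?_)
    fun a => ?_)
  · simp [partialU]
  · refine generators_induction (fun j => ?_) (fun j => ?_) fun b => ?_
    · simp [partialU]
    · obtain ⟨c1, h1⟩ := exists_diskBivector_coord (A := A) P i j
      have h2 : ∀ i y, (diskBivector m P).1 (partialU m A (coord m A i)) y = 0 := fun i y => by
        rw [partialU, partialDisk_coord]
        split_ifs
        · rw [bivector_skew, bivector_one, neg_zero]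
        · simp
      rw [h2, bivector_skew _ _ (partialU m A (coord m A j)), h2, h1, Derivation.map_algebraMap]
      simp
    · rw [diskBivector_coord_fromSlice, partialU, partialDisk_fromSlice, partialDisk_coord,
        bivector_skew _ _ (fromSlice m A b)]
      split_ifs <;> simp [bivector_one]
  · refine generators_induction (fun j => ?_) (fun j => ?_) fun b => ?_
    · simp [partialU]
    · rw [diskBivector_fromSlice_coord, partialU, partialDisk_fromSlice, partialDisk_coord]
      split_ifs <;> simp [bivector_one]
    · simp [partialU]

/-- The weight -k of z_{2i-1} is exactly what makes the standard symplectic part scale by k, in step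
with π_S under ξ. -/
theorem diskBivector_isScaling_twistField (h : IsScaling k P ξ) :
    IsScaling k (diskBivector m P) (twistField m k ξ) := by
  refine isScaling_of_generators adjoin_generators (generators_induction (fun i => ?_)
    (coord_cases ?_ (fun i => ?_) (fun i => ?_)) fun a => ?_)
  · simp
  · simp
  · refine generators_induction (fun j => ?_) (coord_cases ?_ (fun j => ?_) fun j => ?_) fun b => ?_
    · simp
    · simp
    · simp
    · rw [diskBivector_coordP_coordQ, twistField_coordP, twistField_coordQ, map_smul,
        LinearMap.smul_apply, diskBivector_coordP_coordQ]
      split_ifs <;> simp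
    · simp
  · refine generators_induction (fun j => ?_) (coord_cases ?_ (fun j => ?_) fun j => ?_) fun b => ?_
    · simp
    · simp
    · rw [diskBivector_coordQ_coordP, twistField_coordP, twistField_coordQ, map_smul,
        diskBivector_coordQ_coordP]
      split_ifs <;> simp
    · simp
    · simp
  · refine generators_induction (fun j => ?_) (coord_cases ?_ (fun j => ?_) fun j => ?_) fun b => ?_
    · simp
    · simp
    · simp
    · simp
    · simp only [twistField_fromSlice, diskBivector_fromSlice]
      have := congrArg (sliceHom m A) (h a b)
      simpa only [map_sub, map_smul, sliceHom_apply] using this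

theorem totalBivector_isPoisson (hP : IsPoisson P) (hξ : IsScaling k P ξ) :
    IsPoisson (totalBivector m k P ξ) := by
  rw [totalBivector_eq]
  refine isPoisson_smul_wedge_add (diskBivector_isPoisson hP) (diskBivector_isScaling_twistField hξ)
    diskBivector_isScaling_partialU (derivation_comm_of_generators adjoin_generators
      (generators_induction (fun i => ?_) (coord_cases ?_ (fun i => ?_) fun i => ?_) fun a => ?_))
    ?_ ?_ fun x => ?_
  all_goals simp [partialU]

theorem totalBivector_apply (x y : PreFun m A) : (totalBivector m k P ξ).1 x y = tPow m A (-k) *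
    (partialU m A x * twistField m k ξ y - twistField m k ξ x * partialU m A y +
      (diskBivector m P).1 x y) := by
  rw [totalBivector_eq]; rfl

theorem diskBivector_isScaling_euler : IsScaling 0 (diskBivector m P) (euler m A) := by
  refine isScaling_of_generators adjoin_generators (generators_induction (fun i => ?_) (fun i => ?_)
    fun a => ?_)
  · simp
  · refine generators_induction (fun j => ?_) (fun j => ?_) fun b => ?_
    · simp
    · obtain ⟨c1, h1⟩ := exists_diskBivector_coord (A := A) P i j
      rw [h1, Derivation.map_algebraMap, euler_coord, euler_coord]
      simp
    · simp
  · refine generators_induction (fun j => ?_) (fun j => ?_) fun b => ?_ <;> simp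

/-- The only dependence on t is the factor t^(-k): the Euler field commutes with the other fields
and preserves the disk bivector. -/
theorem totalBivector_isScaling_euler :
    IsScaling (-k) (totalBivector m k P ξ) (euler m A) := by
  intro x y
  have h1 : ∀ x, euler m A (partialU m A x) = partialU m A (euler m A x) :=
    derivation_comm_of_generators adjoin_generators
      (generators_induction (fun i => by simp [partialU])
        (fun i => by rw [partialU, partialDisk_coord]; split_ifs <;> simp) fun a => by
          simp [partialU])
  have h2 : ∀ x, euler m A (twistField m k ξ x) = twistField m k ξ (euler m A x) :=
    derivation_comm_of_generators adjoin_generators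
      (generators_induction (fun i => by simp)
        (coord_cases (by simp) (fun i => by simp) fun i => by simp) fun a => by simp)
  have h3 := diskBivector_isScaling_euler (P := P) x y
  rw [Int.cast_zero, zero_smul] at h3
  simp only [totalBivector_apply, Derivation.leibniz, map_add, map_sub, h1, h2, euler_tPow,
    smul_eq_mul, Algebra.smul_def, map_intCast]
  linear_combination tPow m A (-k) * h3

end Values

end Coordinates

/-! ### Explicit substitutions between products -/

section Substitution

variable {m : ℕ} {A A' : Type*} [CommRing A] [Algebra ℂ A] [CommRing A'] [Algebra ℂ A']

theorem generators_cases {p : PreFun m A → Prop} (ht : ∀ i, p (tPow m A i)) (hu : p (coordU m A))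
    (hp : ∀ i, p (coordP m A i)) (hq : ∀ i, p (coordQ m A i)) (ha : ∀ a, p (fromSlice m A a)) :
    ∀ s ∈ generators m A, p s := generators_induction ht (coord_cases hu hp hq) ha

/-- The inclusion of `ℂ[t, t⁻¹]`. -/
def laurentHom (m : ℕ) (A : Type*) [CommRing A] [Algebra ℂ A] : ℂ[T;T⁻¹] →ₐ[ℂ] PreFun m A :=
  (Algebra.TensorProduct.includeLeft : Base m →ₐ[ℂ] PreFun m A).comp
    (Algebra.TensorProduct.includeLeft :
      ℂ[T;T⁻¹] →ₐ[ℂ] ℂ[T;T⁻¹] ⊗[ℂ] MvPolynomial (DiskCoord m) ℂ)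

theorem laurentHom_T (i : ℤ) : laurentHom m A (LaurentPolynomial.T i) = tPow m A i := rfl

theorem laurentScale_T (c : ℂˣ) (i : ℤ) : laurentScale c (LaurentPolynomial.T i) =
    ((c ^ i : ℂˣ) : ℂ) • LaurentPolynomial.T i := by
  rw [laurentScale, LaurentPolynomial.T, AddMonoidAlgebra.lift_single, one_smul]; rfl

/-- The homomorphism of functions on products with prescribed values on a function of `t`, on the
coordinates of the disk and on functions on the slice. -/
def preLift {R : Type*} [CommRing R] [Algebra ℂ R] (τ : ℂ[T;T⁻¹] →ₐ[ℂ] R) (z : DiskCoord m → R)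
    (φ : A →ₐ[ℂ] R) : PreFun m A →ₐ[ℂ] R :=
  Algebra.TensorProduct.productMap
    (Algebra.TensorProduct.productMap τ (MvPolynomial.aeval z) : Base m →ₐ[ℂ] R) φ

section

variable {R : Type*} [CommRing R] [Algebra ℂ R] (τ : ℂ[T;T⁻¹] →ₐ[ℂ] R) (z : DiskCoord m → R)
  (φ : A →ₐ[ℂ] R)

@[simp] theorem preLift_tPow (i : ℤ) :
    preLift τ z φ (tPow m A i) = τ (LaurentPolynomial.T i) := by
  have h : preLift τ z φ (tPow m A i) =
      (τ (LaurentPolynomial.T i) * MvPolynomial.aeval z (1 : MvPolynomial (DiskCoord m) ℂ)) *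
        φ 1 := rfl
  rw [h, map_one, map_one, mul_one, mul_one]

@[simp] theorem preLift_coord (i : DiskCoord m) : preLift τ z φ (coord m A i) = z i := by
  have h : preLift τ z φ (coord m A i) =
      (τ 1 * MvPolynomial.aeval z (MvPolynomial.X i : MvPolynomial (DiskCoord m) ℂ)) * φ 1 := rfl
  rw [h, map_one, map_one, mul_one, one_mul, MvPolynomial.aeval_X]

@[simp] theorem preLift_fromSlice (a : A) : preLift τ z φ (fromSlice m A a) = φ a := by
  have h : preLift τ z φ (fromSlice m A a) =
      (τ 1 * MvPolynomial.aeval z (1 : MvPolynomial (DiskCoord m) ℂ)) * φ a := rfl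
  rw [h, map_one, map_one, mul_one, one_mul]

end

@[simp] theorem preAction_tPow (c : ℂˣ) (i : ℤ) :
    preAction m A c (tPow m A i) = ((c ^ i : ℂˣ) : ℂ) • tPow m A i := by
  rw [tPow, preAction, Algebra.TensorProduct.map_tmul, baseScale_mk, map_one, laurentScale_T]; rfl

@[simp] theorem preAction_coord (c : ℂˣ) (i : DiskCoord m) :
    preAction m A c (coord m A i) = coord m A i := by
  rw [coord, preAction, Algebra.TensorProduct.map_tmul, baseScale_mk, map_one]; rfl

@[simp] theorem preAction_fromSlice (c : ℂˣ) (a : A) :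
    preAction m A c (fromSlice m A a) = fromSlice m A a := by
  rw [fromSlice, preAction, Algebra.TensorProduct.map_tmul, map_one]; rfl

/-- The substitution `t ↦ c t`, `u ↦ c⁻ᵏ u + f`, `z_{2i-1} ↦ c⁻ᵏ z_{2i-1}`, `z_{2i} ↦ z_{2i}`,
together with `φ` on the slice. -/
def substitution (m : ℕ) (k : ℤ) (c : ℂˣ) (f : A) (φ : A' →ₐ[ℂ] A) : PreFun m A' →ₐ[ℂ] PreFun m A :=
  preLift ((laurentHom m A).comp (laurentScale c))
    (Sum.elim (fun _ => ((c ^ (-k) : ℂˣ) : ℂ) • coordU m A + fromSlice m A f)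
      (Sum.elim (fun i => ((c ^ (-k) : ℂˣ) : ℂ) • coordP m A i) fun i => coordQ m A i))
    ((sliceHom m A).comp φ)

section

variable (k : ℤ) (c : ℂˣ) (f : A) (φ : A' →ₐ[ℂ] A)

@[simp] theorem substitution_tPow (i : ℤ) :
    substitution m k c f φ (tPow m A' i) = ((c ^ i : ℂˣ) : ℂ) • tPow m A i := by
  rw [substitution, preLift_tPow, AlgHom.comp_apply, laurentScale_T, map_smul, laurentHom_T]

@[simp] theorem substitution_coordU : substitution m k c f φ (coordU m A') =
    ((c ^ (-k) : ℂˣ) : ℂ) • coordU m A + fromSlice m A f := by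
  rw [substitution, preLift_coord]; rfl

@[simp] theorem substitution_coordP (i : Fin (m - 1)) : substitution m k c f φ (coordP m A' i) =
    ((c ^ (-k) : ℂˣ) : ℂ) • coordP m A i := by
  rw [substitution, preLift_coord]; rfl

@[simp] theorem substitution_coordQ (i : Fin (m - 1)) :
    substitution m k c f φ (coordQ m A' i) = coordQ m A i := by
  rw [substitution, preLift_coord]; rfl

@[simp] theorem substitution_fromSlice (a : A') :
    substitution m k c f φ (fromSlice m A' a) = fromSlice m A (φ a) := by
  rw [substitution, preLift_fromSlice]; rfl

end

@[simp] theorem partialU_tPow (i : ℤ) : partialU m A (tPow m A i) = 0 := by simp [partialU]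
@[simp] theorem partialU_coordU : partialU m A (coordU m A) = 1 := by simp [partialU]
@[simp] theorem partialU_coordP (i : Fin (m - 1)) : partialU m A (coordP m A i) = 0 := by
  simp [partialU]
@[simp] theorem partialU_coordQ (i : Fin (m - 1)) : partialU m A (coordQ m A i) = 0 := by
  simp [partialU]
@[simp] theorem partialU_fromSlice (a : A) : partialU m A (fromSlice m A a) = 0 := by
  simp [partialU]

theorem fromSlice_smul (c : ℂ) (a : A) : fromSlice m A (c • a) = c • fromSlice m A a :=
  map_smul (sliceHom m A) c a

theorem fromSlice_sub (a b : A) : fromSlice m A (a - b) = fromSlice m A a - fromSlice m A b :=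
  map_sub (sliceHom m A) a b

theorem fromSlice_add (a b : A) : fromSlice m A (a + b) = fromSlice m A a + fromSlice m A b :=
  map_add (sliceHom m A) a b

section Values

variable (k : ℤ) (P : Bivector A) (ξ : Derivation ℂ A A)

theorem totalBivector_tPow (x : PreFun m A) (i : ℤ) : (totalBivector m k P ξ).1 x (tPow m A i) =
    (i : ℂ) • (tPow m A (i - k) * partialU m A x) := by
  rw [totalBivector_apply, twistField_tPow, partialU_tPow, diskBivector_tPow, mul_zero, sub_zero,
    add_zero, mul_smul_comm, mul_smul_comm, sub_eq_add_neg, tPow_add]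
  congr 1; ring

theorem totalBivector_coordU (x : PreFun m A) : (totalBivector m k P ξ).1 (coordU m A) x =
    tPow m A (-k) * twistField m k ξ x := by
  rw [totalBivector_apply, partialU_coordU, twistField_coordU, diskBivector_coordU', zero_mul,
    sub_zero, add_zero, one_mul]

theorem totalBivector_coordP_coordP (i j : Fin (m - 1)) :
    (totalBivector m k P ξ).1 (coordP m A i) (coordP m A j) = 0 := by
  simp [totalBivector_apply]

theorem totalBivector_coordQ_coordQ (i j : Fin (m - 1)) :
    (totalBivector m k P ξ).1 (coordQ m A i) (coordQ m A j) = 0 := by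
  simp [totalBivector_apply]

theorem totalBivector_coordP_coordQ (i j : Fin (m - 1)) :
    (totalBivector m k P ξ).1 (coordP m A i) (coordQ m A j) =
      if i = j then tPow m A (-k) else 0 := by
  simp [totalBivector_apply]

theorem totalBivector_coordP_fromSlice (i : Fin (m - 1)) (a : A) :
    (totalBivector m k P ξ).1 (coordP m A i) (fromSlice m A a) = 0 := by
  simp [totalBivector_apply]

theorem totalBivector_coordQ_fromSlice (i : Fin (m - 1)) (a : A) :
    (totalBivector m k P ξ).1 (coordQ m A i) (fromSlice m A a) = 0 := by
  simp [totalBivector_apply]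

theorem totalBivector_fromSlice (a b : A) :
    (totalBivector m k P ξ).1 (fromSlice m A a) (fromSlice m A b) =
      tPow m A (-k) * fromSlice m A (P.1 a b) := by
  simp [totalBivector_apply]

end Values

theorem bivector_map_eq_symm {L L' : Type*} [CommRing L] [Algebra ℂ L] [CommRing L']
    [Algebra ℂ L'] {Q : Bivector L} {Q' : Bivector L'} {σ : L →ₐ[ℂ] L'} {x y : L}
    (h : σ (Q.1 x y) = Q'.1 (σ x) (σ y)) : σ (Q.1 y x) = Q'.1 (σ y) (σ x) := by
  rw [bivector_skew, map_neg, h, ← bivector_skew]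

theorem fromSlice_bivector_coordP {k : ℤ} {P : Bivector A} {ξ : Derivation ℂ A A} (f : A)
    (i : Fin (m - 1)) : (totalBivector m k P ξ).1 (fromSlice m A f) (coordP m A i) = 0 := by
  rw [bivector_skew, totalBivector_coordP_fromSlice, neg_zero]

theorem fromSlice_bivector_coordQ {k : ℤ} {P : Bivector A} {ξ : Derivation ℂ A A} (f : A)
    (i : Fin (m - 1)) : (totalBivector m k P ξ).1 (fromSlice m A f) (coordQ m A i) = 0 := by
  rw [bivector_skew, totalBivector_coordQ_fromSlice, neg_zero]

/-- Scaling t by c multiplies t^(-k) by c^(-k), which is compensated by φ multiplying the slice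
bracket by c^k and by rescaling u and z_{2i-1}. Shifting u by f adds t^(-k){f, -} to the Hamiltonian
field of u on the slice, that is, a Hamiltonian field to ξ. -/
theorem substitution_bivector {k : ℤ} {c : ℂˣ} {f : A} {φ : A' →ₐ[ℂ] A} {P : Bivector A}
    {ξ : Derivation ℂ A A} {P' : Bivector A'} {ξ' : Derivation ℂ A' A'}
    (hP : ∀ a b, φ (P'.1 a b) = ((c ^ k : ℂˣ) : ℂ) • P.1 (φ a) (φ b))
    (hξ : ∀ a, φ (ξ' a) = ξ (φ a) + ((c ^ k : ℂˣ) : ℂ) • P.1 f (φ a)) (x y : PreFun m A') :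
    substitution m k c f φ ((totalBivector m k P' ξ').1 x y) =
      (totalBivector m k P ξ).1 (substitution m k c f φ x) (substitution m k c f φ y) := by
  have hγ : ∀ i j : ℤ, ((c ^ (i + j) : ℂˣ) : ℂ) = ((c ^ i : ℂˣ) : ℂ) * ((c ^ j : ℂˣ) : ℂ) :=
    fun i j => by rw [zpow_add, Units.val_mul]
  have hck : ((c ^ (-k) : ℂˣ) : ℂ) * ((c ^ k : ℂˣ) : ℂ) = 1 := by
    rw [← hγ, neg_add_cancel, zpow_zero, Units.val_one]
  have ht := substitution_tPow (m := m) k c f φ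
  have hu := substitution_coordU (m := m) k c f φ
  have hp := substitution_coordP (m := m) k c f φ
  have hq := substitution_coordQ (m := m) k c f φ
  have ha := substitution_fromSlice (m := m) k c f φ
  generalize substitution m k c f φ = σ at *
  -- The powers of c become an opaque function, used only through `hγ` and `hck`.
  generalize hgγ : (fun i : ℤ => ((c ^ i : ℂˣ) : ℂ)) = γ at *
  have hγ' : ∀ i : ℤ, ((c ^ i : ℂˣ) : ℂ) = γ i := fun i => congrFun hgγ i
  simp only [hγ'] at *
  -- The factor is the one by which u is rescaled; it settles all brackets with powers of t.
  have hδ : ∀ x ∈ generators m A', partialU m A (σ x) = γ (-k) • σ (partialU m A' x) := by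
    refine generators_cases (fun j => ?_) ?_ (fun j => ?_) (fun j => ?_) fun b => ?_
    · rw [ht, Derivation.map_smul, partialU_tPow, partialU_tPow, map_zero, smul_zero, smul_zero]
    · rw [hu, map_add, Derivation.map_smul, partialU_coordU, partialU_coordU, map_one,
        partialU_fromSlice, add_zero]
    · rw [hp, Derivation.map_smul, partialU_coordP, partialU_coordP, map_zero, smul_zero]
    · rw [hq, partialU_coordQ, partialU_coordQ, map_zero, smul_zero]
    · rw [ha, partialU_fromSlice, partialU_fromSlice, map_zero, smul_zero]
  have htt : ∀ i, ∀ s ∈ generators m A', σ ((totalBivector m k P' ξ').1 s (tPow m A' i)) =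
      (totalBivector m k P ξ).1 (σ s) (σ (tPow m A' i)) := by
    intro i s hs
    rw [ht, totalBivector_tPow, map_smul, map_smul, map_mul, ht, totalBivector_tPow, hδ s hs,
      sub_eq_add_neg, hγ]
    simp only [Algebra.smul_def, map_mul]
    ring
  have huu : ∀ s ∈ generators m A', σ ((totalBivector m k P' ξ').1 (coordU m A') s) =
      (totalBivector m k P ξ).1 (σ (coordU m A')) (σ s) := by
    refine generators_cases (fun j => bivector_map_eq_symm ?_) ?_ (fun j => ?_) (fun j => ?_)
      fun b => ?_
    · exact bivector_map_eq_symm (htt j _ (coord_mem_generators _))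
    · rw [(totalBivector m k P' ξ').2.1, (totalBivector m k P ξ).2.1, map_zero]
    · rw [totalBivector_coordU, twistField_coordP, map_mul, ht, map_smul, hp, hu]
      simp only [map_add, map_smul, LinearMap.add_apply, LinearMap.smul_apply,
        fromSlice_bivector_coordP, totalBivector_coordU, twistField_coordP]
      simp only [Algebra.smul_def]
      ring
    · rw [totalBivector_coordU, twistField_coordQ, hq, hu]
      simp only [map_add, map_smul, LinearMap.add_apply, LinearMap.smul_apply,
        fromSlice_bivector_coordQ, totalBivector_coordU, twistField_coordQ]
      simp
    · rw [totalBivector_coordU, twistField_fromSlice, map_mul, ht, ha, ha, hu, hξ]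
      simp only [map_add, map_smul, LinearMap.add_apply, LinearMap.smul_apply,
        totalBivector_fromSlice, totalBivector_coordU, twistField_fromSlice, fromSlice_add,
        fromSlice_smul]
      have h1 := congrArg (algebraMap ℂ (PreFun m A)) hck
      rw [map_mul, map_one] at h1
      simp only [Algebra.smul_def]
      linear_combination tPow m A (-k) * fromSlice m A (P.1 f (φ b)) * h1
  have h : ∀ s ∈ generators m A', ∀ s' ∈ generators m A',
      σ ((totalBivector m k P' ξ').1 s s') =
        (1 : ℂ) • (totalBivector m k P ξ).1 (σ s) (σ s') := by
    simp only [one_smul]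
    have hpq : ∀ i j, σ ((totalBivector m k P' ξ').1 (coordP m A' i) (coordQ m A' j)) =
        (totalBivector m k P ξ).1 (σ (coordP m A' i)) (σ (coordQ m A' j)) := by
      intro i j
      rw [totalBivector_coordP_coordQ, hp, hq, map_smul, LinearMap.smul_apply,
        totalBivector_coordP_coordQ]
      split_ifs
      · rw [ht]
      · rw [map_zero, smul_zero]
    have hpa : ∀ i a, σ ((totalBivector m k P' ξ').1 (coordP m A' i) (fromSlice m A' a)) =
        (totalBivector m k P ξ).1 (σ (coordP m A' i)) (σ (fromSlice m A' a)) := by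
      intro i a
      rw [totalBivector_coordP_fromSlice, hp, ha, map_smul, LinearMap.smul_apply,
        totalBivector_coordP_fromSlice, map_zero, smul_zero]
    have hqa : ∀ i a, σ ((totalBivector m k P' ξ').1 (coordQ m A' i) (fromSlice m A' a)) =
        (totalBivector m k P ξ).1 (σ (coordQ m A' i)) (σ (fromSlice m A' a)) := by
      intro i a
      rw [totalBivector_coordQ_fromSlice, hq, ha, totalBivector_coordQ_fromSlice, map_zero]
    refine generators_cases (fun i s' hs' => bivector_map_eq_symm (htt i s' hs')) huu
      (fun i => ?_) (fun i => ?_) fun a => ?_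
    · refine generators_cases (fun j => htt j _ (coord_mem_generators _))
        (bivector_map_eq_symm (huu _ (coord_mem_generators _))) (fun j => ?_) (hpq i) (hpa i)
      rw [totalBivector_coordP_coordP, hp, hp, map_smul, map_smul, LinearMap.smul_apply,
        totalBivector_coordP_coordP, map_zero, smul_zero, smul_zero]
    · refine generators_cases (fun j => htt j _ (coord_mem_generators _))
        (bivector_map_eq_symm (huu _ (coord_mem_generators _)))
        (fun j => bivector_map_eq_symm (hpq j i)) (fun j => ?_) (hqa i)
      rw [totalBivector_coordQ_coordQ, hq, hq, totalBivector_coordQ_coordQ, map_zero]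
    · refine generators_cases (fun j => htt j _ (fromSlice_mem_generators _))
        (bivector_map_eq_symm (huu _ (fromSlice_mem_generators _)))
        (fun j => bivector_map_eq_symm (hpa j a)) (fun j => bivector_map_eq_symm (hqa j a))
        fun b => ?_
      rw [totalBivector_fromSlice, ha, ha, totalBivector_fromSlice, map_mul, ht, ha, hP,
        fromSlice_smul]
      have h1 := congrArg (algebraMap ℂ (PreFun m A)) hck
      rw [map_mul, map_one] at h1
      simp only [Algebra.smul_def]
      linear_combination tPow m A (-k) * fromSlice m A (P.1 (φ a) (φ b)) * h1
  have := map_bivector_of_generators adjoin_generators h x y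
  rwa [one_smul] at this

end Substitution

theorem continuous_completionMap {L L' : Type*} [CommRing L] [Algebra ℂ L] [CommRing L']
    [Algebra ℂ L'] {I : Ideal L} {I' : Ideal L'} (σ : L →ₐ[ℂ] L') (h : I ≤ I'.comap σ) :
    Continuous (completionMap σ h) := by
  refine continuous_iInf_rng.2 fun n => continuous_induced_rng.2 ?_
  have h1 : (AdicCompletion.evalₐ I' n ∘ completionMap σ h) =
      Ideal.quotientMapₐ (I' ^ n) σ (le_comap_pow_of_le σ h n) ∘ AdicCompletion.evalₐ I n := by
    funext x
    obtain ⟨l, hl⟩ := Approx.exists_approx n x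
    refine (hl.completionMap h).trans ?_
    rw [Function.comp_apply, hl]
    rfl
  rw [h1]
  refine continuous_iInf_dom (i := n) ?_
  exact @Continuous.comp _ _ _ (_) ⊥ (_) _ _ continuous_bot continuous_induced_dom

/-! ### From isomorphisms of slices to isomorphisms of products -/

section Forward

variable {m : ℕ} {A A' : Type*} [CommRing A] [Algebra ℂ A] [CommRing A'] [Algebra ℂ A']

theorem preFun_hom_ext {R : Type*} [CommRing R] [Algebra ℂ R] {σ τ : PreFun m A →ₐ[ℂ] R}
    (h : ∀ s ∈ generators m A, σ s = τ s) : σ = τ :=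
  AlgHom.ext_of_adjoin_eq_top adjoin_generators h

theorem substitution_comp (k : ℤ) {c d : ℂˣ} {f : A} {g : A'} {φ : A' →ₐ[ℂ] A} {ψ : A →ₐ[ℂ] A'}
    (hcd : c * d = 1) (hφ : ∀ a, φ (ψ a) = a) (hf : ((d ^ (-k) : ℂˣ) : ℂ) • f + φ g = 0)
    (x : PreFun m A) : substitution m k c f φ (substitution m k d g ψ x) = x := by
  have hcd' : ∀ i : ℤ, ((d ^ i : ℂˣ) : ℂ) * ((c ^ i : ℂˣ) : ℂ) = 1 := fun i => by
    rw [← Units.val_mul, ← mul_zpow, mul_comm, hcd, one_zpow, Units.val_one]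
  have h : (substitution m k c f φ).comp (substitution m k d g ψ) = AlgHom.id ℂ _ := by
    refine preFun_hom_ext (generators_cases (fun i => ?_) ?_ (fun i => ?_) (fun i => ?_)
      fun a => ?_)
    all_goals simp only [AlgHom.comp_apply, AlgHom.id_apply, substitution_tPow, map_smul, map_add,
      substitution_coordU, substitution_coordP, substitution_coordQ, substitution_fromSlice,
      smul_smul, smul_add, hcd', one_smul, hφ]
    rw [add_assoc, ← fromSlice_smul, ← fromSlice_add, hf, fromSlice_zero, add_zero]
  exact congrArg (fun σ : PreFun m A →ₐ[ℂ] PreFun m A => σ x) h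

theorem preAction_substitution (k : ℤ) (c d : ℂˣ) (f : A) (φ : A' →ₐ[ℂ] A) (x : PreFun m A') :
    preAction m A d (substitution m k c f φ x) = substitution m k c f φ (preAction m A' d x) := by
  have h : (preAction m A d).comp (substitution m k c f φ) =
      (substitution m k c f φ).comp (preAction m A' d) := by
    refine preFun_hom_ext (generators_cases (fun i => ?_) ?_ (fun i => ?_) (fun i => ?_)
      fun a => ?_)
    all_goals simp only [AlgHom.comp_apply, substitution_tPow, map_smul, map_add,
      substitution_coordU, substitution_coordP, substitution_coordQ, substitution_fromSlice,
      preAction_tPow, preAction_coord, preAction_fromSlice]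
    rw [smul_comm]
  exact congrArg (fun σ : PreFun m A' →ₐ[ℂ] PreFun m A => σ x) h

variable [IsLocalRing A] [IsLocalRing A']

theorem coord_mem_lineIdeal (i : DiskCoord m) : coord m A i ∈ lineIdeal m A :=
  Ideal.subset_span (Or.inl ⟨i, rfl⟩)

theorem fromSlice_mem_lineIdeal {a : A} (ha : a ∈ IsLocalRing.maximalIdeal A) :
    fromSlice m A a ∈ lineIdeal m A := Ideal.subset_span (Or.inr ⟨a, ha, rfl⟩)

theorem lineIdeal_le {K : Ideal (PreFun m A)} (hc : ∀ i, coord m A i ∈ K)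
    (ha : ∀ a ∈ IsLocalRing.maximalIdeal A, fromSlice m A a ∈ K) : lineIdeal m A ≤ K := by
  unfold lineIdeal
  rw [Ideal.span_le]
  rintro x (⟨i, rfl⟩ | ⟨a, h, rfl⟩)
  exacts [hc i, ha a h]

theorem lineIdeal_le_comap_substitution (k : ℤ) (c : ℂˣ) {f : A}
    (hf : f ∈ IsLocalRing.maximalIdeal A) {φ : A' →ₐ[ℂ] A}
    (hφ : ∀ a ∈ IsLocalRing.maximalIdeal A', φ a ∈ IsLocalRing.maximalIdeal A) :
    lineIdeal m A' ≤ (lineIdeal m A).comap (substitution m k c f φ) := by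
  refine lineIdeal_le (coord_cases ?_ (fun i => ?_) fun i => ?_) fun a ha => ?_
  all_goals rw [Ideal.mem_comap]
  · rw [substitution_coordU]
    exact add_mem (Submodule.smul_of_tower_mem _ _ (coord_mem_lineIdeal _))
      (fromSlice_mem_lineIdeal hf)
  · rw [substitution_coordP]
    exact Submodule.smul_of_tower_mem _ _ (coord_mem_lineIdeal _)
  · rw [substitution_coordQ]
    exact coord_mem_lineIdeal _
  · rw [substitution_fromSlice]
    exact fromSlice_mem_lineIdeal (hφ a ha)

theorem algEquiv_mem_maximalIdeal (φ : A' ≃ₐ[ℂ] A) {a : A'}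
    (ha : a ∈ IsLocalRing.maximalIdeal A') : φ a ∈ IsLocalRing.maximalIdeal A := by
  rw [IsLocalRing.mem_maximalIdeal] at ha ⊢
  exact fun h => ha (by simpa using h.map φ.symm)

/-- Completion of the substitution. The last clause describes the result on approximations, so that
its effect on the points of the line can be traced later. -/
theorem exists_equiv_of_scaled {k : ℤ} (c : ℂˣ) {f : A} (hf : f ∈ IsLocalRing.maximalIdeal A)
    (φ : A' ≃ₐ[ℂ] A) {P : Bivector A} {ξ : Derivation ℂ A A} {P' : Bivector A'}
    {ξ' : Derivation ℂ A' A'}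
    (hP : ∀ a b, φ (P'.1 a b) = ((c ^ k : ℂˣ) : ℂ) • P.1 (φ a) (φ b))
    (hξ : ∀ a, φ (ξ' a) = ξ (φ a) + ((c ^ k : ℂˣ) : ℂ) • P.1 f (φ a)) :
    ∃ Φ : FormalFun m A' ≃A[ℂ] FormalFun m A,
      (∀ (d : ℂˣ) (x : FormalFun m A'), Φ (action m A' d x) = action m A d (Φ x)) ∧
      (∀ x y : FormalFun m A', Φ (bracket (totalBivector m k P' ξ') x y) =
        bracket (totalBivector m k P ξ) (Φ x) (Φ y)) ∧
      ∀ n x l, Approx n x l → Approx n (Φ x) (substitution m k c f (φ : A' →ₐ[ℂ] A) l) := by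
  -- The shift in the inverse substitution u ↦ c^k u + g, determined by c^k f + φ(g) = 0.
  set g : A' := -(((c ^ k : ℂˣ) : ℂ) • φ.symm f) with hg
  have hck : ((c ^ (-k) : ℂˣ) : ℂ) * ((c ^ k : ℂˣ) : ℂ) = 1 := by
    rw [← Units.val_mul, ← zpow_add, neg_add_cancel, zpow_zero, Units.val_one]
  have hgm : g ∈ IsLocalRing.maximalIdeal A' :=
    neg_mem (Submodule.smul_of_tower_mem _ _ (algEquiv_mem_maximalIdeal φ.symm hf))
  have h1 := lineIdeal_le_comap_substitution (m := m) k c hf (φ := (φ : A' →ₐ[ℂ] A))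
    fun a ha => algEquiv_mem_maximalIdeal φ ha
  have h2 := lineIdeal_le_comap_substitution (m := m) k c⁻¹ hgm (φ := (φ.symm : A →ₐ[ℂ] A'))
    fun a ha => algEquiv_mem_maximalIdeal φ.symm ha
  let σ : PreFun m A' ≃ₐ[ℂ] PreFun m A :=
    AlgEquiv.ofAlgHom (substitution m k c f (φ : A' →ₐ[ℂ] A))
      (substitution m k c⁻¹ g (φ.symm : A →ₐ[ℂ] A'))
      (AlgHom.ext fun x => substitution_comp k (mul_inv_cancel c) (fun a => by simp)
        (by rw [inv_zpow, zpow_neg, inv_inv, hg, map_neg, map_smul]; simp) x)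
      (AlgHom.ext fun x => substitution_comp k (inv_mul_cancel c) (fun a => by simp)
        (by rw [hg, smul_neg, smul_smul, hck, one_smul]; simp) x)
  have h3 : lineIdeal m A' ≤ (lineIdeal m A).comap (σ : PreFun m A' →ₐ[ℂ] PreFun m A) := h1
  have h4 : lineIdeal m A ≤ (lineIdeal m A').comap (σ.symm : PreFun m A →ₐ[ℂ] PreFun m A') := h2
  refine ⟨⟨completionEquiv σ h3 h4, continuous_completionMap _ h3, continuous_completionMap _ h4⟩,
    fun d x => Approx.ext fun n => ?_, fun x y => ?_, fun n x l hl => hl.completionMap h3⟩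
  · obtain ⟨l, hl⟩ := Approx.exists_approx n x
    refine ⟨_, (hl.completionMap (lineIdeal_le_comap m A' d)).completionMap h3, ?_⟩
    have h5 : preAction m A d ((σ : PreFun m A' →ₐ[ℂ] PreFun m A) l) =
        (σ : PreFun m A' →ₐ[ℂ] PreFun m A) (preAction m A' d l) :=
      preAction_substitution k c d f _ l
    have h6 := (hl.completionMap h3).completionMap (lineIdeal_le_comap m A d)
    rw [h5] at h6
    exact h6
  · exact completionMap_completionBivector h3 (substitution_bivector hP hξ) x y

theorem totalIso_of_scaled {k : ℤ} (c : ℂˣ) {f : A} (hf : f ∈ IsLocalRing.maximalIdeal A)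
    (φ : A' ≃ₐ[ℂ] A) {P : Bivector A} {ξ : Derivation ℂ A A} {P' : Bivector A'}
    {ξ' : Derivation ℂ A' A'}
    (hP : ∀ a b, φ (P'.1 a b) = ((c ^ k : ℂˣ) : ℂ) • P.1 (φ a) (φ b))
    (hξ : ∀ a, φ (ξ' a) = ξ (φ a) + ((c ^ k : ℂˣ) : ℂ) • P.1 f (φ a)) :
    TotalIso m k P ξ P' ξ' :=
  let ⟨Φ, h1, h2, _⟩ := exists_equiv_of_scaled c hf φ hP hξ
  ⟨Φ, h1, h2⟩

end Forward

theorem IsFormalGerm.isGerm (A : Type*) [CommRing A] [Algebra ℂ A] [IsFormalGerm A] :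
    IsGerm (IsLocalRing.maximalIdeal A) where
  complete := IsFormalGerm.isAdicComplete
  residue a := by
    obtain ⟨c, hc⟩ := IsFormalGerm.residue_surjective (IsLocalRing.residue A a)
    refine ⟨c, ?_⟩
    rw [← IsLocalRing.residue_eq_zero_iff, map_sub, ← hc]
    exact sub_self _
  ne_top := (IsLocalRing.maximalIdeal.isMaximal A).ne_top

theorem SliceIso.totalIso {m : ℕ} {k : ℤ} {A A' : Type*} [CommRing A] [Algebra ℂ A]
    [IsFormalGerm A] [CommRing A'] [Algebra ℂ A'] [IsLocalRing A'] {P : Bivector A}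
    {ξ : Derivation ℂ A A} {P' : Bivector A'} {ξ' : Derivation ℂ A' A'}
    (h : SliceIso P ξ P' ξ') : TotalIso m k P ξ P' ξ' := by
  obtain ⟨φ, hφ, f, hf⟩ := sliceIso_iff.mp h
  -- Subtracting the value at the closed point does not change the Hamiltonian field, and is needed
  -- for the shifted u to stay in the ideal of the line.
  obtain ⟨c, hc⟩ := (IsFormalGerm.isGerm A).residue (φ f)
  refine totalIso_of_scaled 1 (neg_mem hc) φ (fun a b => by simpa using hφ a b) fun a => ?_
  have h1 : P.1 (algebraMap ℂ A c) (φ a) = 0 := by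
    rw [bivector_skew, bivector_algebraMap, neg_zero]
  rw [hf, map_add, map_neg, map_sub, LinearMap.neg_apply, LinearMap.sub_apply, h1, hφ]
  simp

/-! ### The point t = 1 of the line -/

section Point

variable (m : ℕ) (A : Type*) [CommRing A] [Algebra ℂ A]

/-- Evaluation at `t = 1`. -/
def evalOne (R : Type*) [CommRing R] [Algebra ℂ R] : ℂ[T;T⁻¹] →ₐ[ℂ] R :=
  AddMonoidAlgebra.lift ℂ R ℤ 1

@[simp] theorem evalOne_T (R : Type*) [CommRing R] [Algebra ℂ R] (i : ℤ) :
    evalOne R (LaurentPolynomial.T i) = 1 := by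
  rw [evalOne, LaurentPolynomial.T, AddMonoidAlgebra.lift_single, one_smul]; rfl

/-- Restriction of functions to the slice `t = 1`, `u = z₁ = z₂ = … = 0`. -/
def restrictSlice : PreFun m A →ₐ[ℂ] A := preLift (evalOne A) (fun _ => 0) (AlgHom.id ℂ A)

variable {A}

@[simp] theorem restrictSlice_tPow (i : ℤ) : restrictSlice m A (tPow m A i) = 1 := by
  rw [restrictSlice, preLift_tPow, evalOne_T]

@[simp] theorem restrictSlice_coord (i : DiskCoord m) : restrictSlice m A (coord m A i) = 0 := by
  rw [restrictSlice, preLift_coord]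

@[simp] theorem restrictSlice_fromSlice (a : A) : restrictSlice m A (fromSlice m A a) = a := by
  rw [restrictSlice, preLift_fromSlice]; rfl

variable {m} in
theorem tPow_sub_one_mem {K : Ideal (PreFun m A)} (h : tPow m A 1 - 1 ∈ K) (i : ℤ) :
    tPow m A i - 1 ∈ K := by
  induction i with
  | zero => simp
  | succ i ih =>
    have : tPow m A (i + 1) - 1 = tPow m A i * (tPow m A 1 - 1) + (tPow m A i - 1) := by
      rw [tPow_add]; ring
    rw [this]
    exact add_mem (Ideal.mul_mem_left _ _ h) ih
  | pred i ih =>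
    have h1 : tPow m A (-i) = tPow m A (-i - 1) * tPow m A 1 := by rw [← tPow_add]; ring_nf
    have : tPow m A (-i - 1) - 1 = -tPow m A (-i - 1) * (tPow m A 1 - 1) + (tPow m A (-i) - 1) := by
      rw [h1]; ring
    rw [this]
    exact add_mem (Ideal.mul_mem_left _ _ h) ih

variable [IsFormalGerm A]

theorem bijective_ofId_residueField :
    Function.Bijective (Algebra.ofId ℂ (IsLocalRing.ResidueField A)) :=
  ⟨(algebraMap ℂ _).injective, IsFormalGerm.residue_surjective⟩

variable (A) in
/-- The value of a function at the closed point. -/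
def residueChar : A →ₐ[ℂ] ℂ :=
  ((AlgEquiv.ofBijective (Algebra.ofId ℂ (IsLocalRing.ResidueField A))
    bijective_ofId_residueField).symm : IsLocalRing.ResidueField A →ₐ[ℂ] ℂ).comp
    (IsScalarTower.toAlgHom ℂ A (IsLocalRing.ResidueField A))

theorem residueChar_eq_zero_iff {a : A} :
    residueChar A a = 0 ↔ a ∈ IsLocalRing.maximalIdeal A := by
  rw [← IsLocalRing.residue_eq_zero_iff]
  exact map_eq_zero_iff (AlgEquiv.ofBijective (Algebra.ofId ℂ (IsLocalRing.ResidueField A))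
    bijective_ofId_residueField).symm (AlgEquiv.injective _)

variable (A) in
/-- The value of a function at the closed point of the slice, with `t = 1` and
`u = z₁ = z₂ = … = 0`. -/
def pointChar : PreFun m A →ₐ[ℂ] ℂ := (residueChar A).comp (restrictSlice m A)

variable {m}

theorem pointChar_eq_zero_iff {l : PreFun m A} :
    pointChar m A l = 0 ↔ restrictSlice m A l ∈ IsLocalRing.maximalIdeal A := by
  rw [pointChar, AlgHom.comp_apply, residueChar_eq_zero_iff]

theorem lineIdeal_fg : (lineIdeal m A).FG := by
  have : IsNoetherianRing A := IsFormalGerm.isNoetherianRing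
  have h : lineIdeal m A = Ideal.span (Set.range (coord m A)) ⊔
      (IsLocalRing.maximalIdeal A).map (sliceHom m A) := by
    rw [lineIdeal, Ideal.span_union]; rfl
  rw [h]
  exact (Submodule.fg_span (Set.finite_range _)).sup
    (Ideal.FG.map (IsNoetherian.noetherian (IsLocalRing.maximalIdeal A)) _)

theorem lineIdeal_le_restrictSlice :
    lineIdeal m A ≤ (IsLocalRing.maximalIdeal A).comap (restrictSlice m A) := by
  refine lineIdeal_le (fun i => ?_) fun a ha => ?_
  · rw [Ideal.mem_comap, restrictSlice_coord]; exact zero_mem _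
  · rw [Ideal.mem_comap, restrictSlice_fromSlice]; exact ha

theorem lineIdeal_le_pointChar : lineIdeal m A ≤ (⊥ : Ideal ℂ).comap (pointChar m A) :=
  fun _ h => pointChar_eq_zero_iff.mpr (lineIdeal_le_restrictSlice h)

/-- Modulo t - 1 and the ideal of the line every generator equals its value at the point, so the
quotient map factors through the character. -/
theorem mem_of_pointChar_eq_zero {l : PreFun m A} (h : pointChar m A l = 0) :
    l ∈ Ideal.span {tPow m A 1 - 1} ⊔ lineIdeal m A := by
  set K := Ideal.span {tPow m A 1 - 1} ⊔ lineIdeal m A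
  have h1 : Ideal.Quotient.mkₐ ℂ K =
      (Algebra.ofId ℂ (PreFun m A ⧸ K)).comp (pointChar m A) := by
    refine preFun_hom_ext (generators_induction (fun i => ?_) (fun i => ?_) fun a => ?_)
    · rw [AlgHom.comp_apply, pointChar, AlgHom.comp_apply, restrictSlice_tPow, map_one, map_one,
        ← map_one (Ideal.Quotient.mkₐ ℂ K)]
      exact Ideal.Quotient.eq.mpr (tPow_sub_one_mem
        (Ideal.mem_sup_left (Ideal.mem_span_singleton_self _)) i)
    · rw [AlgHom.comp_apply, pointChar, AlgHom.comp_apply, restrictSlice_coord, map_zero, map_zero]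
      exact Ideal.Quotient.eq_zero_iff_mem.mpr (Ideal.mem_sup_right (coord_mem_lineIdeal i))
    · rw [AlgHom.comp_apply, pointChar, AlgHom.comp_apply, restrictSlice_fromSlice,
        Algebra.ofId_apply, IsScalarTower.algebraMap_apply ℂ (PreFun m A) (PreFun m A ⧸ K)]
      refine Ideal.Quotient.eq.mpr (Ideal.mem_sup_right ?_)
      rw [← AlgHom.commutes (sliceHom m A), ← sliceHom_apply, ← map_sub]
      refine fromSlice_mem_lineIdeal (residueChar_eq_zero_iff.mp ?_)
      rw [map_sub, AlgHom.commutes]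
      exact sub_self _
  have h2 := congrArg (fun σ : PreFun m A →ₐ[ℂ] _ => σ l) h1
  simp only [AlgHom.comp_apply, h, map_zero] at h2
  exact Ideal.Quotient.eq_zero_iff_mem.mp h2

variable (m A) in
/-- The continuous extension of `pointChar`. -/
def formalPointChar : FormalFun m A →ₐ[ℂ] ℂ :=
  completionLift (pointChar m A) lineIdeal_le_pointChar inferInstance

theorem Approx.formalPointChar {n : ℕ} {x : FormalFun m A} {l : PreFun m A}
    (h : Approx (n + 1) x l) : formalPointChar m A x = pointChar m A l := by
  have h1 : Approx 1 x l := h.mono (Nat.le_add_left 1 n)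
  have h2 := completionLift_sub_mem lineIdeal_le_pointChar inferInstance h1
  rw [pow_one, Ideal.mem_bot, sub_eq_zero] at h2
  exact h2

@[simp] theorem formalPointChar_toCompletion (l : PreFun m A) :
    formalPointChar m A (toCompletion _ l) = pointChar m A l :=
  (approx_toCompletion (0 + 1) l).formalPointChar

variable (m A) in
/-- The ideal of the point `t = 1` of the line. -/
def pointIdeal : Ideal (FormalFun m A) := RingHom.ker (formalPointChar m A)

theorem mem_pointIdeal {x : FormalFun m A} : x ∈ pointIdeal m A ↔ formalPointChar m A x = 0 :=
  Iff.rfl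

theorem map_lineIdeal_le_pointIdeal :
    (lineIdeal m A).map (algebraMap _ (FormalFun m A)) ≤ pointIdeal m A :=
  Ideal.map_le_iff_le_comap.mpr fun l hl =>
    (formalPointChar_toCompletion l).trans (lineIdeal_le_pointChar hl)

/-- Generators are t - 1 together with those of the ideal of the line. Finiteness is what the second
completion requires. -/
theorem pointIdeal_fg : (pointIdeal m A).FG := by
  have h : pointIdeal m A = (Ideal.span {tPow m A 1 - 1} ⊔ lineIdeal m A).map
      (algebraMap _ (FormalFun m A)) := by
    refine le_antisymm (fun x hx => ?_) ?_
    · obtain ⟨l, hl⟩ := Approx.exists_approx 1 x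
      have h1 := (Approx.iff_sub_mem lineIdeal_fg).mp hl
      rw [pow_one] at h1
      have h2 : pointChar m A l = 0 := by
        rw [← Approx.formalPointChar (n := 0) hl]; exact hx
      rw [← sub_add_cancel x (algebraMap _ (FormalFun m A) l)]
      exact add_mem (Ideal.map_mono le_sup_right h1)
        (Ideal.mem_map_of_mem _ (mem_of_pointChar_eq_zero h2))
    · rw [Ideal.map_sup]
      refine sup_le ?_ map_lineIdeal_le_pointIdeal
      rw [Ideal.map_span, Set.image_singleton, Ideal.span_singleton_le_iff_mem, mem_pointIdeal]
      refine (formalPointChar_toCompletion (tPow m A 1 - 1)).trans ?_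
      rw [pointChar, AlgHom.comp_apply, map_sub, restrictSlice_tPow, map_one, sub_self, map_zero]
  rw [h]
  exact Ideal.FG.map ((Submodule.fg_span (Set.finite_singleton _)).sup lineIdeal_fg) _

end Point

/-! ### Equivariant isomorphisms commute with the Euler vector field -/

section Weights

variable {m : ℕ} {A : Type*} [CommRing A] [Algebra ℂ A]

/-- On V / K the vector is an eigenvector, and polynomials in T act through the eigenvalue. -/
theorem aeval_sub_mem {V : Type*} [AddCommGroup V] [Module ℂ V] (T : V →ₗ[ℂ] V)
    (K : Submodule ℂ V) (hT : ∀ v ∈ K, T v ∈ K) {μ : ℂ} {v : V} (hv : T v - μ • v ∈ K)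
    (p : Polynomial ℂ) : Polynomial.aeval T p v - p.eval μ • v ∈ K := by
  induction p using Polynomial.induction_on' with
  | add p q hp hq =>
    have := add_mem hp hq
    rw [map_add, LinearMap.add_apply, Polynomial.eval_add, add_smul]
    convert this using 1
    abel
  | monomial n c =>
    rw [Polynomial.aeval_monomial, Polynomial.eval_monomial, mul_smul,
      ← Algebra.smul_def, LinearMap.smul_apply, ← smul_sub]
    refine Submodule.smul_mem _ c ?_
    induction n with
    | zero => simp
    | succ n ih =>
      have h1 := add_mem (hT _ ih) (Submodule.smul_mem _ (μ ^ n) hv)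
      rw [map_sub, map_smul, smul_sub, smul_smul, sub_add_sub_cancel, ← pow_succ] at h1
      rwa [pow_succ', Module.End.mul_apply]

/-- On every function, `t ∂_t` acts as a polynomial in the scaling `t ↦ c t`. -/
theorem exists_finset_aeval_preAction (c : ℂˣ) (l : PreFun m A) : ∃ S : Finset ℤ,
    ∀ p : Polynomial ℂ, (∀ j ∈ S, p.eval (((c ^ j : ℂˣ) : ℂ)) = j) →
      Polynomial.aeval (preAction m A c).toLinearMap p l = euler m A l := by
  set W : Set (PreFun m A) := {l | ∃ i : ℤ, preAction m A c l = ((c ^ i : ℂˣ) : ℂ) • l ∧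
    euler m A l = (i : ℂ) • l} with hW
  let M : Submonoid (PreFun m A) :=
    { carrier := W
      one_mem' := ⟨0, by simp⟩
      mul_mem' := by
        rintro a b ⟨i, hi, hi'⟩ ⟨j, hj, hj'⟩
        refine ⟨i + j, ?_, ?_⟩
        · rw [map_mul, hi, hj, smul_mul_smul_comm, zpow_add, Units.val_mul]
        · rw [Derivation.leibniz, hi', hj', smul_eq_mul, smul_eq_mul, Int.cast_add, add_smul,
            mul_smul_comm, mul_smul_comm, mul_comm b a, add_comm] }
  have h1 : generators m A ⊆ W := by
    refine generators_induction (fun i => ⟨i, by simp⟩) (fun i => ⟨0, by simp⟩) fun a => ⟨0, by simp⟩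
  have h2 : Submodule.span ℂ W = ⊤ := by
    have h3 : Algebra.adjoin ℂ W = ⊤ :=
      eq_top_iff.mpr (adjoin_generators.symm.le.trans (Algebra.adjoin_mono h1))
    have h4 := Algebra.adjoin_eq_span_of_subset (R := ℂ) (s := W) (by
      rw [show Submonoid.closure W = M from Submonoid.closure_eq M]
      exact Submodule.subset_span)
    rw [← h4, h3, Algebra.top_toSubmodule]
  have h5 : l ∈ Submodule.span ℂ W := h2 ▸ Submodule.mem_top
  classical
  induction h5 using Submodule.span_induction with
  | mem l hl =>
    obtain ⟨i, hi, hi'⟩ := hl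
    refine ⟨{i}, fun p hp => ?_⟩
    have h6 := aeval_sub_mem (preAction m A c).toLinearMap ⊥ (by simp) (v := l)
      (by rw [Submodule.mem_bot, sub_eq_zero]; exact hi) p
    rw [Submodule.mem_bot, sub_eq_zero, hp i (Finset.mem_singleton_self i)] at h6
    rw [h6, hi']
  | zero => exact ⟨∅, fun p _ => by simp⟩
  | add a b _ _ ha hb =>
    obtain ⟨S, hS⟩ := ha
    obtain ⟨S', hS'⟩ := hb
    refine ⟨S ∪ S', fun p hp => ?_⟩
    rw [map_add, map_add, hS p fun j hj => hp j (Finset.mem_union_left _ hj),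
      hS' p fun j hj => hp j (Finset.mem_union_right _ hj)]
  | smul r a _ ha =>
    obtain ⟨S, hS⟩ := ha
    exact ⟨S, fun p hp => by rw [map_smul, hS p hp, Derivation.map_smul]⟩

variable [IsLocalRing A]

variable (m A) in
/-- The Euler vector field `t ∂_t` on the formal scheme. -/
def formalEuler : Derivation ℂ (FormalFun m A) (FormalFun m A) :=
  completionDerivation (lineIdeal m A) (euler m A)

theorem Approx.action {n : ℕ} {x : FormalFun m A} {l : PreFun m A} (c : ℂˣ) (h : Approx n x l) :
    Approx n (action m A c x) (preAction m A c l) :=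
  h.completionMap (lineIdeal_le_comap m A c)

theorem action_toCompletion (c : ℂˣ) (l : PreFun m A) :
    action m A c (toCompletion _ l) = toCompletion _ (preAction m A c l) :=
  completionMap_toCompletion _ (lineIdeal_le_comap m A c) l

theorem exists_polynomial_eval (c : ℂˣ) (hc : Function.Injective fun j : ℤ => ((c ^ j : ℂˣ) : ℂ))
    (S : Finset ℤ) : ∃ p : Polynomial ℂ, ∀ j ∈ S, p.eval (((c ^ j : ℂˣ) : ℂ)) = j := by
  classical
  exact ⟨Lagrange.interpolate S (fun j : ℤ => ((c ^ j : ℂˣ) : ℂ)) fun j => (j : ℂ),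
    fun j hj => Lagrange.eval_interpolate_at_node _ hc.injOn hj⟩

/-- Modulo Iⁿ the Euler field is p(T), where T is the action of c and p interpolates c^j ↦ j. An
eigenvector of T with eigenvalue c^i is therefore one of the Euler field with eigenvalue p(c^i) = i.
-/
theorem formalEuler_eq_smul {c : ℂˣ} (hc : Function.Injective fun j : ℤ => ((c ^ j : ℂˣ) : ℂ))
    {y : FormalFun m A} {i : ℤ} (hy : action m A c y = ((c ^ i : ℂˣ) : ℂ) • y) :
    formalEuler m A y = (i : ℂ) • y := by
  classical
  refine Approx.ext fun n => ?_
  obtain ⟨l, hl⟩ := Approx.exists_approx (n + 1) y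
  refine ⟨_, hl.completionDerivation _, (hl.succ.smul _).of_sub_mem ?_⟩
  obtain ⟨S, hS⟩ := exists_finset_aeval_preAction c l
  -- The node i is added because it need not be among the weights of the approximation l.
  obtain ⟨p, hp⟩ := exists_polynomial_eval c hc (insert i S)
  have h1 := aeval_sub_mem (preAction m A c).toLinearMap
    ((lineIdeal m A ^ n).restrictScalars ℂ)
    (fun v hv => pow_le_comap (lineIdeal_le_comap m A c) n hv) (v := l)
    (μ := ((c ^ i : ℂˣ) : ℂ)) (by
      have h2 := hl.succ.action c
      rw [hy] at h2
      exact h2.sub_mem (hl.succ.smul _)) p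
  rw [hS p fun j hj => hp j (Finset.mem_insert_of_mem hj), hp i (Finset.mem_insert_self i S)] at h1
  rw [← neg_sub]
  exact neg_mem h1

end Weights

/-! ### Continuity in terms of approximations -/

section Continuity

variable {L L' : Type*} [CommRing L] [CommRing L'] {I : Ideal L} {I' : Ideal L'}

theorem nhds_zero_induced (n : ℕ) :
    @nhds _ (TopologicalSpace.induced (AdicCompletion.evalₐ I n) ⊥) 0 =
      Filter.principal {x : AdicCompletion I L | Approx n x 0} := by
  let _ : TopologicalSpace (L ⧸ I ^ n) := ⊥
  have : DiscreteTopology (L ⧸ I ^ n) := ⟨rfl⟩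
  rw [nhds_induced, nhds_discrete, Filter.comap_pure, map_zero]
  simp only [Approx, map_zero]
  rfl

theorem exists_approx_zero_imp_mem {U : Set (AdicCompletion I L)} (hU : IsOpen U)
    (h0 : 0 ∈ U) : ∃ n, ∀ x, Approx n x 0 → x ∈ U := by
  have h1 := hU.mem_nhds h0
  rw [nhds_iInf, Filter.mem_iInf_of_directed] at h1
  · obtain ⟨n, hn⟩ := h1
    rw [nhds_zero_induced] at hn
    exact ⟨n, fun x hx => hn hx⟩
  · refine directed_of_isDirected_le fun i j hij => ?_
    rw [nhds_zero_induced, nhds_zero_induced, ge_iff_le, Filter.principal_mono]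
    exact fun x hx => Approx.mono hij hx

theorem exists_approx_zero_of_continuous {Φ : AdicCompletion I L →+* AdicCompletion I' L'}
    (hΦ : Continuous Φ) (N : ℕ) : ∃ n, ∀ x, Approx n x 0 → Approx N (Φ x) 0 := by
  have h : IsOpen {y : AdicCompletion I' L' | Approx N y 0} := by
    let _ : TopologicalSpace (L' ⧸ I' ^ N) := ⊥
    have : DiscreteTopology (L' ⧸ I' ^ N) := ⟨rfl⟩
    have h1 : Continuous (AdicCompletion.evalₐ I' N) :=
      continuous_iInf_dom (i := N) continuous_induced_dom
    have h2 := (isOpen_discrete ({0} : Set (L' ⧸ I' ^ N))).preimage h1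
    convert h2 using 1
    ext y
    simp [Approx]
  exact exists_approx_zero_imp_mem (h.preimage hΦ) 
    (show Approx N (Φ 0) 0 by rw [map_zero]; exact Approx.zero N)

end Continuity

/-! ### Normalizing an isomorphism at the point t = 1 -/

section Normalization

variable {m : ℕ} {A A' : Type*} [CommRing A] [Algebra ℂ A] [CommRing A'] [Algebra ℂ A']

theorem exists_approx_zero_of_equiv [IsLocalRing A] [IsLocalRing A']
    (Φ : FormalFun m A' ≃A[ℂ] FormalFun m A) (N : ℕ) :
    ∃ n, ∀ x, Approx n x 0 → Approx N (Φ x) 0 :=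
  exists_approx_zero_of_continuous
    (Φ := (Φ.toAlgEquiv.toAlgHom.toRingHom : FormalFun m A' →+* FormalFun m A)) Φ.continuous N

variable [IsFormalGerm A] [IsFormalGerm A']

theorem pointChar_substitution (k : ℤ) (c : ℂˣ) (l : PreFun m A) :
    pointChar m A (substitution m k c 0 (AlgHom.id ℂ A) l) = pointChar m A (preAction m A c l) := by
  have h : (pointChar m A).comp (substitution m k c 0 (AlgHom.id ℂ A)) =
      (pointChar m A).comp (preAction m A c) := by
    refine preFun_hom_ext (generators_cases (fun i => ?_) ?_ (fun i => ?_) (fun i => ?_)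
      fun a => ?_)
    all_goals simp [pointChar]
  exact congrArg (fun σ : PreFun m A →ₐ[ℂ] ℂ => σ l) h

/-- By continuity some power of Φ(l) has value 0 at the point, and ℂ has no nilpotents. -/
theorem formalPointChar_map_eq_zero (Φ : FormalFun m A' ≃A[ℂ] FormalFun m A) {l : PreFun m A'}
    (hl : l ∈ lineIdeal m A') : formalPointChar m A (Φ (toCompletion _ l)) = 0 := by
  obtain ⟨n, hn⟩ := exists_approx_zero_of_equiv Φ 1
  have h1 : Approx n (toCompletion (lineIdeal m A') (l ^ n)) 0 :=
    (approx_toCompletion n _).of_sub_mem (by rw [sub_zero]; exact Ideal.pow_mem_pow hl n)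
  have h2 := Approx.formalPointChar (n := 0) (hn _ h1)
  rw [map_pow, map_pow, map_pow, map_zero] at h2
  by_contra h
  exact pow_ne_zero n h h2

/-- A character killing the ideal of the line is determined by its value on t. Continuity extends
the equality from polynomial functions to the completion. -/
theorem formalPointChar_map (Φ : FormalFun m A' ≃A[ℂ] FormalFun m A)
    (h1 : formalPointChar m A (Φ (toCompletion _ (tPow m A' 1))) = 1) (x : FormalFun m A') :
    formalPointChar m A (Φ x) = formalPointChar m A' x := by
  let σ : PreFun m A' →ₐ[ℂ] ℂ := ((formalPointChar m A).comp
    (Φ.toAlgEquiv : FormalFun m A' →ₐ[ℂ] FormalFun m A)).comp (toCompletion _)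
  have h2 : σ = pointChar m A' := by
    have hl : ∀ l ∈ lineIdeal m A', σ l = 0 := fun l hl => formalPointChar_map_eq_zero Φ hl
    refine preFun_hom_ext (generators_induction (fun i => ?_) (fun i => ?_) fun a => ?_)
    · have h3 : tPow m A' 1 - 1 ∈ RingHom.ker σ := by
        rw [RingHom.mem_ker, map_sub, map_one, sub_eq_zero]; exact h1
      have h4 := tPow_sub_one_mem h3 i
      rw [RingHom.mem_ker, map_sub, map_one, sub_eq_zero] at h4
      rw [h4, pointChar, AlgHom.comp_apply, restrictSlice_tPow, map_one]
    · rw [hl _ (coord_mem_lineIdeal i), pointChar, AlgHom.comp_apply, restrictSlice_coord, map_zero]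
    · have h3 : a - algebraMap ℂ A' (residueChar A' a) ∈ IsLocalRing.maximalIdeal A' := by
        rw [← residueChar_eq_zero_iff, map_sub, AlgHom.commutes]
        exact sub_self _
      have h4 := hl _ (fromSlice_mem_lineIdeal h3)
      have h5 : fromSlice m A' (a - algebraMap ℂ A' (residueChar A' a)) = fromSlice m A' a -
          algebraMap ℂ _ (residueChar A' a) := by
        rw [fromSlice_sub, ← sliceHom_apply (algebraMap ℂ A' _), AlgHom.commutes]
      rw [h5, map_sub, sub_eq_zero, AlgHom.commutes] at h4
      rw [h4, pointChar, AlgHom.comp_apply, restrictSlice_fromSlice]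
      rfl
  obtain ⟨n, hn⟩ := exists_approx_zero_of_equiv Φ 1
  obtain ⟨l, hl⟩ := Approx.exists_approx (n + 1) x
  have h3 : Approx n (x - toCompletion _ l) 0 := by
    simpa using hl.succ.sub (approx_toCompletion n l)
  have h4 := Approx.formalPointChar (n := 0) (hn _ h3)
  rw [map_sub, map_sub, map_zero, sub_eq_zero] at h4
  rw [h4, hl.formalPointChar, ← h2]
  rfl

/-- Here c is the value of Φ(t) at the point t = 1. Composing with the substitution t ↦ c⁻¹ t makes
this value 1; the substitution is Poisson only if π_S is multiplied by c^k. -/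
theorem TotalIso.exists_normalized {k : ℤ} {P : Bivector A} {ξ : Derivation ℂ A A} {P' : Bivector A'}
    {ξ' : Derivation ℂ A' A'} (h : TotalIso m k P ξ P' ξ') :
    ∃ (c : ℂˣ) (Φ : FormalFun m A' ≃A[ℂ] FormalFun m A),
      (∀ (d : ℂˣ) (x : FormalFun m A'), Φ (action m A' d x) = action m A d (Φ x)) ∧
      (∀ x y : FormalFun m A', Φ (bracket (totalBivector m k P' ξ') x y) =
        bracket (totalBivector m k (algebraMap ℂ A ((c ^ k : ℂˣ) : ℂ) • P) ξ) (Φ x) (Φ y)) ∧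
      ∀ x, formalPointChar m A (Φ x) = formalPointChar m A' x := by
  obtain ⟨Φ, hact, hbr⟩ := h
  set t' : FormalFun m A' := toCompletion _ (tPow m A' 1) with ht'
  have hunit : IsUnit (formalPointChar m A (Φ t')) := by
    refine ((IsUnit.of_mul_eq_one (toCompletion _ (tPow m A' (-1))) ?_).map Φ).map _
    rw [ht', ← map_mul, tPow_mul_neg, map_one]
  obtain ⟨c, hc⟩ := hunit
  obtain ⟨Θ, hΘact, hΘbr, hΘ⟩ := exists_equiv_of_scaled (m := m) (k := k) c⁻¹
    (zero_mem (IsLocalRing.maximalIdeal A)) (AlgEquiv.refl (R := ℂ) (A₁ := A))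
    (P := algebraMap ℂ A ((c ^ k : ℂˣ) : ℂ) • P) (ξ := ξ) (P' := P) (ξ' := ξ) (fun a b => by
      rw [SetLike.val_smul, LinearMap.smul_apply, LinearMap.smul_apply, algebraMap_smul, smul_smul,
        ← Units.val_mul, ← mul_zpow, inv_mul_cancel, one_zpow, Units.val_one, one_smul]
      rfl) fun a => by simp
  have hchar : ∀ x, formalPointChar m A (Θ x) = formalPointChar m A (action m A c⁻¹ x) := fun x => by
    obtain ⟨l, hl⟩ := Approx.exists_approx 1 x
    rw [Approx.formalPointChar (n := 0) (hΘ _ _ _ hl),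
      Approx.formalPointChar (n := 0) (hl.action c⁻¹)]
    exact pointChar_substitution k c⁻¹ l
  refine ⟨c, Φ.trans Θ, fun d x => ?_, fun x y => ?_, formalPointChar_map _ ?_⟩
  · simp only [ContinuousAlgEquiv.trans_apply, hact, hΘact]
  · simp only [ContinuousAlgEquiv.trans_apply, hbr, hΘbr]
  · rw [ContinuousAlgEquiv.trans_apply, hchar, ← hact, action_toCompletion, preAction_tPow, map_smul,
      map_smul, map_smul, ← ht', ← hc, zpow_one, smul_eq_mul, ← Units.val_mul, inv_mul_cancel,
      Units.val_one]

end Normalization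

/-! ### Passage to the formal neighbourhood of the point -/

section Localization

variable {m : ℕ} {A A' : Type*} [CommRing A] [Algebra ℂ A] [CommRing A'] [Algebra ℂ A']

theorem injective_two_zpow :
    Function.Injective fun j : ℤ => (((Units.mk0 (2 : ℂ) two_ne_zero) ^ j : ℂˣ) : ℂ) := by
  intro i j h
  simp only [Units.val_zpow_eq_zpow_val, Units.val_mk0] at h
  have h1 : (2 : ℝ) ^ i = 2 ^ j := Complex.ofReal_injective (by push_cast; exact h)
  exact zpow_right_injective₀ two_pos (by norm_num) h1

/-- Generators are weight vectors, and equivariance sends them to weight vectors of the same weight,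
on which the Euler field is known. Both sides satisfy the Leibniz rule along Φ, and continuity does
the rest. -/
theorem formalEuler_map [IsLocalRing A] [IsLocalRing A'] (Φ : FormalFun m A' ≃A[ℂ] FormalFun m A)
    (hact : ∀ (d : ℂˣ) (x : FormalFun m A'), Φ (action m A' d x) = action m A d (Φ x))
    (x : FormalFun m A') : Φ (formalEuler m A' x) = formalEuler m A (Φ x) := by
  have h1 : ∀ l : PreFun m A', Φ (formalEuler m A' (toCompletion _ l)) =
      formalEuler m A (Φ (toCompletion _ l)) := by
    intro l
    have hl : l ∈ Algebra.adjoin ℂ (generators m A') := by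
      rw [adjoin_generators]; exact Algebra.mem_top
    have hw : ∀ (i : ℤ) (s : PreFun m A'),
        preAction m A' (Units.mk0 (2 : ℂ) two_ne_zero) s =
          (((Units.mk0 (2 : ℂ) two_ne_zero) ^ i : ℂˣ) : ℂ) • s → euler m A' s = (i : ℂ) • s →
        Φ (formalEuler m A' (toCompletion _ s)) = formalEuler m A (Φ (toCompletion _ s)) := by
      intro i s h1 h2
      rw [formalEuler, completionDerivation_toCompletion, h2, map_smul, map_smul]
      refine (formalEuler_eq_smul injective_two_zpow ?_).symm
      rw [← hact, action_toCompletion, h1, map_smul, map_smul]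
    induction hl using Algebra.adjoin_induction with
    | mem s hs =>
      revert s
      exact generators_induction (fun i => hw i _ (by simp) (by simp))
        (fun i => hw 0 _ (by simp) (by simp)) fun a => hw 0 _ (by simp) (by simp)
    | algebraMap c =>
      rw [AlgHom.commutes, AlgEquivClass.commutes, Derivation.map_algebraMap, Derivation.map_algebraMap,
        map_zero]
    | add a b _ _ ha hb => simp only [map_add, ha, hb]
    | mul a b _ _ ha hb =>
      simp only [map_mul, Derivation.leibniz, smul_eq_mul, map_add, ha, hb]
  rw [← sub_eq_zero]
  refine Approx.ext fun N => ⟨0, ?_, Approx.zero N⟩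
  obtain ⟨n₁, hn₁⟩ := exists_approx_zero_of_equiv Φ N
  obtain ⟨n₂, hn₂⟩ := exists_approx_zero_of_equiv Φ (N + 1)
  rw [← map_zero (euler m A')] at hn₁
  -- A derivation loses one order of precision. One side differentiates before applying Φ, hence n₁
  -- + 1; the other differentiates afterwards, so n₂ was chosen for precision N + 1.
  obtain ⟨l, hl⟩ := Approx.exists_approx (n₁ + 1 + n₂) x
  have h2 : Approx (n₁ + 1 + n₂) (x - toCompletion _ l) 0 := by
    simpa using hl.sub (approx_toCompletion _ l)
  have h3 := hn₁ _ ((h2.mono (Nat.le_add_right _ _)).completionDerivation (euler m A'))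
  have h4 := (hn₂ _ (h2.mono (Nat.le_add_left _ _))).completionDerivation (euler m A)
  have h5 := h3.sub h4
  rw [map_zero, sub_zero] at h5
  have h6 : Φ (formalEuler m A' x) - formalEuler m A (Φ x) =
      Φ (formalEuler m A' (x - toCompletion _ l)) - formalEuler m A (Φ (x - toCompletion _ l)) := by
    simp only [map_sub, h1]; ring
  rw [h6]
  exact h5

variable [IsFormalGerm A] [IsFormalGerm A']

variable (m A) in
/-- Functions on the formal neighborhood of the point `t = 1` of the line. -/
def PointFun : Type _ := AdicCompletion (pointIdeal m A) (FormalFun m A)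

instance pointFunCommRing : CommRing (PointFun m A) :=
  inferInstanceAs (CommRing (AdicCompletion (pointIdeal m A) (FormalFun m A)))

instance pointFunAlgebra : Algebra ℂ (PointFun m A) :=
  inferInstanceAs (Algebra ℂ (AdicCompletion (pointIdeal m A) (FormalFun m A)))

/-- The bracket on functions on the formal neighborhood of a point. -/
def pointBivector (m : ℕ) (k : ℤ) (P : Bivector A) (ξ : Derivation ℂ A A) :
    Bivector (PointFun m A) :=
  completionBivector (pointIdeal m A) (completionBivector (lineIdeal m A) (totalBivector m k P ξ))

variable (m A) in
/-- The vector field `- t ∂_t` on the formal neighborhood of a point. -/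
def pointEuler : Derivation ℂ (PointFun m A) (PointFun m A) :=
  -completionDerivation (pointIdeal m A) (formalEuler m A)

/-- An isomorphism that fixes the point induces one of the completions there. It matches the Euler
fields exactly, so the Hamiltonian correction is 0. -/
theorem sliceIso_of_equiv {k : ℤ} {P : Bivector A} {ξ : Derivation ℂ A A} {P' : Bivector A'}
    {ξ' : Derivation ℂ A' A'} (Φ : FormalFun m A' ≃A[ℂ] FormalFun m A)
    (hact : ∀ (d : ℂˣ) (x : FormalFun m A'), Φ (action m A' d x) = action m A d (Φ x))
    (hbr : ∀ x y : FormalFun m A', Φ (bracket (totalBivector m k P' ξ') x y) =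
        bracket (totalBivector m k P ξ) (Φ x) (Φ y))
    (hχ : ∀ x, formalPointChar m A (Φ x) = formalPointChar m A' x) :
    SliceIso (pointBivector m k P ξ) (pointEuler m A) (pointBivector m k P' ξ')
      (pointEuler m A') := by
  have h1 : pointIdeal m A' ≤ (pointIdeal m A).comap
      (Φ.toAlgEquiv : FormalFun m A' →ₐ[ℂ] FormalFun m A) := fun x hx => (hχ x).trans hx
  have h2 : pointIdeal m A ≤ (pointIdeal m A').comap
      (Φ.toAlgEquiv.symm : FormalFun m A →ₐ[ℂ] FormalFun m A') := fun x hx => by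
    change formalPointChar m A' (Φ.toAlgEquiv.symm x) = 0
    have h : Φ (Φ.toAlgEquiv.symm x) = x := Φ.toAlgEquiv.apply_symm_apply x
    rw [← hχ, h]
    exact hx
  refine sliceIso_iff.mpr ⟨completionEquiv Φ.toAlgEquiv h1 h2,
    completionMap_completionBivector h1 hbr, 0, fun x => ?_⟩
  rw [map_zero, LinearMap.zero_apply, add_zero]
  exact (congrArg Neg.neg
    (completionMap_completionDerivation h1 (formalEuler_map Φ hact) x).symm).trans
      (map_neg (completionEquiv Φ.toAlgEquiv h1 h2) _).symm

end Localization

/-! ### Darboux coordinates near the point -/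

section LocalCoordinates

variable {n : ℕ} {k : ℤ} {A : Type*} [CommRing A] [Algebra ℂ A] {P : Bivector A}
  {ξ : Derivation ℂ A A} {B : Type*} [CommRing B] [Algebra ℂ B] {I : Ideal B} {Q : Bivector B}
  {D : Derivation ℂ B B}

/-- Near the point `t = 1`, the functions `t - 1`, suitably rescaled, `u`, `z'_{2i-1}`, `z_{2i}`
form a system of Darboux coordinates. -/
theorem hasSlice_of_hom (hI : IsGerm I) (hQ : IsPoisson Q) (T : PreFun (n + 1) A →ₐ[ℂ] B)
    (ε : B →ₐ[ℂ] A)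
    (hQT : ∀ a b, Q.1 (T a) (T b) = T ((totalBivector (n + 1) k P ξ).1 a b))
    (hDT : ∀ a, D (T a) = -T (euler (n + 1) A a)) (ht : T (tPow (n + 1) A 1) - 1 ∈ I)
    (hc : ∀ i, T (coord (n + 1) A i) ∈ I) (hε : ∀ l, ε (T l) = restrictSlice (n + 1) A l)
    (happrox : ∀ b N, ∃ l, b - T l ∈ I ^ N ∧
      T (fromSlice (n + 1) A (ε b - restrictSlice (n + 1) A l)) ∈ I ^ N) :
    HasSlice (n + 1) Q D I P ξ := by
  have := hI.complete
  set t : ℤ → B := fun i => T (tPow (n + 1) A i) with ht_def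
  have htt : ∀ i j, t (i + j) = t i * t j := fun i j => by
    simp only [ht_def, tPow_add, map_mul]
  have ht0 : t 0 = 1 := by simp only [ht_def, tPow_zero, map_one]
  have htinv : ∀ i, t i * t (-i) = 1 := fun i => by rw [← htt, add_neg_cancel, ht0]
  set u : B := T (coordU (n + 1) A) with hu_def
  set p : Fin n → B := fun i => T (coordP (n + 1) A i) with hp_def
  set q : Fin n → B := fun i => T (coordQ (n + 1) A i) with hq_def
  set ι : A →ₐ[ℂ] B := T.comp (sliceHom (n + 1) A) with hι_def
  have hι : ∀ a, ι a = T (fromSlice (n + 1) A a) := fun a => rfl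
  -- brackets of generators
  have but : ∀ i, Q.1 u (t i) = (i : ℂ) • t (i - k) := fun i => by
    rw [hu_def, ht_def, hQT, totalBivector_tPow, partialU_coordU, mul_one, map_smul]
  have btt : ∀ i j, Q.1 (t i) (t j) = 0 := fun i j => by
    rw [ht_def, hQT, totalBivector_tPow, partialU_tPow, mul_zero, smul_zero, map_zero]
  have bpt : ∀ i j, Q.1 (p i) (t j) = 0 := fun i j => by
    rw [hp_def, ht_def, hQT, totalBivector_tPow, partialU_coordP, mul_zero, smul_zero, map_zero]
  have bqt : ∀ i j, Q.1 (q i) (t j) = 0 := fun i j => by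
    rw [hq_def, ht_def, hQT, totalBivector_tPow, partialU_coordQ, mul_zero, smul_zero, map_zero]
  have bat : ∀ a j, Q.1 (ι a) (t j) = 0 := fun a j => by
    rw [hι, ht_def, hQT, totalBivector_tPow, partialU_fromSlice, mul_zero, smul_zero, map_zero]
  have bup : ∀ i, Q.1 u (p i) = -(k : ℂ) • (t (-k) * p i) := fun i => by
    rw [hu_def, hp_def, hQT, totalBivector_coordU, twistField_coordP, map_mul, map_smul,
      mul_smul_comm]
  have buq : ∀ i, Q.1 u (q i) = 0 := fun i => by
    rw [hu_def, hq_def, hQT, totalBivector_coordU, twistField_coordQ, mul_zero, map_zero]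
  have bua : ∀ a, Q.1 u (ι a) = t (-k) * ι (ξ a) := fun a => by
    rw [hu_def, hι, hι, hQT, totalBivector_coordU, twistField_fromSlice, map_mul]
  have bpp : ∀ i j, Q.1 (p i) (p j) = 0 := fun i j => by
    rw [hp_def, hQT, totalBivector_coordP_coordP, map_zero]
  have bqq : ∀ i j, Q.1 (q i) (q j) = 0 := fun i j => by
    rw [hq_def, hQT, totalBivector_coordQ_coordQ, map_zero]
  have bpq : ∀ i j, Q.1 (p i) (q j) = if i = j then t (-k) else 0 := fun i j => by
    rw [hp_def, hq_def, hQT, totalBivector_coordP_coordQ, apply_ite T, map_zero]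
  have bqa : ∀ i a, Q.1 (q i) (ι a) = 0 := fun i a => by
    rw [hq_def, hι, hQT, totalBivector_coordQ_fromSlice, map_zero]
  have baa : ∀ a b, Q.1 (ι a) (ι b) = t (-k) * ι (P.1 a b) := fun a b => by
    rw [hι, hι, hι, hQT, totalBivector_fromSlice, map_mul]
  -- rescaled coordinates
  set p' : Fin n → B := fun i => t k * p i with hp'_def
  have btp' : ∀ i j, Q.1 (p' i) (t j) = 0 := fun i j => by
    rw [hp'_def, bivector_leibniz_left, btt, bpt]; ring
  have bup' : ∀ i, Q.1 u (p' i) = 0 := fun i => by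
    rw [hp'_def, bivector_leibniz_right, but, bup, sub_self, ht0]
    simp only [Algebra.smul_def, map_neg]
    linear_combination -algebraMap ℂ B k * p i * htinv k
  have bpp' : ∀ i j, Q.1 (p' i) (p' j) = 0 := fun i j => by
    simp only [hp'_def]
    rw [bivector_leibniz_left, bivector_leibniz_right, bivector_leibniz_right, btt, bpt, bpp,
      bivector_skew Q (t k), bpt]
    ring
  have bpq' : ∀ i j, Q.1 (p' i) (q j) = if i = j then 1 else 0 := fun i j => by
    simp only [hp'_def]
    rw [bivector_leibniz_left, bivector_skew Q (t k), bqt, bpq]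
    split_ifs
    · linear_combination htinv k
    · ring
  -- the function conjugate to `u`
  have htu : ∀ i, IsUnit (t i) := fun i => IsUnit.of_mul_eq_one _ (htinv i)
  have hv1 : hamiltonian Q u (t 1 - 1) = t (1 - k) := by
    rw [map_sub, Derivation.map_one_eq_zero, hamiltonian_apply, but, Int.cast_one, one_smul,
      sub_zero]
  -- Since {u, t - 1} = t^(1-k) is a unit, t - 1 can be multiplied by a function α so that the
  -- bracket with u becomes 1. Modulo I the equation shows that α is a unit, so the hypersurface t =
  -- 1 is unchanged.
  obtain ⟨α, hα⟩ := derivation_surjective (hamiltonian Q u) ht (by rw [hv1]; exact htu _) 1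
  have hα' : t (1 - k) * α + (t 1 - 1) * Q.1 u α = 1 := by
    rw [Derivation.leibniz, hv1, hamiltonian_apply, smul_eq_mul, smul_eq_mul] at hα
    linear_combination hα
  set x₀ : B := (t 1 - 1) * α with hx₀
  have hαu : IsUnit α := by
    refine hI.isUnit_of_mul_sub_one_mem (b := t (1 - k)) ?_
    have : t (1 - k) * α - 1 = -(t 1 - 1) * Q.1 u α := by linear_combination hα'
    rw [this]
    exact Ideal.mul_mem_right _ _ (neg_mem ht)
  have bux : Q.1 u x₀ = 1 := hα
  have btx : ∀ y, (∀ i, Q.1 y (t i) = 0) → Q.1 y x₀ = (t 1 - 1) * Q.1 y α := fun y hy => by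
    rw [hx₀, bivector_leibniz_right, map_sub, hy, bivector_one]; ring
  -- The bracket {y, x₀} = (t - 1){y, α} vanishes on t = 1 and, by Jacobi, is constant along {u, -};
  -- hence it is zero. No explicit formula for α is needed.
  have hcomm : ∀ y, (∀ i, Q.1 y (t i) = 0) → Q.1 u y = 0 → Q.1 y x₀ = 0 := by
    intro y hy hy'
    have h1 := hQ.jacobi u y x₀
    rw [hy', bux, bivector_one, bivector_skew Q 0, map_zero, neg_zero, add_zero, btx y hy] at h1
    rw [btx y hy]
    exact derivation_injective (hamiltonian Q u) ht (by rw [hv1]; exact htu _) h1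
  set x : Fin (n + 1) → B := Fin.cons x₀ q with hx
  set y : Fin (n + 1) → B := Fin.cons u p' with hy
  have hxs : ∀ i, x i ∈ Ideal.span (Set.range x) := fun i => Ideal.subset_span ⟨i, rfl⟩
  have hys : ∀ i, y i ∈ Ideal.span (Set.range y) := fun i => Ideal.subset_span ⟨i, rfl⟩
  have ht1 : t 1 - 1 ∈ Ideal.span (Set.range x) := by
    obtain ⟨β, hβ⟩ := hαu.exists_right_inv
    have : t 1 - 1 = β * x 0 := by
      rw [hx, Fin.cons_zero, hx₀]; linear_combination -(t 1 - 1) * hβ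
    rw [this]
    exact Ideal.mul_mem_left _ _ (hxs 0)
  have hti : ∀ i, t i - 1 ∈ Ideal.span (Set.range x) := fun i => by
    have h1 : tPow (n + 1) A 1 - 1 ∈ (Ideal.span (Set.range x)).comap T := by
      rw [Ideal.mem_comap, map_sub, map_one]; exact ht1
    have h2 := tPow_sub_one_mem h1 i
    rwa [Ideal.mem_comap, map_sub, map_one] at h2
  have hεt : ∀ i, ε (t i) = 1 := fun i => by rw [ht_def, hε, restrictSlice_tPow]
  have Dt : ∀ i, D (t i) = -((i : ℂ) • t i) := fun i => by rw [ht_def, hDT, euler_tPow, map_smul]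
  -- On functions of the slice {t^k u, -} is exactly ξ, since t^k cancels the t^(-k) of the
  -- bivector, while D is zero there.
  refine ⟨x, y, ι, ε, t k * u, ?_⟩
  constructor
  · refine Fin.cases (Ideal.mul_mem_right _ _ ht) fun i => hc _
  · refine Fin.cases (hc _) fun i => Ideal.mul_mem_left _ _ (hc _)
  · refine Fin.cases (Fin.cases (Q.2.1 _) fun j => ?_) fun i => Fin.cases ?_ fun j => bqq i j
    · rw [hx, Fin.cons_zero, Fin.cons_succ, bivector_skew, hcomm _ (bqt j) (buq j), neg_zero]
    · exact hcomm _ (bqt i) (buq i)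
  · refine Fin.cases (Fin.cases (Q.2.1 _) fun j => bup' j) fun i => Fin.cases ?_ fun j => bpp' i j
    rw [hy, Fin.cons_zero, Fin.cons_succ, bivector_skew, bup', neg_zero]
  · refine Fin.cases (Fin.cases ?_ fun j => ?_) fun i => Fin.cases ?_ fun j => ?_
    · rw [if_pos rfl]; exact bux
    · rw [if_neg (Fin.succ_ne_zero j).symm]; exact buq j
    · rw [if_neg (Fin.succ_ne_zero i)]; exact hcomm _ (btp' i) (bup' i)
    · rw [hx, hy, Fin.cons_succ, Fin.cons_succ, bpq']
      simp only [Fin.succ_inj]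
  · intro a
    rw [hι, hε, restrictSlice_fromSlice]
  · refine Fin.cases ?_ fun i => ?_
    · rw [hx, Fin.cons_zero, hx₀, map_mul, map_sub, hεt, map_one, sub_self, zero_mul]
    · rw [hx, Fin.cons_succ, hq_def, hε, restrictSlice_coord]
  · refine Fin.cases ?_ fun i => ?_
    · rw [hy, Fin.cons_zero, hu_def, hε, restrictSlice_coord]
    · simp only [hy, Fin.cons_succ, hp'_def, map_mul, hp_def, hε, restrictSlice_coord, mul_zero]
  · intro a
    refine Fin.cases ?_ fun i => ?_
    · rw [hx, Fin.cons_zero, btx _ (bat a)]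
      exact Ideal.mul_mem_right _ _ ht1
    · have : Q.1 (ι a) (x i.succ) = 0 := by rw [hx, Fin.cons_succ, bivector_skew, bqa, neg_zero]
      rw [this]; exact zero_mem _
  · intro a b
    have : Q.1 (ι a) (ι b) - ι (P.1 a b) = (t (-k) - 1) * ι (P.1 a b) := by rw [baa]; ring
    rw [this]
    exact Ideal.mul_mem_right _ _ (hti _)
  · refine Fin.cases ?_ fun i => ?_
    -- The terms not divisible by t - 1 are -tα from D and t^k from the bracket; by `hα'` the latter
    -- is tα modulo t - 1, so they cancel.
    · have h1 : D (x 0) + Q.1 (t k * u) (x 0) = (t 1 - 1) *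
          (D α + t k * Q.1 u α + u * Q.1 (t k) α) := by
        rw [hx, Fin.cons_zero, bivector_leibniz_left, bux, btx _ (btt k), hx₀, Derivation.leibniz,
          map_sub, Dt, Derivation.map_one_eq_zero, Int.cast_one, one_smul, smul_eq_mul, smul_eq_mul]
        have h2 : t k * t (1 - k) = t 1 := by rw [← htt]; ring_nf
        linear_combination -t k * hα' + α * h2
      rw [h1]
      exact Ideal.mul_mem_right _ _ ht1
    · have h1 : D (x i.succ) + Q.1 (t k * u) (x i.succ) = 0 := by
        rw [hx, Fin.cons_succ, bivector_leibniz_left, buq, bivector_skew Q (t k), bqt, hq_def, hDT,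
          euler_coord]
        simp
      rw [h1]; exact zero_mem _
  · intro a
    have h1 : D (ι a) + Q.1 (t k * u) (ι a) - ι (ξ a) = 0 := by
      rw [bivector_leibniz_left, bua, bivector_skew Q (t k), bat, hι, hDT, euler_fromSlice, map_zero]
      linear_combination ι (ξ a) * htinv k
    rw [h1]; exact zero_mem _
  · intro b N
    set K := Ideal.span (Set.range x) ⊔ Ideal.span (Set.range y) with hK
    -- Modulo all the coordinates a polynomial function equals its restriction to the slice, as is
    -- checked on generators.
    have h1 : (Ideal.Quotient.mkₐ ℂ K).comp T =
        ((Ideal.Quotient.mkₐ ℂ K).comp ι).comp (restrictSlice (n + 1) A) := by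
      refine preFun_hom_ext (generators_cases (fun i => ?_) ?_ (fun i => ?_) (fun i => ?_)
        fun a => ?_)
      all_goals simp only [AlgHom.comp_apply, restrictSlice_tPow, restrictSlice_coord,
        restrictSlice_fromSlice, map_zero, map_one]
      · rw [← map_one (Ideal.Quotient.mkₐ ℂ K)]
        exact Ideal.Quotient.eq.mpr (Ideal.mem_sup_left (hti i))
      · exact Ideal.Quotient.eq_zero_iff_mem.mpr (Ideal.mem_sup_right (hys 0))
      · refine Ideal.Quotient.eq_zero_iff_mem.mpr (Ideal.mem_sup_right ?_)
        have : T (coordP (n + 1) A i) = t (-k) * y (Fin.succ (n := n) i) := by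
          rw [hy, Fin.cons_succ]
          linear_combination -T (coordP (n + 1) A i) * htinv k
        rw [this]
        exact Ideal.mul_mem_left _ _ (hys _)
      · exact Ideal.Quotient.eq_zero_iff_mem.mpr (Ideal.mem_sup_left (hxs (Fin.succ (n := n) i)))
      · rfl
    obtain ⟨l, hl, hl'⟩ := happrox b N
    have h2 : T l - ι (restrictSlice (n + 1) A l) ∈ K :=
      Ideal.Quotient.eq.mp (congrArg (fun σ : PreFun (n + 1) A →ₐ[ℂ] B ⧸ K => σ l) h1)
    have h3 : b - ι (ε b) = (T l - ι (restrictSlice (n + 1) A l)) +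
        (b - T l - ι (ε b - restrictSlice (n + 1) A l)) := by
      rw [map_sub]; ring
    rw [h3]
    exact add_mem (Ideal.mem_sup_left h2) (Ideal.mem_sup_right (sub_mem hl hl'))

end LocalCoordinates

/-! ### Sign changes and constant multiples of the bivector -/

section Scaling

variable {k : ℤ} {A : Type*} [CommRing A] [Algebra ℂ A] {P : Bivector A} {ξ : Derivation ℂ A A}

theorem IsScaling.neg (h : IsScaling (-k) P ξ) : IsScaling k P (-ξ) := fun a b => by
  have h1 := h a b
  rw [Int.cast_neg, neg_smul] at h1
  simp only [Derivation.neg_apply, map_neg, LinearMap.neg_apply]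
  linear_combination -h1

theorem smul_bivector_apply (r : ℂ) (P : Bivector A) (a b : A) :
    (algebraMap ℂ A r • P).1 a b = r • P.1 a b := algebraMap_smul A r _

theorem IsPoisson.smul_complex {P : Bivector A} (hP : IsPoisson P) (r : ℂ) :
    IsPoisson (algebraMap ℂ A r • P) := fun a b c => by
  have := congrArg (fun x => r • r • x) (hP a b c)
  simpa only [smul_bivector_apply, map_smul, smul_add, smul_zero] using this

theorem IsScaling.smul_complex (hξ : IsScaling k P ξ) (r : ℂ) :
    IsScaling k (algebraMap ℂ A r • P) ξ := fun a b => by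
  have := congrArg (fun x => r • x) (hξ a b)
  simp only [smul_bivector_apply, Derivation.map_smul]
  rw [smul_comm _ r, ← this, smul_sub, smul_sub]

end Scaling

/-! ### Recovering the slice from the neighbourhood of the point -/

section PointSlice

variable {m : ℕ} {k : ℤ} {A : Type*} [CommRing A] [Algebra ℂ A] [IsFormalGerm A] {P : Bivector A}
  {ξ : Derivation ℂ A A}

variable (m A) in
/-- The maximal ideal of the formal neighborhood of a point. -/
def pointMaximalIdeal : Ideal (PointFun m A) :=
  (pointIdeal m A).map (algebraMap (FormalFun m A)
    (AdicCompletion (pointIdeal m A) (FormalFun m A)))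

theorem pointMaximalIdeal_isGerm : IsGerm (pointMaximalIdeal m A) :=
  isGerm_completion (χ := formalPointChar m A) pointIdeal_fg fun _ => Iff.rfl

theorem pointBivector_isPoisson (hP : IsPoisson P) (hξ : IsScaling k P ξ) :
    IsPoisson (pointBivector m k P ξ) :=
  completionBivector_isPoisson (completionBivector_isPoisson (totalBivector_isPoisson hP hξ))

theorem pointEuler_isScaling : IsScaling k (pointBivector m k P ξ) (pointEuler m A) :=
  IsScaling.neg (completionDerivation_isScaling
    (completionDerivation_isScaling totalBivector_isScaling_euler))

variable (m A) in
/-- Restriction of functions to the formal neighborhood of a point. -/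
def toPoint : PreFun m A →ₐ[ℂ] PointFun m A :=
  (toCompletion (pointIdeal m A)).comp (toCompletion (lineIdeal m A))

variable (m A) in
/-- Restriction of functions to the slice. -/
def formalRestrictSlice : FormalFun m A →ₐ[ℂ] A :=
  completionLift (restrictSlice m A) lineIdeal_le_restrictSlice IsFormalGerm.isAdicComplete

theorem pointIdeal_le_formalRestrictSlice :
    pointIdeal m A ≤ (IsLocalRing.maximalIdeal A).comap (formalRestrictSlice m A) := by
  intro x hx
  obtain ⟨l, hl⟩ := Approx.exists_approx 1 x
  have h1 := completionLift_sub_mem lineIdeal_le_restrictSlice IsFormalGerm.isAdicComplete hl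
  rw [pow_one] at h1
  have h2 : pointChar m A l = 0 := by
    rw [← Approx.formalPointChar (n := 0) hl]; exact hx
  rw [Ideal.mem_comap, ← sub_add_cancel (formalRestrictSlice m A x) (restrictSlice m A l)]
  exact add_mem h1 (pointChar_eq_zero_iff.mp h2)

variable (m A) in
/-- Restriction of functions on the formal neighborhood of a point to the slice. -/
def pointRestrictSlice : PointFun m A →ₐ[ℂ] A :=
  completionLift (formalRestrictSlice m A) pointIdeal_le_formalRestrictSlice
    IsFormalGerm.isAdicComplete

theorem pointRestrictSlice_toPoint (l : PreFun m A) :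
    pointRestrictSlice m A (toPoint m A l) = restrictSlice m A l :=
  (completionLift_toCompletion _ _ _).trans (completionLift_toCompletion _ _ _)

theorem toPoint_mem {l : PreFun m A} (h : pointChar m A l = 0) :
    toPoint m A l ∈ pointMaximalIdeal m A :=
  Ideal.mem_map_of_mem _ ((formalPointChar_toCompletion l).trans h)

theorem toPoint_fromSlice_mem {a : A} {N : ℕ} (ha : a ∈ IsLocalRing.maximalIdeal A ^ N) :
    toPoint m A (fromSlice m A a) ∈ pointMaximalIdeal m A ^ N := by
  have h : IsLocalRing.maximalIdeal A ≤
      (pointMaximalIdeal m A).comap ((toPoint m A).comp (sliceHom m A)) := fun a ha => by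
    refine toPoint_mem (pointChar_eq_zero_iff.mpr ?_)
    exact (restrictSlice_fromSlice m a).symm ▸ ha
  exact le_comap_pow_of_le _ h N ha

theorem exists_sub_toPoint_mem (b : PointFun m A) (N : ℕ) :
    ∃ l, b - toPoint m A l ∈ pointMaximalIdeal m A ^ N ∧
      pointRestrictSlice m A b - restrictSlice m A l ∈ IsLocalRing.maximalIdeal A ^ N := by
  obtain ⟨x, hx⟩ := Approx.exists_approx N (b : AdicCompletion (pointIdeal m A) (FormalFun m A))
  obtain ⟨l, hl⟩ := Approx.exists_approx N x
  let τ : FormalFun m A →ₐ[ℂ] PointFun m A := toCompletion (pointIdeal m A)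
  have hτ : pointIdeal m A ≤ (pointMaximalIdeal m A).comap τ := fun x hx => Ideal.mem_map_of_mem _ hx
  have h1 : b - τ x ∈ pointMaximalIdeal m A ^ N := (Approx.iff_sub_mem pointIdeal_fg).mp hx
  have h2 : x - toCompletion (lineIdeal m A) l ∈ pointIdeal m A ^ N :=
    Ideal.pow_right_mono map_lineIdeal_le_pointIdeal N ((Approx.iff_sub_mem lineIdeal_fg).mp hl)
  have h3 : τ (x - toCompletion (lineIdeal m A) l) ∈ pointMaximalIdeal m A ^ N :=
    le_comap_pow_of_le τ hτ N h2
  have h4 : pointRestrictSlice m A b - formalRestrictSlice m A x ∈ IsLocalRing.maximalIdeal A ^ N :=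
    completionLift_sub_mem pointIdeal_le_formalRestrictSlice IsFormalGerm.isAdicComplete hx
  have h5 : formalRestrictSlice m A x - restrictSlice m A l ∈ IsLocalRing.maximalIdeal A ^ N :=
    completionLift_sub_mem lineIdeal_le_restrictSlice IsFormalGerm.isAdicComplete hl
  rw [map_sub] at h3
  refine ⟨l, ?_, ?_⟩
  · have := add_mem h1 h3
    rwa [sub_add_sub_cancel] at this
  · have := add_mem h4 h5
    rwa [sub_add_sub_cancel] at this

theorem pointBivector_toPoint (a b : PreFun m A) :
    (pointBivector m k P ξ).1 (toPoint m A a) (toPoint m A b) =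
      toPoint m A ((totalBivector m k P ξ).1 a b) := (completionBivector_toCompletion _ _ _).trans
    (congrArg (toCompletion (pointIdeal m A)) (completionBivector_toCompletion _ a b))

theorem pointEuler_toPoint (a : PreFun m A) :
    pointEuler m A (toPoint m A a) = -toPoint m A (euler m A a) :=
  congrArg Neg.neg ((completionDerivation_toCompletion _ _).trans
    (congrArg (toCompletion (pointIdeal m A)) (completionDerivation_toCompletion _ a)))

theorem hasSlice_point (hm : 1 ≤ m) (hP : IsPoisson P) (hξ : IsScaling k P ξ) :
    HasSlice m (pointBivector m k P ξ) (pointEuler m A) (pointMaximalIdeal m A) P ξ := by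
  obtain ⟨n, rfl⟩ := Nat.exists_eq_add_of_le' hm
  refine hasSlice_of_hom pointMaximalIdeal_isGerm (pointBivector_isPoisson hP hξ) (toPoint _ A)
    (pointRestrictSlice _ A) pointBivector_toPoint pointEuler_toPoint ?_ (fun i => ?_)
    pointRestrictSlice_toPoint fun b N => ?_
  · have := toPoint_mem (m := n + 1) (A := A) (l := tPow (n + 1) A 1 - 1) (by
      rw [map_sub, map_one, pointChar, AlgHom.comp_apply, restrictSlice_tPow, map_one, sub_self])
    rwa [map_sub, map_one] at this
  · exact toPoint_mem (by rw [pointChar, AlgHom.comp_apply, restrictSlice_coord, map_zero])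
  · obtain ⟨l, hl, hl'⟩ := exists_sub_toPoint_mem b N
    exact ⟨l, hl, toPoint_fromSlice_mem hl'⟩

/-- After normalization both slices are slices of the same germ, and cancellation applies. This
holds for arbitrary ξ; tangency to the leaf serves only to remove c^k afterwards. -/
theorem TotalIso.exists_sliceIso {A' : Type*} [CommRing A'] [Algebra ℂ A'] [IsFormalGerm A']
    {P' : Bivector A'} {ξ' : Derivation ℂ A' A'} (hm : 1 ≤ m) (hP : IsPoisson P)
    (hP' : IsPoisson P') (hξ : IsScaling k P ξ) (hξ' : IsScaling k P' ξ')
    (h : TotalIso m k P ξ P' ξ') :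
    ∃ c : ℂˣ, SliceIso (algebraMap ℂ A ((c ^ k : ℂˣ) : ℂ) • P) ξ P' ξ' := by
  obtain ⟨c, Φ, h1, h2, h3⟩ := h.exists_normalized
  have hP₁ := hP.smul_complex ((c ^ k : ℂˣ) : ℂ)
  have hξ₁ := hξ.smul_complex ((c ^ k : ℂˣ) : ℂ)
  exact ⟨c, HasSlice.sliceIso pointMaximalIdeal_isGerm (pointBivector_isPoisson hP₁ hξ₁)
    pointEuler_isScaling (hasSlice_point hm hP₁ hξ₁) ((hasSlice_point hm hP' hξ').of_sliceIso
      pointMaximalIdeal_isGerm pointMaximalIdeal_isGerm (sliceIso_of_equiv Φ h1 h2 h3))⟩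

end PointSlice

/-! ### Exponentials of vector fields vanishing at the closed point -/

/-- V is the direct sum of the generalized eigenspaces; E is the function w of the semisimple part
of T, so no convergence question arises. -/
theorem exists_linearMap_maxGenEigenspace {V : Type*} [AddCommGroup V] [Module ℂ V]
    [FiniteDimensional ℂ V] (T : Module.End ℂ V) (w : ℂ → ℂ) :
    ∃ E : V →ₗ[ℂ] V, ∀ μ, ∀ v ∈ T.maxGenEigenspace μ, E v = w μ • v := by
  classical
  have hint := DirectSum.isInternal_submodule_of_iSupIndep_of_iSup_eq_top
    T.independent_maxGenEigenspace T.iSup_maxGenEigenspace_eq_top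
  let e := LinearEquiv.ofBijective (DirectSum.coeLinearMap T.maxGenEigenspace) hint
  refine ⟨(DirectSum.toModule ℂ ℂ V fun μ => w μ • (T.maxGenEigenspace μ).subtype).comp
    e.symm.toLinearMap, fun μ v hv => ?_⟩
  have h : e.symm v = DirectSum.lof ℂ ℂ (fun μ => T.maxGenEigenspace μ) μ ⟨v, hv⟩ := by
    rw [LinearEquiv.symm_apply_eq]
    exact (DirectSum.coeLinearMap_lof T.maxGenEigenspace μ ⟨v, hv⟩).symm
  rw [LinearMap.comp_apply, LinearEquiv.coe_coe, h, DirectSum.toModule_lof]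
  rfl

section Weights

variable {A : Type*} [CommRing A] [Algebra ℂ A] {I : Ideal A} {ξ : Derivation ℂ A A}

theorem derivation_mem_pow (hξ : ∀ a ∈ I, ξ a ∈ I) (n : ℕ) {a : A} (ha : a ∈ I ^ n) :
    ξ a ∈ I ^ n := by
  induction n generalizing a with
  | zero => simp
  | succ n ih =>
    rw [pow_succ] at ha
    refine Submodule.mul_induction_on ha (fun a ha b hb => ?_) fun a b ha hb => ?_
    · rw [Derivation.leibniz, smul_eq_mul, smul_eq_mul, pow_succ]
      refine add_mem (Ideal.mul_mem_mul ha (hξ b hb)) ?_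
      rw [mul_comm b]
      exact Ideal.mul_mem_mul (ih ha) hb
    · rw [map_add]; exact add_mem ha hb

/-- The operator `ξ - μ`. -/
def shiftField (ξ : Derivation ℂ A A) (μ : ℂ) : Module.End ℂ A := (ξ : A →ₗ[ℂ] A) - μ • 1

theorem shiftField_apply (μ : ℂ) (a : A) : shiftField ξ μ a = ξ a - μ • a := rfl

theorem shiftField_pow_mem (hξ : ∀ a ∈ I, ξ a ∈ I) (μ : ℂ) {n : ℕ} (j : ℕ) {a : A}
    (ha : a ∈ I ^ n) : (shiftField ξ μ ^ j) a ∈ I ^ n := by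
  induction j generalizing a with
  | zero => exact ha
  | succ j ih =>
    rw [pow_succ, Module.End.mul_apply, shiftField_apply]
    exact ih (sub_mem (derivation_mem_pow hξ n ha) (Submodule.smul_of_tower_mem _ _ ha))

/-- By the Leibniz rule ξ - (μ + ν + κ) applied to β(a, b) is the sum of β((ξ - μ)a, b) and β(a, (ξ
- ν)b), so weights add up to the shift κ. Two orders p and n appear because β may lower the order of
vanishing. -/
theorem shiftField_pow_bilin_mem (hξ : ∀ a ∈ I, ξ a ∈ I) {β : A →ₗ[ℂ] A →ₗ[ℂ] A} {κ : ℂ}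
    (hβ : ∀ a b, ξ (β a b) = β (ξ a) b + β a (ξ b) + κ • β a b) {n p : ℕ}
    (hl : ∀ a ∈ I ^ p, ∀ b, β a b ∈ I ^ n) (hr : ∀ a, ∀ b ∈ I ^ p, β a b ∈ I ^ n) {μ ν : ℂ}
    {i j : ℕ} {a b : A} (ha : (shiftField ξ μ ^ i) a ∈ I ^ p)
    (hb : (shiftField ξ ν ^ j) b ∈ I ^ p) :
    (shiftField ξ (μ + ν + κ) ^ (i + j)) (β a b) ∈ I ^ n := by
  induction i generalizing a b j with
  | zero => exact shiftField_pow_mem hξ _ _ (hl a ha b)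
  | succ i ih =>
    induction j generalizing a b with
    | zero => exact shiftField_pow_mem hξ _ _ (hr a b hb)
    | succ j ihj =>
      have h : shiftField ξ (μ + ν + κ) (β a b) =
          β (shiftField ξ μ a) b + β a (shiftField ξ ν b) := by
        simp only [shiftField_apply, hβ, map_sub, LinearMap.sub_apply, map_smul,
          LinearMap.smul_apply, add_smul]
        abel
      have h1 : i + 1 + (j + 1) = (i + (j + 1)) + 1 := by ring
      rw [h1, pow_succ, Module.End.mul_apply, h, map_add]
      refine add_mem (ih (by rwa [pow_succ, Module.End.mul_apply] at ha) hb) ?_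
      have h2 := ihj (a := a) (b := shiftField ξ ν b) ha
        (by rwa [pow_succ, Module.End.mul_apply] at hb)
      rwa [show i + 1 + j = i + (j + 1) by ring] at h2

/-- The endomorphism of `A / Iⁿ` induced by a vector field. -/
def quotientField (hξ : ∀ a ∈ I, ξ a ∈ I) (n : ℕ) :
    Module.End ℂ (A ⧸ (I ^ n).restrictScalars ℂ) :=
  Submodule.mapQ _ _ (ξ : A →ₗ[ℂ] A) fun _ ha => derivation_mem_pow hξ n ha

theorem quotientField_sub_pow_mkQ (hξ : ∀ a ∈ I, ξ a ∈ I) (n : ℕ) (μ : ℂ) (j : ℕ) (a : A) :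
    ((quotientField hξ n - μ • 1) ^ j) (((I ^ n).restrictScalars ℂ).mkQ a) =
      ((I ^ n).restrictScalars ℂ).mkQ ((shiftField ξ μ ^ j) a) := by
  induction j generalizing a with
  | zero => rfl
  | succ j ih =>
    rw [pow_succ, pow_succ, Module.End.mul_apply, Module.End.mul_apply, ← ih]
    rfl

/-- Functions which are generalized eigenvectors of `ξ` modulo `Iⁿ`. -/
def weightSpace (hξ : ∀ a ∈ I, ξ a ∈ I) (n : ℕ) (μ : ℂ) : Submodule ℂ A :=
  ((quotientField hξ n).maxGenEigenspace μ).comap ((I ^ n).restrictScalars ℂ).mkQ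

theorem mem_weightSpace {hξ : ∀ a ∈ I, ξ a ∈ I} {n : ℕ} {μ : ℂ} {a : A} :
    a ∈ weightSpace hξ n μ ↔ ∃ j, (shiftField ξ μ ^ j) a ∈ I ^ n := by
  rw [weightSpace, Submodule.mem_comap, Module.End.mem_maxGenEigenspace]
  refine exists_congr fun j => ?_
  rw [quotientField_sub_pow_mkQ, Submodule.mkQ_apply, Submodule.Quotient.mk_eq_zero]
  rfl

theorem weightSpace_succ_le {hξ : ∀ a ∈ I, ξ a ∈ I} {n : ℕ} {μ : ℂ} :
    weightSpace hξ (n + 1) μ ≤ weightSpace hξ n μ := fun a ha => by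
  obtain ⟨j, hj⟩ := mem_weightSpace.mp ha
  exact mem_weightSpace.mpr ⟨j, Ideal.pow_le_pow_right n.le_succ hj⟩

theorem field_mem_weightSpace {hξ : ∀ a ∈ I, ξ a ∈ I} {n : ℕ} {μ : ℂ} {a : A}
    (ha : a ∈ weightSpace hξ n μ) : ξ a ∈ weightSpace hξ n μ := by
  obtain ⟨j, hj⟩ := mem_weightSpace.mp ha
  have h1 : shiftField ξ μ a ∈ weightSpace hξ n μ := mem_weightSpace.mpr ⟨j, by
    rw [← Module.End.mul_apply, ← pow_succ, pow_succ', Module.End.mul_apply]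
    have := shiftField_pow_mem hξ μ 1 hj
    rwa [pow_one] at this⟩
  have h2 := add_mem h1 (Submodule.smul_mem _ μ ha)
  rwa [shiftField_apply, sub_add_cancel] at h2

theorem iSup_weightSpace (hξ : ∀ a ∈ I, ξ a ∈ I) (n : ℕ)
    [FiniteDimensional ℂ (A ⧸ (I ^ n).restrictScalars ℂ)] : ⨆ μ, weightSpace hξ n μ = ⊤ := by
  rw [eq_top_iff]
  intro a _
  have h1 : ((⨆ μ, weightSpace hξ n μ).map ((I ^ n).restrictScalars ℂ).mkQ) = ⊤ := by
    rw [Submodule.map_iSup, ← (quotientField hξ n).iSup_maxGenEigenspace_eq_top]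
    exact iSup_congr fun μ => Submodule.map_comap_eq_of_surjective (Submodule.mkQ_surjective _) _
  obtain ⟨b, hb, hab⟩ : ((I ^ n).restrictScalars ℂ).mkQ a ∈
      (⨆ μ, weightSpace hξ n μ).map ((I ^ n).restrictScalars ℂ).mkQ := h1 ▸ Submodule.mem_top
  have h2 : a - b ∈ I ^ n := (Submodule.Quotient.eq _).mp hab.symm
  rw [← sub_add_cancel a b]
  refine add_mem (Submodule.mem_iSup_of_mem 0 (mem_weightSpace.mpr ⟨0, h2⟩)) hb

/-- For a finite-codimensional ideal of definition preserved by `ξ`, a function of the eigenvalues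
of `ξ` defines a continuous endomorphism. -/
theorem exists_weightScaling (hI : IsAdicComplete I A) (hξ : ∀ a ∈ I, ξ a ∈ I)
    (hfin : ∀ n, FiniteDimensional ℂ (A ⧸ (I ^ n).restrictScalars ℂ)) (w : ℂ → ℂ) :
    ∃ ψ : A →ₗ[ℂ] A, ∀ n μ, ∀ a ∈ weightSpace hξ n μ, ψ a - w μ • a ∈ I ^ n := by
  choose E hE using fun n => exists_linearMap_maxGenEigenspace (quotientField hξ n) w
  have h1 : ∀ n a, ∃ b, ((I ^ n).restrictScalars ℂ).mkQ b = E n (((I ^ n).restrictScalars ℂ).mkQ a) :=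
    fun n a => Submodule.mkQ_surjective _ _
  -- The operators on successive quotients are compatible, because generalized eigenvectors modulo
  -- I^(n+1) remain so modulo Iⁿ with the same eigenvalue.
  have h2 : ∀ n a b, ((I ^ (n + 1)).restrictScalars ℂ).mkQ b =
      E (n + 1) (((I ^ (n + 1)).restrictScalars ℂ).mkQ a) →
      ((I ^ n).restrictScalars ℂ).mkQ b = E n (((I ^ n).restrictScalars ℂ).mkQ a) := by
    intro n a b h
    let F : A ⧸ (I ^ (n + 1)).restrictScalars ℂ →ₗ[ℂ] A ⧸ (I ^ n).restrictScalars ℂ :=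
      Submodule.mapQ _ _ LinearMap.id fun a ha => Ideal.pow_le_pow_right n.le_succ ha
    have hF : ∀ a, F (((I ^ (n + 1)).restrictScalars ℂ).mkQ a) =
        ((I ^ n).restrictScalars ℂ).mkQ a := fun a => rfl
    rw [← hF, h]
    have ha : a ∈ ⨆ μ, weightSpace hξ (n + 1) μ := by
      rw [iSup_weightSpace]; exact Submodule.mem_top
    clear h
    induction ha using Submodule.iSup_induction' with
    | mem μ a ha =>
      rw [hE _ μ _ ha, hE _ μ _ (weightSpace_succ_le ha), map_smul, hF]
    | zero => simp only [map_zero]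
    | add a b _ _ ha hb => simp only [map_add, ha, hb]
  have h3 : ∀ a, ∃ b, ∀ n, ((I ^ n).restrictScalars ℂ).mkQ b =
      E n (((I ^ n).restrictScalars ℂ).mkQ a) := by
    intro a
    choose f hf using fun n => h1 n a
    obtain ⟨b, hb⟩ := exists_adic_limit (I := I) (f := f) fun n =>
      (Submodule.Quotient.eq _).mp ((h2 n a _ (hf (n + 1))).trans (hf n).symm)
    exact ⟨b, fun n => ((Submodule.Quotient.eq _).mpr (hb n)).trans (hf n)⟩
  choose ψ hψ using h3
  have h4 : ∀ a b, (∀ n, ((I ^ n).restrictScalars ℂ).mkQ a =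
      ((I ^ n).restrictScalars ℂ).mkQ b) → a = b := fun a b h =>
    sub_eq_zero.mp (eq_zero_of_forall_mem_pow (I := I) fun n => (Submodule.Quotient.eq _).mp (h n))
  refine ⟨⟨⟨ψ, fun a b => h4 _ _ fun n => ?_⟩, fun c a => h4 _ _ fun n => ?_⟩,
    fun n μ a ha => (Submodule.Quotient.eq _).mp ?_⟩
  · simp only [map_add, hψ]
  · simp only [map_smul, hψ, RingHom.id_apply]
  · exact (hψ a n).trans (hE n μ _ ha)

theorem sub_smul_mem_of_forall {n : ℕ} {hξ : ∀ a ∈ I, ξ a ∈ I}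
    [FiniteDimensional ℂ (A ⧸ (I ^ n).restrictScalars ℂ)] {f : A →ₗ[ℂ] A}
    (h : ∀ μ, ∀ a ∈ weightSpace hξ n μ, f a ∈ I ^ n) (a : A) : f a ∈ I ^ n := by
  have ha : a ∈ ⨆ μ, weightSpace hξ n μ := by rw [iSup_weightSpace]; exact Submodule.mem_top
  induction ha using Submodule.iSup_induction' with
  | mem μ a ha => exact h μ a ha
  | zero => rw [map_zero]; exact zero_mem _
  | add a b _ _ ha hb => rw [map_add]; exact add_mem ha hb

/-- The flow of a vector field preserving a finite-codimensional ideal of definition. -/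
theorem exists_flow (hI : IsAdicComplete I A) (hξ : ∀ a ∈ I, ξ a ∈ I)
    (hfin : ∀ n, FiniteDimensional ℂ (A ⧸ (I ^ n).restrictScalars ℂ)) (s : ℂ) {P : Bivector A}
    {k : ℤ} (hk : IsScaling k P ξ) :
    ∃ φ : A ≃ₐ[ℂ] A, (∀ a, φ (ξ a) = ξ (φ a)) ∧
      ∀ a b, φ (P.1 a b) = Complex.exp (s * k) • P.1 (φ a) (φ b) := by
  have hzero : ∀ a b : A, (∀ n, a - b ∈ I ^ n) → a = b := fun a b h =>
    sub_eq_zero.mp (eq_zero_of_forall_mem_pow (I := I) h)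
  -- Only the semisimple part of ξ is exponentiated. This suffices: the result still commutes with ξ
  -- and has the multiplicative behaviour wanted.
  obtain ⟨ψ, hψ⟩ := exists_weightScaling hI hξ hfin fun μ => Complex.exp (s * μ)
  obtain ⟨ψ', hψ'⟩ := exists_weightScaling hI hξ hfin fun μ => Complex.exp (-s * μ)
  have hinv : ∀ (s : ℂ) (ψ ψ' : A →ₗ[ℂ] A),
      (∀ n μ, ∀ a ∈ weightSpace hξ n μ, ψ a - Complex.exp (s * μ) • a ∈ I ^ n) →
      (∀ n μ, ∀ a ∈ weightSpace hξ n μ, ψ' a - Complex.exp (-s * μ) • a ∈ I ^ n) →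
      ∀ a, ψ (ψ' a) = a := by
    intro s ψ ψ' hψ hψ' a
    refine hzero _ _ fun n => ?_
    refine sub_smul_mem_of_forall (n := n) (hξ := hξ) (f := ψ.comp ψ' - LinearMap.id)
      (fun μ a ha => ?_) a
    have h1 := hψ' n μ a ha
    have h2 : ψ (ψ' a - Complex.exp (-s * μ) • a) ∈ I ^ n := by
      -- An element of Iⁿ is a generalized eigenvector modulo Iⁿ for every eigenvalue; taking 0
      -- shows that ψ preserves Iⁿ.
      have h3 : ψ' a - Complex.exp (-s * μ) • a ∈ weightSpace hξ n 0 :=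
        mem_weightSpace.mpr ⟨0, h1⟩
      have h4 := add_mem (hψ n 0 _ h3) (Submodule.smul_of_tower_mem (I ^ n) (Complex.exp (s * 0)) h1)
      rwa [sub_add_cancel] at h4
    have h3 := add_mem h2 (Submodule.smul_of_tower_mem (I ^ n) (Complex.exp (-s * μ)) (hψ n μ a ha))
    rw [map_sub, map_smul, smul_sub, smul_smul, sub_add_sub_cancel, ← Complex.exp_add, neg_mul,
      neg_add_cancel, Complex.exp_zero, one_smul] at h3
    exact h3
  -- One statement covers the product (κ = 0) and the bracket (κ = k). The hypotheses allow the loss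
  -- of one order, so weights are taken modulo I^(n+1).
  have hbil : ∀ {β : A →ₗ[ℂ] A →ₗ[ℂ] A} {κ : ℂ}
      (hβ : ∀ a b, ξ (β a b) = β (ξ a) b + β a (ξ b) + κ • β a b)
      (hl : ∀ n, ∀ a ∈ I ^ (n + 1), ∀ b, β a b ∈ I ^ n)
      (hr : ∀ n, ∀ a, ∀ b ∈ I ^ (n + 1), β a b ∈ I ^ n) (a b : A),
      ψ (β a b) = Complex.exp (s * κ) • β (ψ a) (ψ b) := by
    intro β κ hβ hl hr a b
    refine hzero _ _ fun n => ?_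
    have ha : a ∈ ⨆ μ, weightSpace hξ (n + 1) μ := by rw [iSup_weightSpace]; exact Submodule.mem_top
    induction ha using Submodule.iSup_induction' with
    | mem μ a ha =>
      have hb : b ∈ ⨆ μ, weightSpace hξ (n + 1) μ := by
        rw [iSup_weightSpace]; exact Submodule.mem_top
      induction hb using Submodule.iSup_induction' with
      | mem ν b hb =>
        obtain ⟨i, hi⟩ := mem_weightSpace.mp ha
        obtain ⟨j, hj⟩ := mem_weightSpace.mp hb
        have h1 := hψ n _ _ (mem_weightSpace.mpr
          ⟨_, shiftField_pow_bilin_mem hξ hβ (hl n) (hr n) hi hj⟩)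
        have h2 : β (ψ a - Complex.exp (s * μ) • a) (ψ b) +
            Complex.exp (s * μ) • β a (ψ b - Complex.exp (s * ν) • b) ∈ I ^ n :=
          add_mem (hl n _ (hψ _ _ _ ha) _)
            (Submodule.smul_of_tower_mem (I ^ n) _ (hr n _ _ (hψ _ _ _ hb)))
        have h3 := sub_mem h1 (Submodule.smul_of_tower_mem (I ^ n) (Complex.exp (s * κ)) h2)
        have h4 : Complex.exp (s * (μ + ν + κ)) =
            Complex.exp (s * κ) * (Complex.exp (s * μ) * Complex.exp (s * ν)) := by
          rw [← Complex.exp_add, ← Complex.exp_add]; ring_nf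
        convert h3 using 1
        simp only [map_sub, map_smul, LinearMap.sub_apply, LinearMap.smul_apply, smul_sub, smul_add,
          smul_smul, h4]
        abel
      | zero => simp
      | add b b' _ _ hb hb' =>
        convert add_mem hb hb' using 1
        simp only [map_add, smul_add]; abel
    | zero => simp
    | add a a' _ _ ha ha' =>
      convert add_mem ha ha' using 1
      simp only [map_add, LinearMap.add_apply, smul_add]; abel
  have hmul : ∀ a b, ψ (a * b) = ψ a * ψ b := fun a b => by
    have := hbil (β := LinearMap.mul ℂ A) (κ := 0) (fun a b => by
        simp only [LinearMap.mul_apply', Derivation.leibniz, smul_eq_mul, zero_smul]; ring)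
      (fun n a ha b => Ideal.mul_mem_right _ _ (Ideal.pow_le_pow_right n.le_succ ha))
      (fun n a b hb => Ideal.mul_mem_left _ _ (Ideal.pow_le_pow_right n.le_succ hb)) a b
    simpa using this
  have hone : ψ 1 = 1 := by
    refine hzero _ _ fun n => ?_
    have := hψ n 0 1 (mem_weightSpace.mpr ⟨1, by
      rw [pow_one, shiftField_apply, Derivation.map_one_eq_zero, zero_smul, sub_zero]
      exact zero_mem _⟩)
    simpa using this
  have h1 := hinv s ψ ψ' hψ hψ'
  have h2 := hinv (-s) ψ' ψ hψ' (by simpa using hψ)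
  refine ⟨AlgEquiv.ofLinearEquiv (LinearEquiv.ofLinearMap ψ ψ' (LinearMap.ext h1) (LinearMap.ext h2))
    hone hmul, fun a => ?_, fun a b => ?_⟩
  · refine hzero _ _ fun n => ?_
    refine sub_smul_mem_of_forall (n := n) (hξ := hξ)
      (f := ψ.comp (ξ : A →ₗ[ℂ] A) - (ξ : A →ₗ[ℂ] A).comp ψ) (fun μ a ha => ?_) a
    have h3 := sub_mem (hψ n μ _ (field_mem_weightSpace ha))
      (derivation_mem_pow hξ n (hψ n μ a ha))
    rw [map_sub, Derivation.map_smul, sub_sub_sub_cancel_right] at h3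
    exact h3
  · exact hbil (fun a b => by linear_combination hk a b)
      (fun n a ha b => bivector_mem_left P n b ha) (fun n a b hb => bivector_mem_right P n a hb) a b

end Weights

/-! ### Removing the scaling factor and passing to orbits -/

section Classification

variable {A A' : Type*} [CommRing A] [Algebra ℂ A] [CommRing A'] [Algebra ℂ A']

/-- Since the residue field is ℂ, finitely many generators of Iⁿ as an ideal span Iⁿ / I^(n+1) over
ℂ. -/
theorem IsGerm.finiteDimensional_quotient [IsNoetherianRing A] {I : Ideal A} (hI : IsGerm I)
    (n : ℕ) : FiniteDimensional ℂ (A ⧸ (I ^ n).restrictScalars ℂ) := by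
  classical
  have h : ∃ S : Finset A, ∀ a, ∃ b ∈ Submodule.span ℂ (S : Set A), a - b ∈ I ^ n := by
    induction n with
    | zero => exact ⟨∅, fun a => ⟨0, zero_mem _, by simp⟩⟩
    | succ n ih =>
      obtain ⟨S, hS⟩ := ih
      obtain ⟨G, hG⟩ := IsNoetherian.noetherian (I ^ n)
      have h1 : ∀ a ∈ I ^ n, ∃ b ∈ Submodule.span ℂ (G : Set A), a - b ∈ I ^ (n + 1) := by
        intro a ha
        rw [← hG] at ha
        induction ha using Submodule.span_induction with
        | mem g hg => exact ⟨g, Submodule.subset_span hg, by simp⟩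
        | zero => exact ⟨0, zero_mem _, by simp⟩
        | add a a' _ _ ha ha' =>
          obtain ⟨b, hb, hab⟩ := ha
          obtain ⟨b', hb', hab'⟩ := ha'
          exact ⟨b + b', add_mem hb hb', by rw [add_sub_add_comm]; exact add_mem hab hab'⟩
        | smul r a ha ih =>
          obtain ⟨b, hb, hab⟩ := ih
          obtain ⟨c, hc⟩ := hI.residue r
          refine ⟨c • b, Submodule.smul_mem _ c hb, ?_⟩
          have h2 : r • a - c • b = (r - algebraMap ℂ A c) * a + algebraMap ℂ A c * (a - b) := by
            rw [Algebra.smul_def c, smul_eq_mul]; ring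
          rw [h2]
          refine add_mem ?_ (Ideal.mul_mem_left _ _ hab)
          rw [pow_succ']
          exact Ideal.mul_mem_mul hc (hG ▸ ha)
      refine ⟨S ∪ G, fun a => ?_⟩
      obtain ⟨b, hb, hab⟩ := hS a
      obtain ⟨b', hb', hab'⟩ := h1 _ hab
      refine ⟨b + b', ?_, by rwa [← sub_sub]⟩
      rw [Finset.coe_union, Submodule.span_union]
      exact add_mem (Submodule.mem_sup_left hb) (Submodule.mem_sup_right hb')
  obtain ⟨S, hS⟩ := h
  refine Module.Finite.of_surjective
    (((I ^ n).restrictScalars ℂ).mkQ.comp (Submodule.span ℂ (S : Set A)).subtype) fun x => ?_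
  obtain ⟨a, rfl⟩ := Submodule.mkQ_surjective _ x
  obtain ⟨b, hb, hab⟩ := hS a
  exact ⟨⟨b, hb⟩, ((Submodule.Quotient.eq _).mpr hab).symm⟩

/-- Tangency to the leaf allows a Hamiltonian correction ξ₀ of ξ preserving the maximal ideal. The
flow attached to ξ₀ fixes ξ₀ and multiplies P by any prescribed nonzero constant, as k ≠ 0. -/
theorem sliceIso_smul [IsFormalGerm A] {k : ℤ} (hk : k ≠ 0) {P : Bivector A} (hP : IsPoisson P)
    {ξ : Derivation ℂ A A} (hξ : IsScaling k P ξ) (ht : LeafTangent P ξ) {r : ℂ} (hr : r ≠ 0) :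
    SliceIso P ξ (algebraMap ℂ A r • P) ξ := by
  have : IsNoetherianRing A := IsFormalGerm.isNoetherianRing
  obtain ⟨f, hf⟩ := ht
  set ξ₀ : Derivation ℂ A A := ξ + hamiltonian P (-f) with hξ₀
  have hξ₀_apply : ∀ a, ξ a = ξ₀ a + P.1 f a := fun a => by
    rw [hξ₀, Derivation.add_apply, hamiltonian_apply, map_neg, LinearMap.neg_apply,
      neg_add_cancel_right]
  have hmem : ∀ a ∈ IsLocalRing.maximalIdeal A, ξ₀ a ∈ IsLocalRing.maximalIdeal A := fun a ha => by
    have := hf a ha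
    rwa [hξ₀_apply, add_sub_cancel_right] at this
  -- The time s is chosen with exp(s k) = r⁻¹, which cancels the factor r in the source bracket.
  have hs : Complex.exp (-Complex.log r / k * k) = r⁻¹ := by
    rw [div_mul_cancel₀ _ (Int.cast_ne_zero.mpr hk), Complex.exp_neg, Complex.exp_log hr]
  obtain ⟨φ, hφ, hφ'⟩ := exists_flow IsFormalGerm.isAdicComplete hmem
    (IsFormalGerm.isGerm A).finiteDimensional_quotient (-Complex.log r / k)
    (hξ.add_hamiltonian hP (-f))
  have h1 : SliceIso P ξ₀ (algebraMap ℂ A r • P) ξ₀ := by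
    refine sliceIso_iff.mpr ⟨φ, fun a b => ?_, 0, fun a => ?_⟩
    · rw [smul_bivector_apply, map_smul, hφ', hs, smul_smul, mul_inv_cancel₀ hr, one_smul]
    · rw [map_zero, LinearMap.zero_apply, add_zero, hφ]
  have h2 : SliceIso (algebraMap ℂ A r • P) ξ (algebraMap ℂ A r • P) ξ₀ :=
    -- For the bracket r P the same Hamiltonian field is generated by r⁻¹ f.
    SliceIso.of_add_hamiltonian _ (r⁻¹ • f) fun a => by
      rw [smul_bivector_apply, map_smul, LinearMap.smul_apply, smul_smul, mul_inv_cancel₀ hr,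
        one_smul, hξ₀_apply]
  exact ((SliceIso.of_add_hamiltonian P f hξ₀_apply).trans h1).trans h2.symm

theorem TotalIso.sliceIso [IsFormalGerm A] [IsFormalGerm A'] {m : ℕ} (hm : 1 ≤ m) {k : ℤ}
    {P : Bivector A} (hP : IsPoisson P) {P' : Bivector A'} (hP' : IsPoisson P')
    {ξ : Derivation ℂ A A} (hξ : IsScaling k P ξ) {ξ' : Derivation ℂ A' A'}
    (hξ' : IsScaling k P' ξ') (ht : k = 0 ∨ LeafTangent P ξ) (h : TotalIso m k P ξ P' ξ') :
    SliceIso P ξ P' ξ' := by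
  obtain ⟨c, hc⟩ := h.exists_sliceIso hm hP hP' hξ hξ'
  by_cases hk : k = 0
  · subst hk
    rwa [zpow_zero, Units.val_one, map_one, one_smul] at hc
  · exact (sliceIso_smul hk hP hξ (ht.resolve_left hk) (Units.ne_zero _)).trans hc

theorem sliceIso_of_sub_mem {P : Bivector A} {ξ ξ' : Derivation ℂ A A}
    (h : ξ - ξ' ∈ hamiltonianFields P) : SliceIso P ξ P ξ' := by
  obtain ⟨f, hf⟩ := h
  refine SliceIso.of_add_hamiltonian P f fun a => ?_
  have h1 : P.1 f a = (ξ - ξ') a := congrArg (fun D : Derivation ℂ A A => D a) hf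
  rw [h1, Derivation.sub_apply, add_sub_cancel]

/-- Passing to classes modulo Hamiltonian fields absorbs f, and φ itself is the group element
carrying the class of ξ' to that of ξ. -/
theorem sliceIso_iff_orbitRel {P : Bivector A} {ξ ξ' : Derivation ℂ A A} :
    SliceIso P ξ P ξ' ↔ MulAction.orbitRel (poissonAut P) (Derivation ℂ A A ⧸ hamiltonianFields P)
      (Submodule.Quotient.mk ξ) (Submodule.Quotient.mk ξ') := by
  have hsmul : ∀ (g : poissonAut P) (D : Derivation ℂ A A),
      g • (Submodule.Quotient.mk D : Derivation ℂ A A ⧸ hamiltonianFields P) =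
        Submodule.Quotient.mk (transport g.1 D) := fun g D => rfl
  rw [MulAction.orbitRel_apply, MulAction.mem_orbit_iff]
  constructor
  · rintro ⟨φ, hφ, f, hf⟩
    refine ⟨⟨φ, hφ⟩, ?_⟩
    rw [hsmul, Submodule.Quotient.eq]
    refine ⟨-φ f, Derivation.ext fun a => ?_⟩
    have h1 : φ.symm (ξ (φ (φ.symm a))) = ξ' (φ.symm a) + P.1 f (φ.symm a) :=
      congrArg (fun D : Derivation ℂ A A => D (φ.symm a)) hf
    have h2 := congrArg φ h1
    rw [map_add, hφ, φ.apply_symm_apply, φ.apply_symm_apply] at h2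
    change P.1 (-φ f) a = transport φ ξ' a - ξ a
    rw [transport_apply, h2, map_neg, LinearMap.neg_apply]
    ring
  · rintro ⟨g, hg⟩
    rw [hsmul, Submodule.Quotient.eq] at hg
    obtain ⟨f, hf⟩ := hg
    refine sliceIso_iff.mpr ⟨g.1, g.2, g.1.symm (-f), fun a => ?_⟩
    have h1 : P.1 f (g.1 a) = g.1 (ξ' (g.1.symm (g.1 a))) - ξ (g.1 a) :=
      congrArg (fun D : Derivation ℂ A A => D (g.1 a)) hf
    rw [g.1.symm_apply_apply] at h1
    rw [map_add, g.2, g.1.apply_symm_apply, map_neg, LinearMap.neg_apply, h1]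
    ring

end Classification

end FormalPoisson

/-! ### The classification theorem -/

theorem theorem3p4 (m : ℕ) (hm : 1 ≤ m) (k : ℤ)
    {A A' : Type*} [CommRing A] [Algebra ℂ A] [FormalPoisson.IsFormalGerm A]
    [CommRing A'] [Algebra ℂ A'] [FormalPoisson.IsFormalGerm A']
    (P : FormalPoisson.Bivector A) (hP : FormalPoisson.IsPoisson P)
    (P' : FormalPoisson.Bivector A') (hP' : FormalPoisson.IsPoisson P') :
    -- classification of pairs
    (∀ (ξ : Derivation ℂ A A) (ξ' : Derivation ℂ A' A'),
      FormalPoisson.IsScaling k P ξ → FormalPoisson.IsScaling k P' ξ' →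
        (FormalPoisson.SliceIso P ξ P' ξ' → FormalPoisson.TotalIso m k P ξ P' ξ') ∧
        ((k = 0 ∨ FormalPoisson.LeafTangent P ξ) →
          (FormalPoisson.TotalIso m k P ξ P' ξ' ↔ FormalPoisson.SliceIso P ξ P' ξ'))) ∧
    -- all Poisson vector fields Hamiltonian
    (FormalPoisson.poissonFields P ≤ FormalPoisson.hamiltonianFields P →
      ∀ ξ ξ' : Derivation ℂ A A,
        FormalPoisson.IsScaling k P ξ → FormalPoisson.IsScaling k P ξ' →
          FormalPoisson.TotalIso m k P ξ P ξ') ∧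
    -- isomorphism classes for a fixed slice
    (∀ (η : Derivation ℂ A A) (hη : FormalPoisson.IsAdmissible k P η),
      ∃ e : Quotient (FormalPoisson.totalSetoid m k P) ≃
          Quotient (FormalPoisson.cosetSetoid k P η),
        ∀ (ξ : Derivation ℂ A A) (hξ : FormalPoisson.IsAdmissible k P ξ),
          e (Quotient.mk _ ⟨ξ, hξ⟩) =
            Quotient.mk _ ⟨Submodule.Quotient.mk ξ, FormalPoisson.mk_mem_etaCoset hη hξ⟩) := by
  refine ⟨fun ξ ξ' hξ hξ' => ⟨fun h => h.totalIso, fun ht =>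
    ⟨fun h => h.sliceIso hm hP hP' hξ hξ' ht, fun h => h.totalIso⟩⟩, fun h ξ ξ' hξ hξ' =>
    (FormalPoisson.sliceIso_of_sub_mem (h fun a b => ?_)).totalIso, fun η hη => ?_⟩
  · have h1 := hξ a b
    have h2 := hξ' a b
    simp only [Derivation.sub_apply, map_sub, LinearMap.sub_apply, Int.cast_zero, zero_smul]
    linear_combination h1 - h2
  -- The two equivalence relations correspond under ξ ↦ ξ + H(S). This gives well-definedness and
  -- injectivity together; surjectivity holds because η + p is admissible for every p in P_k(S).
  · have hrel : ∀ x y : {ξ : Derivation ℂ A A // FormalPoisson.IsAdmissible k P ξ},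
        FormalPoisson.totalSetoid m k P x y ↔ FormalPoisson.cosetSetoid k P η
          ⟨Submodule.Quotient.mk x.1, FormalPoisson.mk_mem_etaCoset hη x.2⟩
          ⟨Submodule.Quotient.mk y.1, FormalPoisson.mk_mem_etaCoset hη y.2⟩ := fun x y =>
      Iff.trans ⟨FormalPoisson.TotalIso.sliceIso hm hP hP x.2.1 y.2.1 x.2.2,
        FormalPoisson.SliceIso.totalIso⟩ FormalPoisson.sliceIso_iff_orbitRel
    refine ⟨Equiv.ofBijective (Quotient.map
      (fun x => ⟨Submodule.Quotient.mk x.1, FormalPoisson.mk_mem_etaCoset hη x.2⟩)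
      fun x y h => (hrel x y).mp h) ⟨?_, ?_⟩, fun ξ hξ => rfl⟩
    · intro x y
      refine Quotient.inductionOn₂ x y fun x y h => ?_
      exact Quotient.sound ((hrel x y).mpr (Quotient.exact h))
    · intro y
      refine Quotient.inductionOn y ?_
      rintro ⟨_, p, hp, rfl⟩
      refine ⟨Quotient.mk _ ⟨η + p, hη.1.add hp.1, ?_⟩, rfl⟩
      rcases hη.2 with h | ⟨f, hf⟩
      · exact Or.inl h
      rcases hp.2 with h | ⟨g, hg⟩
      · exact Or.inl h
      refine Or.inr ⟨f + g, fun a ha => ?_⟩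
      have h1 : (η + p) a - P.1 (f + g) a = (η a - P.1 f a) + (p a - P.1 g a) := by
        simp only [Derivation.add_apply, map_add, LinearMap.add_apply]; ring
      rw [h1]
      exact add_mem (hf a ha) (hg a ha)
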